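/- Let $q\in C^\infty([0,\infty))$ be real-valued, and let $L_0$ be the minimal Sturm–Liouville operator $L_0y=-y''+qy$ in $\mathcal H=L_2(0,\infty)$ (complex-valued functions) with domain $\{y\in\mathcal H\cap H^2_{\rm loc}([0,\infty)) : y(0)=y'(0)=0,\ -y''+qy\in\mathcal H\}$. Assume that $-\frac{d^2}{dx^2}+q$ is in the limit point case at infinity and that $L_0$ is positive definite, i.e. $(L_0y,y)\ge\varkappa\|y\|^2$ on $\mathrm{Dom}\,L_0$ for some $\varkappa>0$. Let $L$ be the Friedrichs extension of $L_0$, $\mathcal K=\mathrm{Ker}\,L_0^*$ and $\Gamma_1=L^{-1}L_0^*-\mathbb I$. Let $\mathfrak L(\mathcal H)$ be the lattice of closed subspaces of $\mathcal H$ (order: inclusion; operations: closed sum, intersection, orthogonal complement; convergence: strong convergence of the orthogonal projections). *Reachable subspaces.* For $T\ge 0$ let $\mathcal U^T=\{u^h(T)\}$, where $h$ runs over the functions in $C^\infty([0,\infty);\mathcal K)$ that vanish near $t=0$, and $u^h\in C^\infty([0,\infty);\mathcal H)$ is the classical solution of $u_{tt}+L_0^*u=0$ $(t>0)$, $u|_{t=0}=u_t|_{t=0}=0$,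 $\Gamma_1u=h$ $(t\ge0)$. Put $\mathfrak U=\{\overline{\mathcal U^T}\}_{T\ge0}$. *Wave isotony.* For a closed subspace $\mathcal G$ put $I^0\mathcal G=\mathcal G$, and for $t>0$ let $I^t\mathcal G$ be the closure of the set of all $$\int_0^tL^{-1/2}\sin\big[(t-s)L^{1/2}\big]g(s)\,ds,\qquad g\in L_2^{\rm loc}([0,\infty);\mathcal G).$$ *Wave spectrum.* Let $\mathfrak L$ be the smallest family of closed subspaces that contains $\mathfrak U$, $\{0\}$ and $\mathcal H$, is closed under the lattice operations (complements included), and is invariant under $I$, i.e. $\{I^t\mathcal G: t\ge 0,\ \mathcal G\in\mathfrak L\}=\mathfrak L$. Let $\mathcal F_I=\{t\mapsto I^t\mathcal G : \mathcal G\in\mathfrak L\}$, and let $\overline{\mathcal F_I}$ be the set of all functions $[0,\infty)\to\mathfrak L(\mathcal H)$ that are pointwise limits of sequences in $\mathcal F_I$, ordered by pointwise inclusion; its least element is the function identically equal to $\{0\}$. Let $\Omega$ be the set of atoms of $\overline{\mathcal F_I}$, i.e. of the elements $\omega\ne0$ such that $0\ne\omega'\le\omega$, $\omega'\in\overline{\mathcal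 F_I}$, implies $\omega'=\omega$. For $x\ge0$ and $t\ge0$ let $\{x\}^t=\{z\in[0,\infty):|z-x|<t\}$, and $\omega_x(t)=L_2(\{x\}^t)$, the subspace of the functions in $\mathcal H$ that vanish almost everywhere outside $\{x\}^t$. Then $\omega_x\in\Omega$ for every $x\ge 0$: the function $\omega_x$ belongs to $\overline{\mathcal F_I}$ and is an atom of it. -/

import Mathlib

open MeasureTheory Filter Topology Set
open scoped ContDiff NNReal InnerProductSpace

noncomputable section

namespace WaveSpectrum

/-! ### Operators in a Hilbert space -/

section Operators

variable {E : Type*} [NormedAddCommGroup E] [InnerProductSpace ℂ E] [CompleteSpace E]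

/-- Positive definiteness: `(A y, y) ≥ κ ‖y‖²` for some `κ > 0` and all `y ∈ Dom A`. As an
inequality between complex numbers this includes that `(A y, y)` is real. -/
def IsPositiveDefinite (A : E →ₗ.[ℂ] E) : Prop :=
  ∃ κ : ℝ, 0 < κ ∧ ∀ y : A.domain,
    (inner ℂ (y : E) (A y)).im = 0 ∧ κ * ‖(y : E)‖ ^ 2 ≤ (inner ℂ (y : E) (A y)).re

/-- The vectors that are limits of sequences `yₙ ∈ Dom A` which are Cauchy in the energy norm:
`(A (yₙ - yₘ), yₙ - yₘ) → 0`. For a positive definite symmetric `A` this is the form domain (the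
completion of `Dom A` in the energy norm, realised in the Hilbert space). -/
def formDomain (A : E →ₗ.[ℂ] E) : Set E :=
  {x | ∃ y : ℕ → A.domain, Tendsto (fun n => (y n : E)) atTop (𝓝 x) ∧
    Tendsto (fun p : ℕ × ℕ => (inner ℂ ((y p.1 - y p.2 : A.domain) : E)
      (A (y p.1 - y p.2))).re) (atTop ×ˢ atTop) (𝓝 0)}

/-- The Friedrichs extension of a densely defined positive definite operator `A`: the restriction
of the adjoint `A*` to the form domain (which is a linear subspace: see `span_formDomain`). -/
def friedrichs (A : E →ₗ.[ℂ] E) : E →ₗ.[ℂ] E :=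
  A.adjoint.domRestrict (Submodule.span ℂ (formDomain A))

/-- For a positive definite operator the span in `friedrichs` adds nothing. -/
theorem span_formDomain (A : E →ₗ.[ℂ] E) (hA : IsPositiveDefinite A) :
    (Submodule.span ℂ (formDomain A) : Set E) = formDomain A := by
  obtain ⟨κ, hκ, hA⟩ := hA
  have hpos : ∀ y : A.domain, 0 ≤ (inner ℂ (y : E) (A y)).re := fun y =>
    le_trans (by positivity) (hA y).2
  have hpar : ∀ a b : A.domain, (inner ℂ ((a + b : A.domain) : E) (A (a + b))).re ≤
      2 * (inner ℂ (a : E) (A a)).re + 2 * (inner ℂ (b : E) (A b)).re := by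
    intro a b
    have h := hpos (a - b)
    simp only [LinearPMap.map_add, LinearPMap.map_sub, Submodule.coe_add, Submodule.coe_sub,
      inner_add_left, inner_add_right, inner_sub_left, inner_sub_right, Complex.add_re,
      Complex.sub_re] at h ⊢
    linarith
  let S : Submodule ℂ E :=
    { carrier := formDomain A
      zero_mem' := ⟨fun _ => 0, by simp, by simp⟩
      add_mem' := by
        rintro x x' ⟨y, hy, hy'⟩ ⟨z, hz, hz'⟩
        refine ⟨fun n => y n + z n, by simpa using hy.add hz, ?_⟩
        have hlim := (hy'.const_mul 2).add (hz'.const_mul 2)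
        rw [mul_zero, add_zero] at hlim
        refine squeeze_zero (fun p => hpos _) (fun p => ?_) hlim
        have := hpar (y p.1 - y p.2) (z p.1 - z p.2)
        rwa [show y p.1 + z p.1 - (y p.2 + z p.2) = y p.1 - y p.2 + (z p.1 - z p.2) by abel]
      smul_mem' := by
        rintro c x ⟨y, hy, hy'⟩
        refine ⟨fun n => c • y n, by simpa using hy.const_smul c, ?_⟩
        have h := hy'.const_mul (‖c‖ ^ 2)
        rw [mul_zero] at h
        refine h.congr fun p => ?_
        rw [← smul_sub, LinearPMap.map_smul, Submodule.coe_smul, inner_smul_left, inner_smul_right,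
          ← mul_assoc, ← Complex.normSq_eq_conj_mul_self, Complex.re_ofReal_mul,
          Complex.normSq_eq_norm_sq] }
  exact congrArg (fun T : Submodule ℂ E => (T : Set E)) (Submodule.span_eq S)

/-- `B` is the bounded everywhere defined inverse of the operator `L`. -/
def IsBoundedInverse (L : E →ₗ.[ℂ] E) (B : E →L[ℂ] E) : Prop :=
  (∀ y : E, ∃ x : L.domain, (x : E) = B y ∧ L x = y) ∧ ∀ x : L.domain, B (L x) = x

open Classical in
/-- The bounded everywhere defined inverse `L⁻¹` of `L` (`0` if there is none; it exists for the
Friedrichs extension of a densely defined positive definite operator). -/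
def boundedInverse (L : E →ₗ.[ℂ] E) : E →L[ℂ] E :=
  if h : ∃ B, IsBoundedInverse L B then h.choose else 0

/-- A bounded inverse is unique, so that `boundedInverse` is it as soon as it exists. -/
theorem boundedInverse_eq {L : E →ₗ.[ℂ] E} {B : E →L[ℂ] E} (h : IsBoundedInverse L B) :
    boundedInverse L = B := by
  have hex : ∃ B, IsBoundedInverse L B := ⟨B, h⟩
  have hs := hex.choose_spec
  rw [boundedInverse, dif_pos hex]
  ext y
  obtain ⟨x, hx, hxy⟩ := h.1 y
  rw [← hx, ← hs.2 x, hxy]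

/-- The boundary operator `Γ₁ = L⁻¹ A* - 1` on `Dom A*`, with `L` the Friedrichs extension. -/
def boundaryMap (A : E →ₗ.[ℂ] E) (y : A.adjoint.domain) : E :=
  boundedInverse (friedrichs A) (A.adjoint y) - y

/-- The smooth boundary controls: `h ∈ C^∞([0,∞); Ker A*)` vanishing near `t = 0`. -/
def IsControl (A : E →ₗ.[ℂ] E) (h : ℝ → E) : Prop :=
  ContDiffOn ℝ ∞ h (Ici 0) ∧
    (∀ t : ℝ, 0 ≤ t → ∃ y : A.adjoint.domain, (y : E) = h t ∧ A.adjoint y = 0) ∧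
    ∃ ε : ℝ, 0 < ε ∧ ∀ t ∈ Icc 0 ε, h t = 0

/-- `u ∈ C^∞([0,∞); E)` is a classical solution of
`u'' + A* u = 0` for `t > 0`, `u(0) = u'(0) = 0`, `Γ₁ u(t) = h(t)` for `t ≥ 0`. -/
structure IsClassicalWave (A : E →ₗ.[ℂ] E) (h u : ℝ → E) : Prop where
  smooth : ContDiffOn ℝ ∞ u (Ici 0)
  init : u 0 = 0
  init_deriv : derivWithin u (Ici 0) 0 = 0
  equation : ∀ t : ℝ, 0 ≤ t → ∃ y : A.adjoint.domain, (y : E) = u t ∧ boundaryMap A y = h t ∧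
    (0 < t → iteratedDerivWithin 2 u (Ici 0) t + A.adjoint y = 0)

/-- The reachable set at the time `T`: the states `u(T)` of the waves with smooth controls. -/
def reachableSet (A : E →ₗ.[ℂ] E) (T : ℝ) : Set E :=
  {y | ∃ h u : ℝ → E, IsControl A h ∧ IsClassicalWave A h u ∧ y = u T}

/-- The reachable subspaces: closures of the reachable sets (which are linear subspaces, so that
taking the span changes nothing), `T ≥ 0`. -/
def reachableSubspaces (A : E →ₗ.[ℂ] E) : Set (ClosedSubmodule ℂ E) :=
  {G | ∃ T : ℝ, 0 ≤ T ∧ G = (Submodule.span ℂ (reachableSet A T)).closure}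

/-- `L^{-1/2} sin(t L^{1/2})` for the Friedrichs extension `L` of `A`. In terms of the bounded
positive operator `B = L⁻¹` it is `f(B)` with `f(b) = b^{1/2} sin(t b^{-1/2})`, `f(0) = 0`,
a continuous function on `[0,∞)`. -/
def sineFamily (A : E →ₗ.[ℂ] E) (t : ℝ) : E →L[ℂ] E :=
  cfc (fun b : ℝ => √b * Real.sin (t / √b)) (boundedInverse (friedrichs A))

/-- The (generalized) solution `v^g(t) = ∫₀ᵗ L^{-1/2} sin((t-s) L^{1/2}) g(s) ds` of
`v'' + L v = g`, `v(0) = v'(0) = 0`. -/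
def duhamel (A : E →ₗ.[ℂ] E) (g : ℝ → E) (t : ℝ) : E :=
  ∫ s in (0 : ℝ)..t, sineFamily A (t - s) (g s)

/-- `g ∈ L₂^loc([0,∞); G)`. -/
def IsSource (G : ClosedSubmodule ℂ E) (g : ℝ → E) : Prop :=
  (∀ T : ℝ, MemLp g 2 (volume.restrict (Ioc 0 T))) ∧
    ∀ᵐ s ∂(volume.restrict (Ioi (0 : ℝ))), g s ∈ G

/-- The set of the states `v^g(t)` with `G`-valued sources `g`. -/
def sourceReachableSet (A : E →ₗ.[ℂ] E) (t : ℝ) (G : ClosedSubmodule ℂ E) : Set E :=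
  {y | ∃ g : ℝ → E, IsSource G g ∧ y = duhamel A g t}

/-- The wave isotony: `I⁰ = id`, and `Iᵗ G` is the closure of the set of states reachable at the
time `t > 0` from `G`-valued sources (a linear subspace, so that taking the span changes
nothing). -/
def waveIsotony (A : E →ₗ.[ℂ] E) (t : ℝ≥0) (G : ClosedSubmodule ℂ E) : ClosedSubmodule ℂ E :=
  if t = 0 then G else (Submodule.span ℂ (sourceReachableSet A t G)).closure

/-! ### Lattices of subspaces, closures and atoms -/

/-- A family of closed subspaces which is invariant under all the lattice operations (`⊔` is the
closure of the sum, `⊓` the intersection) and contains the least and the greatest subspace. -/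
structure IsSubspaceLattice (S : Set (ClosedSubmodule ℂ E)) : Prop where
  bot_mem : ⊥ ∈ S
  top_mem : ⊤ ∈ S
  sup_mem : ∀ G ∈ S, ∀ K ∈ S, G ⊔ K ∈ S
  inf_mem : ∀ G ∈ S, ∀ K ∈ S, G ⊓ K ∈ S
  orthogonal_mem : ∀ G ∈ S, G.orthogonal ∈ S

/-- `S` is invariant under the isotony `I`: `{Iᵗ G | t ≥ 0, G ∈ S} = S`. -/
def IsInvariant (I : ℝ≥0 → ClosedSubmodule ℂ E → ClosedSubmodule ℂ E)
    (S : Set (ClosedSubmodule ℂ E)) : Prop :=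
  {K | ∃ t : ℝ≥0, ∃ G ∈ S, K = I t G} = S

/-- The minimal lattice that contains the family `M` and is invariant under `I`. -/
def minimalLattice (I : ℝ≥0 → ClosedSubmodule ℂ E → ClosedSubmodule ℂ E)
    (M : Set (ClosedSubmodule ℂ E)) : Set (ClosedSubmodule ℂ E) :=
  ⋂₀ {S | IsSubspaceLattice S ∧ M ⊆ S ∧ IsInvariant I S}

/-- The set of functions `t ↦ Iᵗ G`, `G ∈ S`. -/
def isotonyFunctions (I : ℝ≥0 → ClosedSubmodule ℂ E → ClosedSubmodule ℂ E)
    (S : Set (ClosedSubmodule ℂ E)) : Set (ℝ≥0 → ClosedSubmodule ℂ E) :=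
  {f | ∃ G ∈ S, f = fun t => I t G}

/-- Convergence of subspaces: strong convergence of the orthogonal projections. -/
def SubspaceTendsto (G : ℕ → ClosedSubmodule ℂ E) (K : ClosedSubmodule ℂ E) : Prop :=
  ∀ y : E, Tendsto (fun n => (G n).toSubmodule.starProjection y) atTop
    (𝓝 (K.toSubmodule.starProjection y))

/-- The set `F` together with all the pointwise limits of converging sequences in `F`. -/
def sequentialClosure (F : Set (ℝ≥0 → ClosedSubmodule ℂ E)) :
    Set (ℝ≥0 → ClosedSubmodule ℂ E) :=
  {f | ∃ φ : ℕ → ℝ≥0 → ClosedSubmodule ℂ E, (∀ n, φ n ∈ F) ∧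
    ∀ t, SubspaceTendsto (fun n => φ n t) (f t)}

/-- The atoms of a set `P` of subspace-valued functions, ordered pointwise by inclusion, whose
least element is the function `⊥` identically equal to `{0}`. -/
def atoms (P : Set (ℝ≥0 → ClosedSubmodule ℂ E)) : Set (ℝ≥0 → ClosedSubmodule ℂ E) :=
  {f | f ∈ P ∧ f ≠ ⊥ ∧ ∀ g ∈ P, g ≠ ⊥ → g ≤ f → g = f}

/-- The minimal lattice containing the reachable subspaces and invariant under the wave
isotony. -/
def waveLattice (A : E →ₗ.[ℂ] E) : Set (ClosedSubmodule ℂ E) :=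
  minimalLattice (waveIsotony A) (reachableSubspaces A)

/-- The wave spectrum of the operator `A`. -/
def waveSpectrum (A : E →ₗ.[ℂ] E) : Set (ℝ≥0 → ClosedSubmodule ℂ E) :=
  atoms (sequentialClosure (isotonyFunctions (waveIsotony A) (waveLattice A)))

end Operators

/-! ### The Sturm-Liouville operator on the half-line -/

/-- Lebesgue measure on `(0,∞)`. -/
abbrev halfLine : Measure ℝ := volume.restrict (Ioi (0 : ℝ))

/-- The Hilbert space `L₂(0,∞)` of complex-valued functions. -/
abbrev L2Half : Type := Lp ℂ 2 halfLine

/-- `y ∈ H²_loc([0,∞))`: `y` has (a.e.) the representative `u`, continuously differentiable on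
`[0,∞)` with derivative `v`, and `v` is locally absolutely continuous with `v' = w ∈ L₂^loc`. -/
structure IsH2Loc (y u v w : ℝ → ℂ) : Prop where
  ae_eq : y =ᵐ[halfLine] u
  memLp : ∀ R : ℝ, MemLp w 2 (volume.restrict (Ioc 0 R))
  deriv : ∀ x : ℝ, 0 ≤ x → HasDerivWithinAt u (v x) (Ici 0) x
  primitive : ∀ x : ℝ, 0 ≤ x → v x = v 0 + ∫ s in (0 : ℝ)..x, w s

/-- The graph of the minimal Sturm-Liouville operator: pairs `(y, -y'' + q y)` with
`y ∈ L₂ ∩ H²_loc([0,∞))`, `y(0) = y'(0) = 0`, `-y'' + q y ∈ L₂`. -/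
def sturmLiouvilleGraph (q : ℝ → ℝ) : Submodule ℂ (L2Half × L2Half) where
  carrier := {p | ∃ u v w : ℝ → ℂ, IsH2Loc p.1 u v w ∧ u 0 = 0 ∧ v 0 = 0 ∧
    ∀ᵐ x ∂halfLine, p.2 x = -w x + q x * u x}
  zero_mem' := by
    refine ⟨0, 0, 0, ⟨Lp.coeFn_zero _ _ _, fun R => MemLp.zero', fun x _ => ?_, by simp⟩,
      rfl, rfl, ?_⟩
    · exact hasDerivWithinAt_const x (Ici (0 : ℝ)) (0 : ℂ)
    · filter_upwards [Lp.coeFn_zero ℂ 2 halfLine] with x hx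
      simpa using hx
  add_mem' := by
    rintro ⟨y, f⟩ ⟨y', f'⟩ ⟨u, v, w, h, hu, hv, hf⟩ ⟨u', v', w', h', hu', hv', hf'⟩
    have hint : ∀ {w : ℝ → ℂ}, (∀ R : ℝ, MemLp w 2 (volume.restrict (Ioc 0 R))) →
        ∀ x : ℝ, 0 ≤ x → IntervalIntegrable w volume 0 x := fun hw x hx =>
      (intervalIntegrable_iff_integrableOn_Ioc_of_le hx).2 ((hw x).integrable (by norm_num))
    refine ⟨u + u', v + v', w + w', ⟨(Lp.coeFn_add y y').trans (h.ae_eq.add h'.ae_eq),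
      fun R => (h.memLp R).add (h'.memLp R), fun x hx => (h.deriv x hx).add (h'.deriv x hx),
      fun x hx => ?_⟩, by simp [hu, hu'], by simp [hv, hv'], ?_⟩
    · simp only [Pi.add_apply]
      rw [intervalIntegral.integral_add (hint h.memLp x hx) (hint h'.memLp x hx),
        h.primitive x hx, h'.primitive x hx]
      ring
    · filter_upwards [Lp.coeFn_add f f', hf, hf'] with x h1 h2 h3
      rw [Prod.mk_add_mk, h1, Pi.add_apply, h2, h3]
      simp only [Pi.add_apply]
      ring
  smul_mem' := by
    rintro c ⟨y, f⟩ ⟨u, v, w, h, hu, hv, hf⟩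
    refine ⟨c • u, c • v, c • w, ⟨(Lp.coeFn_smul c y).trans (h.ae_eq.const_smul c),
      fun R => (h.memLp R).const_smul c, fun x hx => (h.deriv x hx).const_smul c,
      fun x hx => ?_⟩, by simp [hu], by simp [hv], ?_⟩
    · simp only [Pi.smul_apply]
      rw [intervalIntegral.integral_smul, h.primitive x hx, smul_add]
    · filter_upwards [Lp.coeFn_smul c f, hf] with x h1 h2
      rw [Prod.smul_mk, h1, Pi.smul_apply, h2]
      simp only [Pi.smul_apply, smul_eq_mul]
      ring

/-- The function `-y'' + q y` is determined by `y`: the graph is the graph of an operator. -/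
theorem sturmLiouvilleGraph_functional (q : ℝ → ℝ) (p : L2Half × L2Half)
    (hp : p ∈ sturmLiouvilleGraph q) (h0 : p.1 = 0) : p.2 = 0 := by
  obtain ⟨u, v, w, h, hu, hv, hf⟩ := hp
  have hcont : ContinuousOn u (Ioi 0) := fun x hx =>
    ((h.deriv x (le_of_lt hx)).continuousWithinAt).mono Ioi_subset_Ici_self
  have hae : u =ᵐ[halfLine] (fun _ => (0 : ℂ)) := by
    have h1 := h.ae_eq
    rw [h0] at h1
    exact h1.symm.trans (Lp.coeFn_zero ℂ 2 halfLine)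
  have hu0 : EqOn u (fun _ => 0) (Ioi 0) :=
    Measure.eqOn_open_of_ae_eq hae isOpen_Ioi hcont continuousOn_const
  have hv0 : ∀ x : ℝ, 0 < x → v x = 0 := by
    intro x hx
    have h1 : HasDerivAt u (v x) x := (h.deriv x hx.le).hasDerivAt (Ici_mem_nhds hx)
    have h2 : u =ᶠ[𝓝 x] fun _ => (0 : ℂ) := by
      filter_upwards [Ioi_mem_nhds hx] with z hz using hu0 hz
    exact (h1.congr_of_eventuallyEq h2.symm).unique (hasDerivAt_const x 0)
  have hprim : ∀ x : ℝ, 0 < x → ∫ s in (0 : ℝ)..x, w s = 0 := by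
    intro x hx
    have h1 := h.primitive x hx.le
    rw [hv0 x hx, hv] at h1
    simpa using h1.symm
  have hw : ∀ᵐ x ∂halfLine, w x = 0 := by
    have key : ∀ n : ℕ, ∀ᵐ x : ℝ, x ∈ Ioo (0 : ℝ) n → w x = 0 := by
      intro n
      have hi : IntervalIntegrable w volume 0 n :=
        (intervalIntegrable_iff_integrableOn_Ioc_of_le n.cast_nonneg).2
          ((h.memLp n).integrable (by norm_num))
      filter_upwards [hi.ae_hasDerivAt_integral] with x hx hxn
      have h1 := hx (by rw [uIcc_of_le n.cast_nonneg]; exact ⟨hxn.1.le, hxn.2.le⟩) 0 left_mem_uIcc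
      have h2 : (fun x => ∫ s in (0 : ℝ)..x, w s) =ᶠ[𝓝 x] fun _ => (0 : ℂ) := by
        filter_upwards [Ioi_mem_nhds hxn.1] with z hz using hprim z hz
      exact (h1.congr_of_eventuallyEq h2.symm).unique (hasDerivAt_const x 0)
    rw [ae_restrict_iff' measurableSet_Ioi]
    filter_upwards [ae_all_iff.2 key] with x hx hx0
    obtain ⟨n, hn⟩ := exists_nat_gt x
    exact hx n ⟨hx0, hn⟩
  apply Lp.ext
  filter_upwards [hf, hw, hae, Lp.coeFn_zero ℂ 2 halfLine] with x h1 h2 h3 h4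
  rw [h1, h2, h3, h4]
  simp

/-- The minimal Sturm-Liouville operator `L₀ y = -y'' + q y` in `L₂(0,∞)`. -/
def sturmLiouville (q : ℝ → ℝ) : L2Half →ₗ.[ℂ] L2Half :=
  (sturmLiouvilleGraph q).toLinearPMap

/-- `y` is a solution of `-y'' + q y = z y` on `[0,∞)`. -/
def IsSolution (q : ℝ → ℝ) (z : ℂ) (y : ℝ → ℂ) : Prop :=
  ∃ y' : ℝ → ℂ, ∀ x : ℝ, 0 ≤ x → HasDerivWithinAt y (y' x) (Ici 0) x ∧
    HasDerivWithinAt y' ((q x - z) * y x) (Ici 0) x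

/-- Weyl's limit point case at infinity: for some `z ∈ ℂ` not all the solutions of
`-y'' + q y = z y` are square integrable on `(0,∞)`. -/
def IsLimitPoint (q : ℝ → ℝ) : Prop :=
  ∃ z : ℂ, ∃ y : ℝ → ℂ, IsSolution q z y ∧ ¬ MemLp y 2 halfLine

/-- The subspace `L₂(S)` of the functions in `L₂(0,∞)` that vanish outside `S`. -/
def L2On (S : Set ℝ) : ClosedSubmodule ℂ L2Half where
  carrier := {y | ∀ᵐ x ∂halfLine, x ∉ S → y x = 0}
  zero_mem' := by
    filter_upwards [Lp.coeFn_zero ℂ 2 halfLine] with x hx _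
    simpa using hx
  add_mem' := by
    intro y z hy hz
    simp only [mem_ofPred_eq] at hy hz ⊢
    filter_upwards [hy, hz, Lp.coeFn_add y z] with x h1 h2 h3 hx
    rw [h3, Pi.add_apply, h1 hx, h2 hx, add_zero]
  smul_mem' := by
    intro c y hy
    simp only [mem_ofPred_eq] at hy ⊢
    filter_upwards [hy, Lp.coeFn_smul c y] with x h1 h2 hx
    rw [h2, Pi.smul_apply, h1 hx, smul_zero]
  isClosed' := by
    refine IsSeqClosed.isClosed fun y z hy hz => ?_
    obtain ⟨φ, -, hφ⟩ := (tendstoInMeasure_of_tendsto_Lp hz).exists_seq_tendsto_ae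
    have hy' : ∀ᵐ x ∂halfLine, ∀ n, x ∉ S → y n x = 0 := ae_all_iff.2 fun n => hy n
    change ∀ᵐ x ∂halfLine, x ∉ S → z x = 0
    filter_upwards [hφ, hy'] with x h1 h2 hx
    have h3 : (fun i => y (φ i) x) = fun _ => (0 : ℂ) := funext fun i => h2 (φ i) hx
    rw [h3] at h1
    exact tendsto_nhds_unique h1 tendsto_const_nhds

/-- The metric neighbourhood `S^r = {x ∈ [0,∞) | dist(x, S) < r}` of a set in the half-line. -/
def neighborhood (S : Set ℝ) (r : ℝ) : Set ℝ := Metric.thickening r S ∩ Ici 0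

/-- The function `ω_x(t) = L₂({x}^t)`, `t ≥ 0`. -/
def omega (x : ℝ) : ℝ≥0 → ClosedSubmodule ℂ L2Half :=
  fun t => L2On (neighborhood {x} t)

end WaveSpectrum

end

noncomputable section

namespace WaveSpectrum

/-! ### The inverse of the Friedrichs extension -/

section Friedrichs

variable {E : Type*} [NormedAddCommGroup E] [InnerProductSpace ℂ E]

/-! All the subspaces involved are of the form `L₂(E)`, and the isotony acts on them by metric
neighbourhoods. Let `F` be the essential closure of a measurable `E`, the set of points all of whose
neighbourhoods meet `E ∩ (0,∞)` in positive measure. Then `Iᵗ L₂(E) = L₂(Fᵗ)` for `t > 0`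
(`waveIsotony_L2On`). The inclusion from left to right is finite speed of propagation for `v'' + L v
= g`. Conversely, if `y` is orthogonal to `Iᵗ L₂(E)`, then the time averages over `(-t, t)` of the
wave `S(s) y`, `S(s) = L^{-1/2} sin(s L^{1/2})`, vanish on `E`. Their value and `x`-derivative
vanish on `F`, and uniqueness for the lateral Cauchy problem (in one dimension space and time can be
exchanged) makes `y` vanish at distance less than `t` from `F`.

The reachable subspaces are `L₂(0,T)` (`closure_reachableSet`), by the same two tools. Completeness
is unique continuation from `0`: there the value vanishes by the Dirichlet condition, and the slope
is a functional that vanishes on `Ran L₀`, so orthogonality to the waves with controls in `Ker L₀*`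
annihilates it.

Hence the wave lattice consists of subspaces `L₂(E)` and contains those of the intervals `[a,b)`.
Intervals shrinking to `x` give `ω_x` in the limit. For atomicity, let `0 ≠ g ≤ ω_x` be a limit of
`t ↦ Iᵗ L₂(Eₙ)`. Since `g(t) ≠ 0` for some `t`, the essential closures of infinitely many `Eₙ` meet
a fixed ball; by compactness points of them converge along a subsequence to some `p`. Then `ω_p ≤ g
≤ ω_x` at positive times, which forces `p = x` and `g = ω_x`.

The analysis rests on the bounded operator `B = L⁻¹`. Waves with `L₂` data are averaged in time,
which puts them in the domain of powers of `L`: applying `L` means minus two derivatives on the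
weight. The function `(L⁻² g(s))(r)` of a twice differentiable orbit `g` is then regular enough for
a pointwise argument. Extended oddly in `r` it solves the wave equation on the whole line, and
`eq_zero_of_cauchy_data` treats it by integration along characteristics. -/

theorem IsPositiveDefinite.isSymmetric {A : E →ₗ.[ℂ] E} (hA : IsPositiveDefinite A)
    (x y : A.domain) : inner ℂ (A x) (y : E) = inner ℂ (x : E) (A y) := by
  obtain ⟨κ, -, hA⟩ := hA
  have h0 : ∀ z : A.domain, (inner ℂ (z : E) (A z)).im = 0 := fun z => (hA z).1
  -- Polarization: reality of the form at `x + y` compares the imaginary parts, reality at `x + i y`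
  -- the real parts.
  have h1 := h0 (x + y)
  have h2 := h0 (x + Complex.I • y)
  simp only [LinearPMap.map_add, LinearPMap.map_smul, Submodule.coe_add, Submodule.coe_smul,
    inner_add_left, inner_add_right, inner_smul_left, inner_smul_right, Complex.add_im, Complex.add_re, h0,
    Complex.mul_im, Complex.mul_re, Complex.conj_I, Complex.I_re, Complex.I_im, Complex.neg_re,
    Complex.neg_im] at h1 h2
  have h3 : inner ℂ (A x) (y : E) = (starRingEnd ℂ) (inner ℂ (y : E) (A x)) :=
    (inner_conj_symm _ _).symm
  rw [h3]
  apply Complex.ext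
  · simp only [Complex.conj_re]; linarith
  · simp only [Complex.conj_im]; linarith

/-- The domain of a positive definite operator, as the carrier of the energy norm. -/
def EnergySpace (A : E →ₗ.[ℂ] E) (_ : IsPositiveDefinite A) : Type _ := A.domain

namespace EnergySpace

variable (A : E →ₗ.[ℂ] E) (hA : IsPositiveDefinite A)

instance : AddCommGroup (EnergySpace A hA) := inferInstanceAs (AddCommGroup A.domain)

instance : Module ℂ (EnergySpace A hA) := inferInstanceAs (Module ℂ A.domain)

/-- The underlying element of the domain. -/
def toDomain : EnergySpace A hA ≃ₗ[ℂ] A.domain := LinearEquiv.refl ℂ A.domain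

/-- The energy inner product. -/
@[reducible]
def core : InnerProductSpace.Core ℂ (EnergySpace A hA) where
  inner x y := inner ℂ (toDomain A hA x : E) (A (toDomain A hA y))
  conj_inner_symm x y := by
    rw [inner_conj_symm, hA.isSymmetric]
  re_inner_nonneg x := by
    obtain ⟨κ, hκ, h⟩ := hA
    exact le_trans (by positivity) (h x).2
  add_left x y z := by
    rw [map_add, Submodule.coe_add, inner_add_left]
  smul_left x y r := by
    rw [map_smul, Submodule.coe_smul, inner_smul_left]
  definite x hx := by
    obtain ⟨κ, hκ, h⟩ := hA
    have h1 := (h (toDomain A _ x)).2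
    have h2 : (inner ℂ (toDomain A _ x : E) (A (toDomain A _ x))).re = 0 := congrArg Complex.re hx
    rw [h2] at h1
    have h3 : ‖(toDomain A _ x : E)‖ ^ 2 = 0 := le_antisymm (by
      by_contra h4
      push Not at h4
      nlinarith) (by positivity)
    exact (toDomain A _).map_eq_zero_iff.1 (Subtype.ext (by simpa using h3))

instance : NormedAddCommGroup (EnergySpace A hA) :=
  @InnerProductSpace.Core.toNormedAddCommGroup ℂ _ _ _ _ (core A hA)

instance : InnerProductSpace ℂ (EnergySpace A hA) :=
  InnerProductSpace.ofCore (core A hA).toCore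

theorem inner_eq (x y : EnergySpace A hA) :
    inner ℂ x y = inner ℂ (toDomain A hA x : E) (A (toDomain A hA y)) := rfl

theorem norm_sq_eq (x : EnergySpace A hA) :
    ‖x‖ ^ 2 = (inner ℂ (toDomain A hA x : E) (A (toDomain A hA x))).re := by
  rw [← inner_eq, ← inner_self_eq_norm_sq (𝕜 := ℂ)]
  rfl

end EnergySpace

variable {A : E →ₗ.[ℂ] E} (hA : IsPositiveDefinite A)

include hA

/-- The Cauchy-Schwarz inequality for the energy. -/
theorem IsPositiveDefinite.norm_inner_sq_le (x y : A.domain) :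
    ‖inner ℂ (x : E) (A y)‖ ^ 2 ≤
      (inner ℂ (x : E) (A x)).re * (inner ℂ (y : E) (A y)).re := by
  let ι := (EnergySpace.toDomain A hA).symm
  have h := pow_le_pow_left₀ (norm_nonneg _) (norm_inner_le_norm (𝕜 := ℂ) (ι x) (ι y)) 2
  rwa [mul_pow, EnergySpace.norm_sq_eq, EnergySpace.norm_sq_eq, EnergySpace.inner_eq,
    LinearEquiv.apply_symm_apply, LinearEquiv.apply_symm_apply] at h

variable [CompleteSpace E]

/-- The weak solution of `A* x = f` in the form domain. -/
theorem IsPositiveDefinite.exists_weak_solution (f : E) :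
    ∃ x ∈ formDomain A, ∀ z : A.domain, inner ℂ x (A z) = inner ℂ f (z : E) := by
  obtain ⟨κ, hκ, hκA⟩ := id hA
  let V := EnergySpace A hA
  let ι : V → E := fun x => (EnergySpace.toDomain A hA x : E)
  have hι : ∀ x : V, ‖ι x‖ ≤ (√κ)⁻¹ * ‖x‖ := by
    intro x
    have h1 := (hκA (EnergySpace.toDomain A hA x)).2
    rw [← EnergySpace.norm_sq_eq A hA x] at h1
    have h2 : √κ * ‖ι x‖ ≤ ‖x‖ := by
      refine le_of_sq_le_sq ?_ (norm_nonneg _)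
      rw [mul_pow, Real.sq_sqrt hκ.le]
      exact h1
    rwa [inv_mul_eq_div, le_div_iff₀' (Real.sqrt_pos.2 hκ)]
  -- Riesz representation in the energy completion: pairing with `f` is bounded there because the
  -- energy norm dominates `√κ` times the norm of `E`.
  let F : StrongDual ℂ V := LinearMap.mkContinuous
    ((innerₛₗ ℂ f).comp (A.domain.subtype.comp (EnergySpace.toDomain A hA).toLinearMap))
    (‖f‖ * (√κ)⁻¹) (fun x => by
      refine (norm_inner_le_norm _ _).trans ?_
      rw [mul_assoc]
      exact mul_le_mul_of_nonneg_left (hι x) (norm_nonneg _))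
  let Fc : StrongDual ℂ (UniformSpace.Completion V) :=
    F.extend (UniformSpace.Completion.toComplL (𝕜 := ℂ) (E := V))
  have hFc : ∀ z : V, Fc (z : UniformSpace.Completion V) = F z := fun z =>
    ContinuousLinearMap.extend_eq F (UniformSpace.Completion.denseRange_coe)
      (UniformSpace.Completion.isUniformInducing_coe V) z
  let ξ := (InnerProductSpace.toDual ℂ (UniformSpace.Completion V)).symm Fc
  have hξ : ∀ z : V, inner ℂ ξ (z : UniformSpace.Completion V) = inner ℂ f (ι z) := fun z => by
    rw [InnerProductSpace.toDual_symm_apply, hFc]; rfl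
  -- The representing vector lives in an abstract completion. Its approximants from `Dom A` are
  -- Cauchy in energy, hence in `E`, and their limit in `E` is the solution sought.
  obtain ⟨y', hy', hy⟩ := mem_closure_iff_seq_limit.1
    ((UniformSpace.Completion.denseRange_coe (α := V)).closure_eq ▸ mem_univ ξ)
  choose y hyy using hy'
  obtain rfl : (fun n => (y n : UniformSpace.Completion V)) = y' := funext hyy
  have hcau : CauchySeq y :=
    (UniformSpace.Completion.isUniformInducing_coe V).cauchy_map_iff.1 hy.cauchySeq
  have hdist : Tendsto (fun p : ℕ × ℕ => ‖y p.1 - y p.2‖) (atTop ×ˢ atTop) (𝓝 0) := by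
    have := cauchySeq_iff_tendsto_dist_atTop_0.1 hcau
    rw [prod_atTop_atTop_eq]
    simpa only [dist_eq_norm] using this
  have hcauE : CauchySeq (fun n => ι (y n)) := by
    refine cauchySeq_iff_tendsto_dist_atTop_0.2 ?_
    rw [← prod_atTop_atTop_eq]
    refine squeeze_zero (fun _ => dist_nonneg) (fun p => ?_)
      (by simpa using hdist.const_mul (√κ)⁻¹)
    rw [dist_eq_norm]
    exact hι (y p.1 - y p.2)
  obtain ⟨x, hx⟩ := cauchySeq_tendsto_of_complete hcauE
  refine ⟨x, ⟨fun n => EnergySpace.toDomain A hA (y n), hx, ?_⟩, fun z => ?_⟩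
  · have h2 := hdist.pow 2
    rw [zero_pow two_ne_zero] at h2
    refine h2.congr fun p => ?_
    rw [EnergySpace.norm_sq_eq, map_sub]
  · let ζ : V := (EnergySpace.toDomain A hA).symm z
    have h1 : Tendsto (fun n => inner ℂ (ι (y n)) (A z)) atTop (𝓝 (inner ℂ x (A z))) :=
      hx.inner tendsto_const_nhds
    have h2 : Tendsto (fun n => inner ℂ (y n : UniformSpace.Completion V)
        (ζ : UniformSpace.Completion V)) atTop
        (𝓝 (inner ℂ ξ (ζ : UniformSpace.Completion V))) :=
      hy.inner tendsto_const_nhds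
    rw [hξ] at h2
    refine tendsto_nhds_unique h1 (h2.congr fun n => ?_)
    rw [UniformSpace.Completion.inner_coe]
    rfl

omit [CompleteSpace E] in
/-- The pairing of two vectors in the form domain as a limit. -/
theorem IsPositiveDefinite.tendsto_energy {y : ℕ → A.domain} {x x' f : E}
    (hx' : ∀ z : A.domain, inner ℂ x' (A z) = inner ℂ f (z : E))
    (hy : Tendsto (fun n => (y n : E)) atTop (𝓝 x))
    (hyc : Tendsto (fun p : ℕ × ℕ => (inner ℂ ((y p.1 - y p.2 : A.domain) : E)
      (A (y p.1 - y p.2))).re) (atTop ×ˢ atTop) (𝓝 0)) {y' : ℕ → A.domain}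
    (hy' : Tendsto (fun n => (y' n : E)) atTop (𝓝 x'))
    (hyc' : Tendsto (fun p : ℕ × ℕ => (inner ℂ ((y' p.1 - y' p.2 : A.domain) : E)
      (A (y' p.1 - y' p.2))).re) (atTop ×ˢ atTop) (𝓝 0)) :
    Tendsto (fun n => inner ℂ (y' n : E) (A (y n))) atTop (𝓝 (inner ℂ f x)) := by
  let V := EnergySpace A hA
  let ι : A.domain ≃ₗ[ℂ] V := (EnergySpace.toDomain A hA).symm
  have key : ∀ u : ℕ → A.domain, Tendsto (fun p : ℕ × ℕ =>
      (inner ℂ ((u p.1 - u p.2 : A.domain) : E) (A (u p.1 - u p.2))).re) (atTop ×ˢ atTop) (𝓝 0) →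
      Tendsto (fun p : ℕ × ℕ => ‖ι (u p.1 - u p.2)‖) (atTop ×ˢ atTop) (𝓝 0) ∧
      ∃ C, ∀ n, ‖ι (u n)‖ ≤ C := by
    intro u hu
    have h1 : Tendsto (fun p : ℕ × ℕ => ‖ι (u p.1 - u p.2)‖)
        (atTop ×ˢ atTop) (𝓝 0) := by
      have := hu.sqrt
      rw [Real.sqrt_zero] at this
      refine this.congr fun p => ?_
      rw [← Real.sqrt_sq (norm_nonneg (ι (u p.1 - u p.2))),
        EnergySpace.norm_sq_eq A hA]
      rfl
    refine ⟨h1, ?_⟩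
    have h2 : CauchySeq (fun n => ι (u n)) := by
      refine cauchySeq_iff_tendsto_dist_atTop_0.2 ?_
      rw [← prod_atTop_atTop_eq]
      exact h1.congr fun p => by rw [dist_eq_norm, map_sub]
    obtain ⟨C, hC⟩ := h2.norm_bddAbove
    exact ⟨C, fun n => hC ⟨n, rfl⟩⟩
  obtain ⟨-, C, hC⟩ := key y hyc
  obtain ⟨h1, -⟩ := key y' hyc'
  have hlim : Tendsto (fun n => inner ℂ x' (A (y n))) atTop (𝓝 (inner ℂ f x)) := by
    refine Tendsto.congr (fun n => (hx' (y n)).symm) ?_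
    exact tendsto_const_nhds.inner hy
  have hdiff : Tendsto (fun n => inner ℂ (y' n : E) (A (y n)) - inner ℂ x' (A (y n))) atTop
      (𝓝 0) := by
    rw [Metric.tendsto_atTop]
    intro ε hε
    have h2 : ∀ᶠ p : ℕ × ℕ in atTop ×ˢ atTop,
        ‖ι (y' p.1 - y' p.2)‖ * C < ε / 2 := by
      have := h1.mul_const C
      rw [zero_mul] at this
      exact this.eventually_lt_const (by linarith)
    rw [prod_atTop_atTop_eq, eventually_atTop] at h2
    obtain ⟨⟨N₁, N₂⟩, hN⟩ := h2
    refine ⟨max N₁ N₂, fun n hn => ?_⟩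
    rw [dist_zero_right]
    -- Cauchy-Schwarz for the energy, with the energy norms of `y n` bounded by `C`, is uniform in
    -- `m`; as `m → ∞` it replaces `y' m` by `x'`.
    have h3 : ∀ m ≥ max N₁ N₂,
        ‖inner ℂ (y' n : E) (A (y n)) - inner ℂ (y' m : E) (A (y n))‖ ≤ ε / 2 := by
      intro m hm
      rw [← inner_sub_left]
      refine (norm_inner_le_norm (𝕜 := ℂ) (E := V) (ι (y' n - y' m)) (ι (y n))).trans ?_
      refine (mul_le_mul_of_nonneg_left (hC n) (norm_nonneg _)).trans ?_
      exact (hN (n, m) ⟨le_trans (le_max_left _ _) hn, le_trans (le_max_right _ _) hm⟩).le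
    have h4 : Tendsto (fun m => ‖inner ℂ (y' n : E) (A (y n)) - inner ℂ (y' m : E) (A (y n))‖)
        atTop (𝓝 ‖inner ℂ (y' n : E) (A (y n)) - inner ℂ x' (A (y n))‖) :=
      (tendsto_const_nhds.sub (hy'.inner tendsto_const_nhds)).norm
    have h5 := le_of_tendsto h4 (eventually_atTop.2 ⟨_, h3⟩)
    linarith
  have := hdiff.add hlim
  rw [zero_add] at this
  exact this.congr fun n => by ring

omit [CompleteSpace E] in
/-- Weak solutions in the form domain satisfy the energy estimate and the symmetry. -/
theorem IsPositiveDefinite.weak_solution_symm {x x' f f' : E} (hx : x ∈ formDomain A)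
    (hx' : x' ∈ formDomain A) (hf : ∀ z : A.domain, inner ℂ x (A z) = inner ℂ f (z : E))
    (hf' : ∀ z : A.domain, inner ℂ x' (A z) = inner ℂ f' (z : E)) :
    inner ℂ f' x = inner ℂ x' f := by
  obtain ⟨y, hy, hyc⟩ := hx
  obtain ⟨y', hy', hyc'⟩ := hx'
  have h1 := hA.tendsto_energy hf' hy hyc hy' hyc'
  have h2 := hA.tendsto_energy hf hy' hyc' hy hyc
  have h3 := (Complex.continuous_conj.tendsto _).comp h2
  rw [inner_conj_symm] at h3
  refine tendsto_nhds_unique h1 (h3.congr fun n => ?_)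
  rw [Function.comp, inner_conj_symm, hA.isSymmetric]

omit [CompleteSpace E] in
-- The energies `(yₙ, A yₙ)` of an approximating sequence tend to `(f, x)`, so the lower bound
-- survives the limit. It yields uniqueness, boundedness of the solution map and positivity of
-- `L⁻¹`.
theorem IsPositiveDefinite.weak_solution_pos {κ : ℝ}
    (hκ : ∀ y : A.domain, κ * ‖(y : E)‖ ^ 2 ≤ (inner ℂ (y : E) (A y)).re)
    {x f : E} (hx : x ∈ formDomain A)
    (hf : ∀ z : A.domain, inner ℂ x (A z) = inner ℂ f (z : E)) :
    κ * ‖x‖ ^ 2 ≤ (inner ℂ f x).re := by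
  obtain ⟨y, hy, hyc⟩ := hx
  have h1 := hA.tendsto_energy hf hy hyc hy hyc
  have h2 : Tendsto (fun n => (inner ℂ (y n : E) (A (y n))).re) atTop (𝓝 (inner ℂ f x).re) :=
    (Complex.continuous_re.tendsto _).comp h1
  exact le_of_tendsto_of_tendsto' ((hy.norm.pow 2).const_mul κ) h2 fun n => hκ (y n)

/-- Coercivity gives `‖x‖ ≤ κ⁻¹ ‖f‖`; weak solutions are therefore unique, and any choice of them is
linear and bounded. The weak formulation avoids the adjoint, so density of the domain plays no role
yet. -/
theorem IsPositiveDefinite.exists_inverse :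
    ∃ B : E →L[ℂ] E, (∀ f, B f ∈ formDomain A ∧
      ∀ z : A.domain, inner ℂ (B f) (A z) = inner ℂ f (z : E)) ∧
      ∀ x ∈ formDomain A, ∀ f, (∀ z : A.domain, inner ℂ x (A z) = inner ℂ f (z : E)) →
        B f = x := by
  choose b hbm hb using hA.exists_weak_solution
  obtain ⟨κ, hκ, hκA⟩ := id hA
  have hS : ∀ {x : E}, x ∈ Submodule.span ℂ (formDomain A) ↔ x ∈ formDomain A := by
    intro x
    rw [← SetLike.mem_coe, span_formDomain A hA]
  have hest : ∀ x ∈ formDomain A, ∀ f, (∀ z : A.domain, inner ℂ x (A z) = inner ℂ f (z : E)) →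
      ‖x‖ ≤ κ⁻¹ * ‖f‖ := by
    intro x hx f hf
    have h1 := hA.weak_solution_pos (fun y => (hκA y).2) hx hf
    have h2 : (inner ℂ f x).re ≤ ‖f‖ * ‖x‖ :=
      (Complex.re_le_norm _).trans (norm_inner_le_norm _ _)
    rw [inv_mul_eq_div, le_div_iff₀' hκ]
    rcases (norm_nonneg x).eq_or_lt with h0 | h0
    · rw [← h0]; simp
    · nlinarith
  have huniq : ∀ x ∈ formDomain A, ∀ x' ∈ formDomain A, ∀ f,
      (∀ z : A.domain, inner ℂ x (A z) = inner ℂ f (z : E)) →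
      (∀ z : A.domain, inner ℂ x' (A z) = inner ℂ f (z : E)) → x = x' := by
    intro x hx x' hx' f hf hf'
    have h1 := hest (x - x') (hS.1 (Submodule.sub_mem _ (hS.2 hx) (hS.2 hx'))) 0 (fun z => by
      rw [inner_sub_left, hf, hf', sub_self, inner_zero_left])
    rw [norm_zero, mul_zero] at h1
    exact sub_eq_zero.1 (norm_le_zero_iff.1 h1)
  let B₀ : E →ₗ[ℂ] E :=
    { toFun := b
      map_add' := fun f g => huniq _ (hbm _) _
        (hS.1 (Submodule.add_mem _ (hS.2 (hbm f)) (hS.2 (hbm g)))) (f + g) (hb _) (fun z => by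
          rw [inner_add_left, hb, hb, inner_add_left])
      map_smul' := fun c f => huniq _ (hbm _) _
        (hS.1 (Submodule.smul_mem _ c (hS.2 (hbm f)))) (c • f) (hb _) (fun z => by
          rw [RingHom.id_apply, inner_smul_left, hb, inner_smul_left]) }
  refine ⟨B₀.mkContinuous κ⁻¹ fun f => hest _ (hbm f) f (hb f), fun f => ⟨hbm f, hb f⟩,
    fun x hx f hf => huniq _ (hbm f) _ hx f (hb f) hf⟩

omit hA in
theorem friedrichs_apply {x : (friedrichs A).domain} {y : A.adjoint.domain} (h : (x : E) = y) :
    friedrichs A x = A.adjoint y :=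
  LinearPMap.domRestrict_apply h

variable (hd : Dense (A.domain : Set E))

include hd

theorem IsPositiveDefinite.isBoundedInverse {B : E →L[ℂ] E}
    (h1 : ∀ f, B f ∈ formDomain A ∧ ∀ z : A.domain, inner ℂ (B f) (A z) = inner ℂ f (z : E))
    (h2 : ∀ x ∈ formDomain A, ∀ f, (∀ z : A.domain, inner ℂ x (A z) = inner ℂ f (z : E)) →
        B f = x) : IsBoundedInverse (friedrichs A) B := by
  refine ⟨fun f => ?_, fun x => ?_⟩
  · have hm : B f ∈ A.adjoint.domain :=
      LinearPMap.mem_adjoint_domain_of_exists _ ⟨f, fun z => ((h1 f).2 z).symm⟩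
    refine ⟨⟨B f, Submodule.subset_span (h1 f).1, hm⟩, rfl, ?_⟩
    rw [friedrichs_apply (y := ⟨B f, hm⟩) rfl]
    exact LinearPMap.adjoint_apply_eq hd _ fun z => ((h1 f).2 z).symm
  · have hx := x.2
    have hm : (x : E) ∈ A.adjoint.domain := hx.2
    have hf : (x : E) ∈ formDomain A := by
      rw [← span_formDomain A hA]; exact hx.1
    refine h2 _ hf _ fun z => ?_
    rw [friedrichs_apply (y := ⟨(x : E), hm⟩) rfl]
    exact (LinearPMap.adjoint_isFormalAdjoint hd ⟨(x : E), hm⟩ z).symm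

theorem IsPositiveDefinite.boundedInverse_spec :
    (∀ f, boundedInverse (friedrichs A) f ∈ formDomain A ∧
      ∀ z : A.domain, inner ℂ (boundedInverse (friedrichs A) f) (A z) = inner ℂ f (z : E)) ∧
      ∀ x ∈ formDomain A, ∀ f, (∀ z : A.domain, inner ℂ x (A z) = inner ℂ f (z : E)) →
        boundedInverse (friedrichs A) f = x := by
  obtain ⟨B, h1, h2⟩ := hA.exists_inverse
  rw [boundedInverse_eq (hA.isBoundedInverse hd h1 h2)]
  exact ⟨h1, h2⟩

theorem IsPositiveDefinite.inner_boundedInverse_apply (f : E) (z : A.domain) :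
    inner ℂ (boundedInverse (friedrichs A) f) (A z) = inner ℂ f (z : E) :=
  ((hA.boundedInverse_spec hd).1 f).2 z

theorem IsPositiveDefinite.boundedInverse_mem_formDomain (f : E) :
    boundedInverse (friedrichs A) f ∈ formDomain A :=
  ((hA.boundedInverse_spec hd).1 f).1

theorem IsPositiveDefinite.boundedInverse_mem_adjoint (f : E) :
    boundedInverse (friedrichs A) f ∈ A.adjoint.domain :=
  LinearPMap.mem_adjoint_domain_of_exists _
    ⟨f, fun z => (hA.inner_boundedInverse_apply hd f z).symm⟩

theorem IsPositiveDefinite.adjoint_boundedInverse (f : E) :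
    A.adjoint ⟨boundedInverse (friedrichs A) f, hA.boundedInverse_mem_adjoint hd f⟩ = f :=
  LinearPMap.adjoint_apply_eq hd _ fun z => (hA.inner_boundedInverse_apply hd f z).symm

theorem IsPositiveDefinite.boundedInverse_apply (y : A.domain) :
    boundedInverse (friedrichs A) (A y) = y := by
  refine (hA.boundedInverse_spec hd).2 _ ⟨fun _ => y, tendsto_const_nhds, by simp⟩ _ fun z => ?_
  rw [hA.isSymmetric]

theorem IsPositiveDefinite.isSelfAdjoint_boundedInverse :
    IsSelfAdjoint (boundedInverse (friedrichs A)) := by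
  rw [ContinuousLinearMap.isSelfAdjoint_iff_isSymmetric]
  intro f g
  exact (hA.weak_solution_symm (hA.boundedInverse_mem_formDomain hd g)
    (hA.boundedInverse_mem_formDomain hd f)
    (hA.inner_boundedInverse_apply hd g) (hA.inner_boundedInverse_apply hd f)).symm

end Friedrichs

end WaveSpectrum

end

noncomputable section

namespace WaveSpectrum

/-! ### The sine family -/

section SineFamily

/-- Mean value inequality for a function with derivative `cos (x + z) - cos x`. What matters is a
remainder independent of `x`, hence uniform in the spectral parameter. -/
theorem norm_sin_taylor_le (x h : ℝ) :
    |Real.sin (x + h) - Real.sin x - h * Real.cos x| ≤ h ^ 2 := by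
  have hd : ∀ z ∈ uIcc 0 h, HasDerivWithinAt
      (fun z => Real.sin (x + z) - z * Real.cos x) (Real.cos (x + z) - Real.cos x) (uIcc 0 h) z := by
    intro z _
    have h1 : HasDerivAt (fun z => Real.sin (x + z)) (Real.cos (x + z)) z := by
      simpa using ((hasDerivAt_id z).const_add x).sin
    have h2 : HasDerivAt (fun z : ℝ => z * Real.cos x) (Real.cos x) z := by
      simpa using (hasDerivAt_id z).mul_const (Real.cos x)
    exact (h1.sub h2).hasDerivWithinAt
  have hb : ∀ z ∈ uIcc 0 h, ‖Real.cos (x + z) - Real.cos x‖ ≤ |h| := by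
    intro z hz
    have h1 : |z| ≤ |h| := by simpa using abs_sub_left_of_mem_uIcc hz
    have h2 := Real.abs_cos_sub_cos_le (x + z) x
    rw [add_sub_cancel_left] at h2
    exact h2.trans h1
  have := Convex.norm_image_sub_le_of_norm_hasDerivWithin_le hd hb (convex_uIcc 0 h)
    left_mem_uIcc right_mem_uIcc
  rw [Real.norm_eq_abs, Real.norm_eq_abs, sub_zero, abs_mul_abs_self] at this
  rw [sq]
  convert this using 2
  simp only [add_zero, zero_mul, sub_zero]
  ring

theorem norm_cos_taylor_le (x h : ℝ) :
    |Real.cos (x + h) - Real.cos x + h * Real.sin x| ≤ h ^ 2 := by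
  have := norm_sin_taylor_le (x + Real.pi / 2) h
  rw [add_right_comm, Real.sin_add_pi_div_two, Real.sin_add_pi_div_two,
    Real.cos_add_pi_div_two] at this
  convert this using 2
  ring

/-- The product rule for the application of complex-linear operators depending on a real
parameter. -/
theorem hasDerivAt_clm_apply {E F : Type*} [NormedAddCommGroup E] [NormedSpace ℂ E]
    [NormedAddCommGroup F] [NormedSpace ℂ F] {T : ℝ → E →L[ℂ] F} {T' : E →L[ℂ] F} {g : ℝ → E}
    {g' : E} {t : ℝ} (hT : HasDerivAt T T' t) (hg : HasDerivAt g g' t) :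
    HasDerivAt (fun t => T t (g t)) (T' (g t) + T t g') t := by
  have h := (ContinuousLinearMap.restrictScalarsL ℂ E F ℝ ℝ).hasFDerivAt.comp_hasDerivAt t hT
  exact h.clm_apply hg

/-- At `0` the factor `r` beats the bounded oscillation of `φ (t / r)`. Continuity is essential:
`cfc` takes the default value `0` on functions that are not continuous on the spectrum. -/
theorem continuous_sqrt_mul_comp_div {φ : ℝ → ℝ} (hφ : Continuous φ) (h1 : ∀ x, |φ x| ≤ 1)
    (t : ℝ) : Continuous fun b : ℝ => √b * φ (t / √b) := by
  have h : Continuous fun r : ℝ => r * φ (t / r) := by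
    refine continuous_iff_continuousAt.2 fun r => ?_
    rcases eq_or_ne r 0 with rfl | hr
    · rw [ContinuousAt, zero_mul]
      refine squeeze_zero_norm (fun r => ?_) (a := fun r => |r|) ?_
      · rw [norm_mul, Real.norm_eq_abs, Real.norm_eq_abs]
        exact mul_le_of_le_one_right (abs_nonneg _) (h1 _)
      · simpa using (continuous_abs.tendsto (0 : ℝ))
    · exact continuousAt_id.mul
        (hφ.continuousAt.comp (continuousAt_const.div continuousAt_id hr))
  exact h.comp Real.continuous_sqrt

variable {E : Type*} [NormedAddCommGroup E] [InnerProductSpace ℂ E] [CompleteSpace E]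

/-- The norm of `cfc f B` is at most the supremum of `|f|` on the spectrum, where `b ≤ ‖B‖`. A
remainder quadratic in `s`, uniformly there, thus gives a derivative in operator norm. -/
theorem hasDerivAt_cfc {B : E →L[ℂ] E} {F G : ℝ → ℝ → ℝ}
    (hF : ∀ t, Continuous (F t)) (hG : ∀ t, Continuous (G t)) {C : ℝ} (hC : 0 ≤ C)
    (h : ∀ t s b, b ≤ ‖B‖ → |F (t + s) b - F t b - s * G t b| ≤ C * s ^ 2) (t : ℝ) :
    HasDerivAt (fun t => cfc (F t) B) (cfc (G t) B) t := by
  rw [hasDerivAt_iff_isLittleO_nhds_zero]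
  have hO : (fun s : ℝ => cfc (F (t + s)) B - cfc (F t) B - s • cfc (G t) B) =O[𝓝 0]
      fun s : ℝ => s ^ 2 := by
    refine Asymptotics.IsBigO.of_bound C (Eventually.of_forall fun s => ?_)
    rw [← cfc_const_mul s (G t) B (hG t).continuousOn,
      ← cfc_sub (hf := (hF _).continuousOn) (hg := (hF _).continuousOn),
      ← cfc_sub (fun x => F (t + s) x - F t x) (fun x => s * G t x)
        (hf := ((hF _).sub (hF _)).continuousOn)
        (hg := (continuous_const.mul (hG _)).continuousOn)]
    refine norm_cfc_le (by positivity) fun b hb => ?_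
    rw [Real.norm_eq_abs, Real.norm_eq_abs, abs_of_nonneg (sq_nonneg s)]
    exact h t s b ((le_abs_self b).trans ((spectrum.norm_le_norm_mul_of_mem hb).trans
      (mul_le_of_le_one_right (norm_nonneg _) ContinuousLinearMap.norm_id_le)))
  refine hO.trans_isLittleO ?_
  exact Asymptotics.isLittleO_pow_id one_lt_two

variable (A : E →ₗ.[ℂ] E)

/-- `L⁻¹ cos(t L^{1/2})` for the Friedrichs extension `L` of `A`. -/
def cosineFamily (t : ℝ) : E →L[ℂ] E :=
  cfc (fun b : ℝ => √b * (√b * Real.cos (t / √b))) (boundedInverse (friedrichs A))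

theorem continuous_sineFun (t : ℝ) : Continuous fun b : ℝ => √b * Real.sin (t / √b) :=
  continuous_sqrt_mul_comp_div Real.continuous_sin Real.abs_sin_le_one t

theorem continuous_cosineFun (t : ℝ) : Continuous fun b : ℝ => √b * (√b * Real.cos (t / √b)) :=
  Real.continuous_sqrt.mul (continuous_sqrt_mul_comp_div Real.continuous_cos Real.abs_cos_le_one t)

theorem sineFamily_zero : sineFamily A 0 = 0 := by
  simp [sineFamily]

theorem sineFamily_neg (t : ℝ) : sineFamily A (-t) = -sineFamily A t := by
  rw [sineFamily, sineFamily, ← cfc_neg]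
  congr 1
  ext b
  rw [neg_div, Real.sin_neg, mul_neg]

variable {A} (hA : IsPositiveDefinite A) (hd : Dense (A.domain : Set E))

include hA hd

/-- The Lipschitz constant `1/√b` of `sin (· / √b)` is cancelled by the factor `√b`, whatever `b`
is. -/
theorem norm_sineFamily_sub_le (s t : ℝ) : ‖sineFamily A s - sineFamily A t‖ ≤ |s - t| := by
  have hB := hA.isSelfAdjoint_boundedInverse hd
  rw [sineFamily, sineFamily, ← cfc_sub (hf := (continuous_sineFun _).continuousOn)
    (hg := (continuous_sineFun _).continuousOn)]
  refine norm_cfc_le (abs_nonneg _) fun b _ => ?_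
  rw [← mul_sub, norm_mul, Real.norm_of_nonneg (Real.sqrt_nonneg b), Real.norm_eq_abs]
  rcases (Real.sqrt_nonneg b).eq_or_lt with h | h
  · rw [← h, zero_mul]; exact abs_nonneg _
  · refine (mul_le_mul_of_nonneg_left (Real.abs_sin_sub_sin_le _ _) h.le).trans ?_
    rw [← sub_div, abs_div, abs_of_pos h, mul_div_cancel₀ _ h.ne']

theorem continuous_sineFamily : Continuous (sineFamily A) :=
  (LipschitzWith.of_dist_le_mul (K := 1) fun s t => by
    rw [dist_eq_norm, NNReal.coe_one, one_mul, Real.dist_eq]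
    exact norm_sineFamily_sub_le hA hd s t).continuous

theorem norm_sineFamily_le (t : ℝ) : ‖sineFamily A t‖ ≤ |t| := by
  simpa [sineFamily_zero] using norm_sineFamily_sub_le hA hd t 0

theorem continuous_sineFamily_apply (y : E) : Continuous fun t => sineFamily A t y :=
  (continuous_sineFamily hA hd).clm_apply continuous_const

omit hA hd in
theorem inner_sineFamily (t : ℝ) (x y : E) :
    inner ℂ (sineFamily A t x) y = inner ℂ x (sineFamily A t y) := by
  have h : IsSelfAdjoint (sineFamily A t) :=
    cfc_predicate (R := ℝ) (p := IsSelfAdjoint) _ _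
  exact ContinuousLinearMap.isSelfAdjoint_iff_isSymmetric.1 h x y

theorem boundedInverse_sineFamily (t : ℝ) (y : E) :
    boundedInverse (friedrichs A) (sineFamily A t y) =
      sineFamily A t (boundedInverse (friedrichs A) y) := by
  have h := cfc_commute_cfc id (fun b : ℝ => √b * Real.sin (t / √b))
    (boundedInverse (friedrichs A))
  rw [cfc_id ℝ _ (hA.isSelfAdjoint_boundedInverse hd)] at h
  exact congrArg (fun T : E →L[ℂ] E => T y) h.eq

theorem cosineFamily_zero : cosineFamily A 0 = boundedInverse (friedrichs A) := by
  have hB := hA.isSelfAdjoint_boundedInverse hd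
  -- `√b * √b = b` holds only for `b ≥ 0`, so the spectrum must be known to be nonnegative.
  have hpos : 0 ≤ boundedInverse (friedrichs A) := by
    rw [ContinuousLinearMap.nonneg_iff_isPositive, ContinuousLinearMap.isPositive_def']
    refine ⟨hB, fun f => ?_⟩
    obtain ⟨κ, hκ, h⟩ := id hA
    have := hA.weak_solution_pos (fun y => (h y).2) (hA.boundedInverse_mem_formDomain hd f)
      (hA.inner_boundedInverse_apply hd f)
    rw [ContinuousLinearMap.reApplyInnerSelf, inner_re_symm]
    exact le_trans (by positivity) this
  have h : cosineFamily A 0 = cfc (id : ℝ → ℝ) (boundedInverse (friedrichs A)) := by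
    refine cfc_congr fun b hb => ?_
    have hb0 : 0 ≤ b := spectrum_nonneg_of_nonneg hpos hb
    simp [Real.mul_self_sqrt hb0]
  rw [h, cfc_id ℝ _ hB]

/-- The quadratic remainder of `√b sin(t/√b)` is of size `s²/√b`, not uniform near `b = 0`; the
extra factor `b` contributed by `B` turns it into `√b s²`. The cosine symbol already carries a
factor `b` and needs no help. -/
theorem hasDerivAt_sineFamily (t : ℝ) (y : E) :
    HasDerivAt (fun t => sineFamily A t (boundedInverse (friedrichs A) y))
      (cosineFamily A t y) t := by
  have hB := hA.isSelfAdjoint_boundedInverse hd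
  have h : HasDerivAt (fun t => cfc (fun b : ℝ => √b * Real.sin (t / √b) * b)
      (boundedInverse (friedrichs A))) (cosineFamily A t) t := by
    refine hasDerivAt_cfc (F := fun t b => √b * Real.sin (t / √b) * b) (fun t => (continuous_sineFun t).mul continuous_id)
      (fun t => continuous_cosineFun t) (Real.sqrt_nonneg ‖boundedInverse (friedrichs A)‖)
      (fun t s b hb => ?_) t
    rcases (Real.sqrt_nonneg b).eq_or_lt with h | h
    · simp only [← h]; simp
      positivity
    · have h1 := norm_sin_taylor_le (t / √b) (s / √b)
      have hbb : b = √b * √b := (Real.mul_self_sqrt (Real.sqrt_pos.1 h).le).symm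
      have h2 : √b * Real.sin ((t + s) / √b) * b - √b * Real.sin (t / √b) * b -
          s * (√b * (√b * Real.cos (t / √b))) = √b * √b * √b * (Real.sin (t / √b + s / √b) -
            Real.sin (t / √b) - s / √b * Real.cos (t / √b)) := by
        rw [add_div]
        conv_lhs => rw [show ∀ x y : ℝ, x * b - y * b = x * (√b * √b) - y * (√b * √b) by
          intro x y; rw [← hbb]]
        field_simp
      rw [h2, abs_mul, abs_of_pos (by positivity)]
      refine (mul_le_mul_of_nonneg_left h1 (by positivity)).trans ?_
      rw [div_pow, show √b * √b * √b * (s ^ 2 / √b ^ 2) = √b * s ^ 2 by field_simp]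
      exact mul_le_mul_of_nonneg_right (Real.sqrt_le_sqrt hb) (sq_nonneg s)
  have h3 : (fun t => cfc (fun b : ℝ => √b * Real.sin (t / √b) * b)
      (boundedInverse (friedrichs A))) =
      fun t => sineFamily A t * boundedInverse (friedrichs A) := by
    ext1 t
    rw [cfc_mul _ (fun b => b) _ (continuous_sineFun t).continuousOn
      continuous_id.continuousOn, cfc_id' ℝ _ hB]
    rfl
  rw [h3] at h
  simpa using hasDerivAt_clm_apply h (hasDerivAt_const t y)

theorem hasDerivAt_cosineFamily (t : ℝ) (y : E) :
    HasDerivAt (fun t => cosineFamily A t y) (-sineFamily A t y) t := by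
  have hB := hA.isSelfAdjoint_boundedInverse hd
  have h : HasDerivAt (cosineFamily A) (cfc (fun b : ℝ => -(√b * Real.sin (t / √b)))
      (boundedInverse (friedrichs A))) t := by
    refine hasDerivAt_cfc (G := fun t b => -(√b * Real.sin (t / √b)))
      (fun t => continuous_cosineFun t) (fun t => (continuous_sineFun t).neg) zero_le_one
      (fun t s b hb => ?_) t
    rcases (Real.sqrt_nonneg b).eq_or_lt with h | h
    · simp only [← h]; simp; positivity
    · have h1 := norm_cos_taylor_le (t / √b) (s / √b)
      have h2 : √b * (√b * Real.cos ((t + s) / √b)) - √b * (√b * Real.cos (t / √b)) -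
          s * -(√b * Real.sin (t / √b)) = √b * √b * (Real.cos (t / √b + s / √b) -
            Real.cos (t / √b) + s / √b * Real.sin (t / √b)) := by
        rw [add_div]
        field_simp
        ring
      rw [h2, abs_mul, abs_of_pos (by positivity)]
      refine (mul_le_mul_of_nonneg_left h1 (by positivity)).trans ?_
      rw [div_pow, show √b * √b * (s ^ 2 / √b ^ 2) = 1 * s ^ 2 by field_simp]
  rw [cfc_neg] at h
  simpa [sineFamily] using hasDerivAt_clm_apply h (hasDerivAt_const t y)

theorem dense_range_boundedInverse : DenseRange (boundedInverse (friedrichs A)) :=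
  hd.mono fun y hy => ⟨A ⟨y, hy⟩, hA.boundedInverse_apply hd ⟨y, hy⟩⟩

/-- A vector is determined by the sine family near `0`. -/
theorem inner_eq_zero_of_sineFamily {n y : E} {ε : ℝ} (hε : 0 < ε)
    (h : ∀ s, |s| < ε → inner ℂ n (sineFamily A s y) = 0) : inner ℂ n y = 0 := by
  have key : ∀ δ > 0, ‖inner ℂ n y‖ ≤ 2 * ‖n‖ * δ := by
    intro δ hδ
    obtain ⟨z, hz⟩ := (dense_range_boundedInverse hA hd).exists_dist_lt y hδ
    rw [dist_eq_norm] at hz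
    have hder := hasDerivAt_sineFamily hA hd 0 z
    -- The slopes `s⁻¹ S(s) B z` tend to `B z`, and replacing `B z` by `y` in them costs at most
    -- `δ`, since `‖S(s)‖ ≤ |s|`.
    rw [cosineFamily_zero hA hd, hasDerivAt_iff_tendsto_slope_zero] at hder
    have hlim : Tendsto (fun s : ℝ => ‖inner ℂ n (s⁻¹ • sineFamily A s
        (boundedInverse (friedrichs A) z))‖) (𝓝[≠] 0)
        (𝓝 ‖inner ℂ n (boundedInverse (friedrichs A) z)‖) := by
      refine (tendsto_const_nhds.inner ?_).norm
      simpa [sineFamily_zero] using hder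
    have hle : ∀ᶠ s : ℝ in 𝓝[≠] 0, ‖inner ℂ n (s⁻¹ • sineFamily A s
        (boundedInverse (friedrichs A) z))‖ ≤ ‖n‖ * δ := by
      have : ∀ᶠ s : ℝ in 𝓝[≠] 0, |s| < ε :=
        nhdsWithin_le_nhds ((continuous_abs.tendsto (0 : ℝ)).eventually_lt_const (by simpa))
      filter_upwards [this, self_mem_nhdsWithin] with s hs hs0
      have h1 : inner ℂ n (s⁻¹ • sineFamily A s (boundedInverse (friedrichs A) z)) =
          inner ℂ n (s⁻¹ • sineFamily A s (boundedInverse (friedrichs A) z - y)) := by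
        rw [map_sub, smul_sub, inner_sub_right, ← Complex.coe_smul s⁻¹ (sineFamily A s y),
          inner_smul_right, h s hs, mul_zero, sub_zero]
      rw [h1]
      refine (norm_inner_le_norm _ _).trans (mul_le_mul_of_nonneg_left ?_ (norm_nonneg _))
      rw [norm_smul, norm_inv, Real.norm_eq_abs, inv_mul_le_iff₀ (abs_pos.2 hs0)]
      refine ((sineFamily A s).le_opNorm _).trans ?_
      refine mul_le_mul (norm_sineFamily_le hA hd s) ?_ (norm_nonneg _) (abs_nonneg _)
      rw [norm_sub_rev]; exact hz.le
    have h2 := le_of_tendsto hlim hle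
    have h3 : ‖inner ℂ n (y - boundedInverse (friedrichs A) z)‖ ≤ ‖n‖ * δ :=
      (norm_inner_le_norm _ _).trans (mul_le_mul_of_nonneg_left hz.le (norm_nonneg _))
    calc ‖inner ℂ n y‖ = ‖inner ℂ n (y - boundedInverse (friedrichs A) z) +
        inner ℂ n (boundedInverse (friedrichs A) z)‖ := by rw [← inner_add_right, sub_add_cancel]
      _ ≤ _ := norm_add_le _ _
      _ ≤ 2 * ‖n‖ * δ := by linarith
  by_contra hne
  have hpos := norm_pos_iff.2 hne
  rcases (norm_nonneg n).eq_or_lt with h0 | h0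
  · have := key 1 one_pos
    rw [← h0] at this
    simp at this
    exact hne this
  · have := key (‖inner ℂ n y‖ / (4 * ‖n‖)) (by positivity)
    rw [show 2 * ‖n‖ * (‖inner ℂ n y‖ / (4 * ‖n‖)) = ‖inner ℂ n y‖ / 2 by field_simp; norm_num]
      at this
    linarith

end SineFamily

/-! ### Averaging in time -/

section Mollify

variable {E : Type*} [NormedAddCommGroup E] [InnerProductSpace ℂ E]

/-- The convolution in time of a vector-valued function with a scalar one. -/
def mollify (φ : ℝ → ℝ) (K : ℝ → E) (t : ℝ) : E :=
  convolution φ K (ContinuousLinearMap.lsmul ℝ ℝ) volume t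

theorem mollify_apply (φ : ℝ → ℝ) (K : ℝ → E) (t : ℝ) :
    mollify φ K t = ∫ s, φ s • K (t - s) := rfl

theorem mollify_apply' (φ : ℝ → ℝ) (K : ℝ → E) (t : ℝ) :
    mollify φ K t = ∫ s, φ (t - s) • K s := by
  rw [mollify_apply, ← integral_sub_left_eq_self (fun s => φ s • K (t - s)) volume t]
  simp

theorem integrable_mollify {φ : ℝ → ℝ} (hφ : Continuous φ) (hc : HasCompactSupport φ)
    {K : ℝ → E} (hK : Continuous K) (t : ℝ) : Integrable fun s => φ s • K (t - s) :=
  Continuous.integrable_of_hasCompactSupport (by fun_prop) hc.smul_right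

theorem hasDerivAt_mollify {φ : ℝ → ℝ} (hφ : ContDiff ℝ 1 φ) (hc : HasCompactSupport φ)
    {K : ℝ → E} (hK : LocallyIntegrable K) (t : ℝ) :
    HasDerivAt (mollify φ K) (mollify (deriv φ) K t) t :=
  hc.hasDerivAt_convolution_left _ hφ hK t

theorem mollify_deriv {φ : ℝ → ℝ} (hφ : ContDiff ℝ 1 φ) (hc : HasCompactSupport φ)
    {K K' : ℝ → E} (hK : ∀ t, HasDerivAt K (K' t) t) (hK' : Continuous K') (t : ℝ) :
    mollify (deriv φ) K t = mollify φ K' t := by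
  have hKc : Continuous K := continuous_iff_continuousAt.2 fun t => (hK t).continuousAt
  have hφ' : Continuous (deriv φ) := hφ.continuous_deriv le_rfl
  have h := integral_bilinear_hasDerivAt_right_eq_neg_left_of_integrable
    (L := (ContinuousLinearMap.lsmul ℝ ℝ : ℝ →L[ℝ] E →L[ℝ] E)) (u := φ) (u' := deriv φ)
    (v := fun s => K (t - s)) (v' := fun s => -K' (t - s))
    (fun s _ => (hφ.differentiable one_ne_zero s).hasDerivAt)
    (fun s _ => by
      have := (hK (t - s)).scomp s ((hasDerivAt_id s).const_sub t)
      rw [neg_one_smul] at this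
      exact this)
    (by simpa using (integrable_mollify hφ.continuous hc hK' t).neg)
    (integrable_mollify hφ' hc.deriv hKc t)
    (integrable_mollify hφ.continuous hc hKc t)
  simp only [ContinuousLinearMap.lsmul_apply, smul_neg, integral_neg, neg_inj] at h
  exact h.symm

variable [CompleteSpace E] {A : E →ₗ.[ℂ] E} (hA : IsPositiveDefinite A) (hd : Dense (A.domain : Set E))

include hA hd

/-- Moved under the integral, `B` acts on `y`, and `s ↦ S(s) B y` has the second derivative `-S(s)
y`; two integrations by parts then free `φ` of its derivatives. So averaging in time makes the wave
of an arbitrary `y` smooth with respect to `L`. -/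
theorem boundedInverse_mollify_sineFamily {φ : ℝ → ℝ} (hφ : ContDiff ℝ 2 φ)
    (hc : HasCompactSupport φ) (y : E) (t : ℝ) :
    boundedInverse (friedrichs A) (mollify (deriv (deriv φ)) (fun s => sineFamily A s y) t) =
      -mollify φ (fun s => sineFamily A s y) t := by
  have hφ1 : ContDiff ℝ 1 (deriv φ) := by
    have : ContDiff ℝ (1 + 1) φ := hφ
    exact (contDiff_succ_iff_deriv.1 this).2.2
  have hS : Continuous fun s => sineFamily A s y := continuous_sineFamily_apply hA hd y
  have h1 : boundedInverse (friedrichs A)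
      (mollify (deriv (deriv φ)) (fun s => sineFamily A s y) t) =
      mollify (deriv (deriv φ)) (fun s => sineFamily A s (boundedInverse (friedrichs A) y)) t := by
    rw [mollify_apply, mollify_apply, ← ContinuousLinearMap.integral_comp_comm _
      (integrable_mollify (hφ1.continuous_deriv le_rfl) hc.deriv.deriv hS t)]
    congr 1
    ext1 s
    rw [← Complex.coe_smul, map_smul, boundedInverse_sineFamily hA hd, Complex.coe_smul]
  have hcos : Continuous fun s => cosineFamily A s y :=
    continuous_iff_continuousAt.2 fun t => (hasDerivAt_cosineFamily hA hd t y).continuousAt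
  rw [h1, mollify_deriv hφ1 hc.deriv (fun t => hasDerivAt_sineFamily hA hd t y) hcos,
    mollify_deriv (hφ.of_le one_le_two) hc (fun t => hasDerivAt_cosineFamily hA hd t y) hS.neg,
    mollify_apply, mollify_apply, ← integral_neg]
  simp

end Mollify

end WaveSpectrum

end

noncomputable section

namespace WaveSpectrum

/-! ### Uniqueness for the wave equation in one dimension -/

section CauchyProblem

/-- The solution of `W_ss - W_rr = p W` with zero Cauchy data on the interval `|r - r₀| ≤ T` of the
line `s = 0` vanishes in the characteristic triangle. -/
theorem eq_zero_of_cauchy_data {W Ws Wr p : ℝ → ℝ → ℂ} {r₀ T C M : ℝ}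
    (hW : ∀ r s, HasDerivAt (fun s => W s r) (Ws s r) s)
    (hP : ∀ r s, HasDerivAt (fun s => Ws s (r - s) + Wr s (r - s)) (p s (r - s) * W s (r - s)) s)
    (hQ : ∀ r s, HasDerivAt (fun s => Ws s (r + s) - Wr s (r + s)) (p s (r + s) * W s (r + s)) s)
    (hp : ∀ s r, 0 ≤ s → |r - r₀| ≤ T - s → ‖p s r‖ ≤ C)
    (hM : ∀ s r, 0 ≤ s → |r - r₀| ≤ T - s → ‖W s r‖ ≤ M)
    (h0 : ∀ r, |r - r₀| ≤ T → W 0 r = 0 ∧ Ws 0 r = 0 ∧ Wr 0 r = 0) (s r : ℝ) (hs : 0 ≤ s)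
    (hr : |r - r₀| ≤ T - s) : W s r = 0 := by
  have hC : 0 ≤ C := (norm_nonneg _).trans (hp s r hs hr)
  have hM0 : 0 ≤ M := (norm_nonneg _).trans (hM s r hs hr)
  -- With the weight `exp (lam s)`, two integrations in `s` gain `lam⁻²`; the choice `C / lam² ≤
  -- 1/2` makes each pass halve the bound on `W`.
  obtain ⟨lam, hlam, hlamC⟩ : ∃ l : ℝ, 0 < l ∧ C / l / l ≤ 1 / 2 := by
    refine ⟨2 * C + 2, by linarith, ?_⟩
    rw [div_div, div_le_div_iff₀ (by nlinarith) two_pos]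
    nlinarith
  have step : ∀ N : ℝ, 0 ≤ N →
      (∀ s r, 0 ≤ s → |r - r₀| ≤ T - s → ‖W s r‖ ≤ N * Real.exp (lam * s)) →
      ∀ s r, 0 ≤ s → |r - r₀| ≤ T - s → ‖W s r‖ ≤ N / 2 * Real.exp (lam * s) := by
    intro N hN hb
    have hexp : ∀ K s : ℝ, HasDerivAt (fun s => K / lam * Real.exp (lam * s))
        (K * Real.exp (lam * s)) s := by
      intro K s
      have h1 : HasDerivAt (fun s : ℝ => lam * s) lam s := by
        simpa using (hasDerivAt_id s).const_mul lam
      have := (h1.exp).const_mul (K / lam)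
      convert! this using 1
      field_simp
    -- One integration along a characteristic that stays in the triangle and starts from the value
    -- zero.
    have hchar : ∀ (f : ℝ → ℂ) (r : ℝ → ℝ) (s₁ : ℝ), 0 ≤ s₁ →
        (∀ s ∈ Icc 0 s₁, |r s - r₀| ≤ T - s) → f 0 = 0 →
        (∀ s, HasDerivAt f (p s (r s) * W s (r s)) s) →
        ‖f s₁‖ ≤ C * N / lam * Real.exp (lam * s₁) := by
      intro f r s₁ hs₁ hr hf0 hf
      refine image_norm_le_of_norm_deriv_right_le_deriv_boundary (a := 0) (b := s₁)
        (fun s _ => (hf s).continuousAt.continuousWithinAt) (fun s _ => (hf s).hasDerivWithinAt)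
        (B := fun s => C * N / lam * Real.exp (lam * s)) ?_ (fun s => hexp (C * N) s)
        (fun s hs => ?_) (right_mem_Icc.2 hs₁)
      · rw [hf0, norm_zero]; positivity
      · have hs' := hr s ⟨hs.1, hs.2.le⟩
        rw [norm_mul, mul_assoc]
        exact mul_le_mul (hp s _ hs.1 hs') (hb s _ hs.1 hs') (norm_nonneg _) hC
    -- Both characteristics through `(s, r)` run back to the base inside the triangle, and `Ws` is
    -- half the sum of the two characteristic derivatives of `W`.
    have hWs : ∀ s r, 0 ≤ s → |r - r₀| ≤ T - s →
        ‖Ws s r‖ ≤ C * N / lam * Real.exp (lam * s) := by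
      intro s r hs hr
      rw [abs_le] at hr
      have h1 : ‖Ws s (r + s - s) + Wr s (r + s - s)‖ ≤ C * N / lam * Real.exp (lam * s) := by
        refine hchar (fun σ => Ws σ (r + s - σ) + Wr σ (r + s - σ)) (fun σ => r + s - σ) s hs
          (fun σ hσ => ?_) ?_ (fun σ => hP (r + s) σ)
        · rw [abs_le]; constructor <;> linarith [hσ.1, hσ.2]
        · have := h0 (r + s - 0) (by rw [abs_le]; constructor <;> linarith)
          simp only [this.2.1, this.2.2, add_zero]
      have h2 : ‖Ws s (r - s + s) - Wr s (r - s + s)‖ ≤ C * N / lam * Real.exp (lam * s) := by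
        refine hchar (fun σ => Ws σ (r - s + σ) - Wr σ (r - s + σ)) (fun σ => r - s + σ) s hs
          (fun σ hσ => ?_) ?_ (fun σ => hQ (r - s) σ)
        · rw [abs_le]; constructor <;> linarith [hσ.1, hσ.2]
        · have := h0 (r - s + 0) (by rw [abs_le]; constructor <;> linarith)
          simp only [this.2.1, this.2.2, sub_zero]
      rw [add_sub_cancel_right] at h1
      rw [sub_add_cancel] at h2
      have h3 : Ws s r = (1 / 2 : ℂ) * ((Ws s r + Wr s r) + (Ws s r - Wr s r)) := by ring
      rw [h3, norm_mul]
      have h4 := norm_add_le (Ws s r + Wr s r) (Ws s r - Wr s r)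
      have h5 : ‖(1 / 2 : ℂ)‖ = 1 / 2 := by norm_num
      rw [h5]
      linarith
    intro s₁ r hs₁ hr
    have h1 : ‖W s₁ r‖ ≤ C * N / lam / lam * Real.exp (lam * s₁) := by
      refine image_norm_le_of_norm_deriv_right_le_deriv_boundary (a := 0) (b := s₁)
        (f := fun s => W s r) (f' := fun s => Ws s r)
        (fun s _ => (hW r s).continuousAt.continuousWithinAt)
        (fun s _ => (hW r s).hasDerivWithinAt)
        (B := fun s => C * N / lam / lam * Real.exp (lam * s)) ?_
        (fun s => hexp (C * N / lam) s) (fun s hs => ?_) (right_mem_Icc.2 hs₁)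
      · rw [(h0 r (hr.trans (by linarith))).1, norm_zero]; positivity
      · exact hWs s r hs.1 (hr.trans (by linarith [hs.2]))
    refine h1.trans (mul_le_mul_of_nonneg_right ?_ (Real.exp_pos _).le)
    calc C * N / lam / lam = C / lam / lam * N := by ring
      _ ≤ 1 / 2 * N := mul_le_mul_of_nonneg_right hlamC hN
      _ = N / 2 := by ring
  have hall : ∀ n : ℕ, ∀ s r, 0 ≤ s → |r - r₀| ≤ T - s →
      ‖W s r‖ ≤ M * (1 / 2) ^ n * Real.exp (lam * s) := by
    intro n
    induction n with
    | zero =>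
      intro s r hs hr
      rw [pow_zero, mul_one]
      refine (hM s r hs hr).trans (le_mul_of_one_le_right hM0 (Real.one_le_exp (by positivity)))
    | succ n ih =>
      intro s r hs hr
      have := step _ (by positivity) ih s r hs hr
      rwa [pow_succ, ← mul_assoc, mul_one_div]
  have hlim : Tendsto (fun n : ℕ => M * (1 / 2) ^ n * Real.exp (lam * s)) atTop (𝓝 0) := by
    have := ((tendsto_pow_atTop_nhds_zero_of_lt_one (r := (1 / 2 : ℝ)) (by norm_num)
      (by norm_num)).const_mul M).mul_const (Real.exp (lam * s))
    simpa using this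
  exact norm_le_zero_iff.1 (ge_of_tendsto' hlim fun n => hall n s r hs hr)

end CauchyProblem

end WaveSpectrum

end

noncomputable section

namespace WaveSpectrum

/-! ### The Sturm-Liouville equation with square integrable data -/

section Ode

/-- The solution of `y'' = h`, `y(0) = y'(0) = 0`. -/
def secondPrimitive (h : ℝ → ℂ) (x : ℝ) : ℂ := ∫ s in Ioc 0 x, (x - s) • h s

/-- A fixed domain of integration and a kernel that is 1-Lipschitz in `x`: the form suited to
differentiation under the integral and to Fubini. -/
theorem secondPrimitive_eq {h : ℝ → ℂ} {x R : ℝ} (hx : x ≤ R) :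
    secondPrimitive h x = ∫ s in Ioc 0 R, max (x - s) 0 • h s := by
  rw [secondPrimitive, setIntegral_eq_of_subset_of_forall_sdiff_eq_zero measurableSet_Ioc
    (Ioc_subset_Ioc_right hx)]
  · refine setIntegral_congr_fun measurableSet_Ioc fun s hs => ?_
    simp only [max_eq_left (sub_nonneg.2 hs.2)]
  · intro s hs
    have : x ≤ s := by
      by_contra h
      exact hs.2 ⟨hs.1.1, (not_le.1 h).le⟩
    rw [max_eq_right (sub_nonpos.2 this), zero_smul]

theorem secondPrimitive_of_nonpos (h : ℝ → ℂ) {x : ℝ} (hx : x ≤ 0) : secondPrimitive h x = 0 := by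
  rw [secondPrimitive, Ioc_eq_empty (not_lt.2 hx), Measure.restrict_empty, integral_zero_measure]

theorem integrableOn_max_smul {h : ℝ → ℂ} {R : ℝ} (hh : IntegrableOn h (Ioc 0 R)) (x : ℝ) :
    IntegrableOn (fun s => max (x - s) 0 • h s) (Ioc 0 R) := by
  refine Integrable.bdd_smul (φ := fun s : ℝ => max (x - s) 0) hh (|x| + |R|)
    (Continuous.aestronglyMeasurable (by fun_prop)) ?_
  filter_upwards [ae_restrict_mem measurableSet_Ioc] with s hs
  rw [Real.norm_eq_abs, abs_le]
  have h1 := le_abs_self x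
  have h2 := abs_nonneg x
  have h3 := abs_nonneg R
  constructor
  · exact le_trans (by linarith) (le_max_right _ _)
  · exact max_le (by linarith [hs.1]) (by linarith)

/-- Domination by `‖h‖`: the kernel fails to be differentiable in `x` only at `s = x`, a null set,
so local integrability of `h` is enough. -/
theorem hasDerivAt_secondPrimitive {h : ℝ → ℂ} (hh : ∀ R, IntegrableOn h (Ioc 0 R)) (x : ℝ) :
    HasDerivAt (secondPrimitive h) (∫ s in Ioc 0 x, h s) x := by
  have h1 : secondPrimitive h =ᶠ[𝓝 x] fun y => ∫ s in Ioc 0 (x + 1), max (y - s) 0 • h s := by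
    filter_upwards [Iio_mem_nhds (lt_add_one x)] with y hy
    exact secondPrimitive_eq (le_of_lt hy)
  refine HasDerivAt.congr_of_eventuallyEq ?_ h1
  have h2 := (hasDerivAt_integral_of_dominated_loc_of_lip
    (μ := volume.restrict (Ioc 0 (x + 1))) (F := fun y s => max (y - s) 0 • h s)
    (F' := (Iio x).indicator h) (x₀ := x) (s := univ) (bound := fun s => ‖h s‖) univ_mem
    (Eventually.of_forall fun y => (integrableOn_max_smul (hh _) y).aestronglyMeasurable)
    (integrableOn_max_smul (hh _) x)
    ((hh _).aestronglyMeasurable.indicator measurableSet_Iio)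
    (Eventually.of_forall fun s => by
      refine LipschitzOnWith.of_dist_le_mul fun y _ y' _ => ?_
      rw [dist_eq_norm, ← sub_smul, norm_smul, Real.dist_eq, mul_comm]
      simp only [Real.coe_nnabs, abs_norm]
      refine mul_le_mul_of_nonneg_left ?_ (norm_nonneg _)
      rw [Real.norm_eq_abs]
      refine (abs_max_sub_max_le_abs _ _ _).trans ?_
      rw [sub_sub_sub_cancel_right])
    (hh _).norm ?_).2
  · rw [setIntegral_indicator measurableSet_Iio] at h2
    convert h2 using 1
    refine setIntegral_congr_set ?_
    have h3 : Ioc 0 (x + 1) ∩ Iio x = Ioo 0 x := by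
      ext s
      simp only [mem_inter_iff, mem_Ioc, mem_Iio, mem_Ioo]
      constructor
      · rintro ⟨h, h'⟩; exact ⟨h.1, h'⟩
      · rintro ⟨h, h'⟩; exact ⟨⟨h, by linarith⟩, h'⟩
    rw [h3]
    exact Ioo_ae_eq_Ioc.symm
  · have h4 : ∀ᵐ s : ℝ ∂(volume.restrict (Ioc 0 (x + 1))), s ≠ x :=
      ae_restrict_of_ae (Measure.ae_ne volume x)
    filter_upwards [h4] with s hs
    rcases lt_or_gt_of_ne hs with h5 | h5
    · rw [indicator_of_mem (mem_Iio.2 h5)]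
      have : (fun y => max (y - s) 0 • h s) =ᶠ[𝓝 x] fun y => (y - s) • h s := by
        filter_upwards [Ioi_mem_nhds h5] with y hy
        rw [max_eq_left (sub_nonneg.2 (le_of_lt hy))]
      refine HasDerivAt.congr_of_eventuallyEq ?_ this
      simpa using ((hasDerivAt_id x).sub_const s).smul_const (h s)
    · rw [indicator_of_notMem (by simpa using h5.le)]
      have : (fun y => max (y - s) 0 • h s) =ᶠ[𝓝 x] fun y => (0 : ℂ) := by
        filter_upwards [Iio_mem_nhds h5] with y hy
        rw [max_eq_right (sub_nonpos.2 (le_of_lt hy)), zero_smul]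
      exact (hasDerivAt_const x (0 : ℂ)).congr_of_eventuallyEq this

theorem continuous_secondPrimitive {h : ℝ → ℂ} (hh : ∀ R, IntegrableOn h (Ioc 0 R)) :
    Continuous (secondPrimitive h) :=
  continuous_iff_continuousAt.2 fun x => (hasDerivAt_secondPrimitive hh x).continuousAt

/-- The solution of `z'' = w` that vanishes to the right of the support of `w`. -/
def backwardPrimitive (R : ℝ) (w : ℝ → ℝ) (x : ℝ) : ℝ := ∫ s in Ioc 0 R, max (s - x) 0 * w s

/-- Fubini: the transpose of integrating twice from `0` is integrating twice backwards from `R`. -/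
theorem integral_smul_secondPrimitive {w : ℝ → ℝ} {h : ℝ → ℂ} {R : ℝ}
    (hw : IntegrableOn w (Ioc 0 R)) (hh : IntegrableOn h (Ioc 0 R)) :
    ∫ x in Ioc 0 R, w x • secondPrimitive h x =
      ∫ s in Ioc 0 R, backwardPrimitive R w s • h s := by
  have h1 : ∫ x in Ioc 0 R, w x • secondPrimitive h x =
      ∫ x in Ioc 0 R, ∫ s in Ioc 0 R, (max (x - s) 0 * w x) • h s := by
    refine setIntegral_congr_fun measurableSet_Ioc fun x hx => ?_
    rw [secondPrimitive_eq hx.2, ← integral_smul]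
    congr 1
    ext1 s
    rw [smul_smul, mul_comm]
  have h2 : ∫ s in Ioc 0 R, backwardPrimitive R w s • h s =
      ∫ s in Ioc 0 R, ∫ x in Ioc 0 R, (max (x - s) 0 * w x) • h s := by
    refine setIntegral_congr_fun measurableSet_Ioc fun s _ => ?_
    simp only [backwardPrimitive]
    rw [integral_smul_const]
  rw [h1, h2]
  refine integral_integral_swap ?_
  have h3 : Integrable (fun p : ℝ × ℝ => w p.1 • h p.2)
      ((volume.restrict (Ioc 0 R)).prod (volume.restrict (Ioc 0 R))) :=
    Integrable.smul_prod hw hh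
  have h4 : Integrable (fun p : ℝ × ℝ => max (p.1 - p.2) 0 • (w p.1 • h p.2))
      ((volume.restrict (Ioc 0 R)).prod (volume.restrict (Ioc 0 R))) := by
    refine Integrable.bdd_smul (φ := fun p : ℝ × ℝ => max (p.1 - p.2) 0) h3 |R|
      (Continuous.aestronglyMeasurable (by fun_prop)) ?_
    rw [Measure.prod_restrict]
    filter_upwards [ae_restrict_mem (measurableSet_Ioc.prod measurableSet_Ioc)] with p hp
    rw [Real.norm_eq_abs, abs_le]
    have h1 := le_abs_self R
    have h2 := abs_nonneg R
    exact ⟨le_trans (by linarith) (le_max_right _ _),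
      max_le (by linarith [hp.1.2, hp.2.1]) h2⟩
  refine h4.congr (Eventually.of_forall fun p => ?_)
  simp only [Function.uncurry]
  rw [smul_smul]

/-- A bounded function on `(0,R]` that is orthogonal to the affine functions. -/
structure IsTest (R : ℝ) (w : ℝ → ℝ) : Prop where
  measurable : Measurable w
  bounded : ∃ C, ∀ x, |w x| ≤ C
  support : ∀ x, x ∉ Ioc 0 R → w x = 0

namespace IsTest

variable {R : ℝ} {w : ℝ → ℝ}

theorem integrableOn (hw : IsTest R w) (R' : ℝ) : IntegrableOn w (Ioc 0 R') := by
  obtain ⟨C, hC⟩ := hw.bounded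
  exact Measure.integrableOn_of_bounded (M := C) measure_Ioc_lt_top.ne
    hw.measurable.aestronglyMeasurable (Eventually.of_forall hC)

theorem sub {w' : ℝ → ℝ} (hw : IsTest R w) (hw' : IsTest R w') :
    IsTest R (fun x => w x - w' x) := by
  obtain ⟨C, hC⟩ := hw.bounded
  obtain ⟨C', hC'⟩ := hw'.bounded
  exact ⟨hw.measurable.sub hw'.measurable, ⟨C + C', fun x =>
    (abs_sub _ _).trans (add_le_add (hC x) (hC' x))⟩, fun x hx => by
      simp only [hw.support x hx, hw'.support x hx, sub_zero]⟩

theorem const_mul (hw : IsTest R w) (c : ℝ) : IsTest R (fun x => c * w x) := by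
  obtain ⟨C, hC⟩ := hw.bounded
  exact ⟨hw.measurable.const_mul c, ⟨|c| * C, fun x => by
    rw [abs_mul]; exact mul_le_mul_of_nonneg_left (hC x) (abs_nonneg c)⟩, fun x hx => by
      simp only [hw.support x hx, mul_zero]⟩

theorem indicator {S : Set ℝ} (hS : MeasurableSet S) (hSR : S ⊆ Ioc 0 R) :
    IsTest R (S.indicator 1) := by
  refine ⟨measurable_one.indicator hS, ⟨1, fun x => ?_⟩, fun x hx =>
    indicator_of_notMem (fun h => hx (hSR h)) _⟩
  by_cases h : x ∈ S <;> simp [h]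

/-- The affine function `a + b x` cut off at `1`. -/
theorem affine (hR : 1 ≤ R) (a b : ℝ) :
    IsTest R ((Ioc (0 : ℝ) 1).indicator fun x => a + b * x) := by
  refine ⟨(by fun_prop : Measurable fun x : ℝ => a + b * x).indicator measurableSet_Ioc,
    ⟨|a| + |b|, fun x => ?_⟩, fun x hx =>
    indicator_of_notMem (fun h => hx ⟨h.1, h.2.trans hR⟩) _⟩
  by_cases h : x ∈ Ioc (0 : ℝ) 1
  · rw [indicator_of_mem h]
    refine (abs_add_le _ _).trans (add_le_add_right ?_ _)
    rw [abs_mul, abs_of_pos h.1]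
    exact mul_le_of_le_one_right (abs_nonneg b) h.2
  · rw [indicator_of_notMem h, abs_zero]; positivity

end IsTest

theorem abs_backwardPrimitive_le {R R' C : ℝ} {w : ℝ → ℝ} (hR : 0 ≤ R') (hw : IsTest R' w)
    (hC : ∫ s in Ioc 0 R, |w s| ≤ C) {x : ℝ} (hx : 0 ≤ x) :
    |backwardPrimitive R w x| ≤ R' * C := by
  rw [backwardPrimitive, ← Real.norm_eq_abs]
  refine (norm_integral_le_integral_norm _).trans ?_
  refine le_trans ?_ (mul_le_mul_of_nonneg_left hC hR)
  rw [← integral_const_mul]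
  refine integral_mono_of_nonneg (Eventually.of_forall fun s => norm_nonneg _)
    ((hw.integrableOn R).abs.const_mul R') ?_
  filter_upwards [ae_restrict_mem measurableSet_Ioc] with s hs
  rw [norm_mul, Real.norm_of_nonneg (le_max_right _ _), Real.norm_eq_abs]
  rcases le_or_gt s R' with h | h
  · exact mul_le_mul_of_nonneg_right (max_le (by linarith) hR) (abs_nonneg _)
  · rw [hw.support s (fun h' => not_lt.2 h'.2 h), abs_zero, mul_zero, mul_zero]

theorem backwardPrimitive_eq_zero {R x : ℝ} (w : ℝ → ℝ) (hx : R ≤ x) :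
    backwardPrimitive R w x = 0 := by
  rw [backwardPrimitive, setIntegral_congr_fun measurableSet_Ioc (g := fun _ => (0 : ℝ))]
  · simp
  · intro s hs
    simp only [max_eq_right (show s - x ≤ 0 by linarith [hs.2]), zero_mul]

theorem continuous_backwardPrimitive {R : ℝ} {w : ℝ → ℝ} (hw : IsTest R w) :
    Continuous (backwardPrimitive R w) := by
  rw [continuous_iff_continuousAt]
  intro x
  refine continuousAt_of_dominated (bound := fun s => (|x| + 1 + |R|) * |w s|) ?_ ?_
    ((hw.integrableOn R).abs.const_mul _) (Eventually.of_forall fun s => by fun_prop)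
  · exact Eventually.of_forall fun y => ((by fun_prop : Continuous fun s : ℝ => max (s - y) 0)
      |>.aestronglyMeasurable.mul hw.measurable.aestronglyMeasurable)
  · filter_upwards [Metric.ball_mem_nhds x one_pos] with y hy
    filter_upwards [ae_restrict_mem measurableSet_Ioc] with s hs
    rw [norm_mul, Real.norm_eq_abs, Real.norm_eq_abs]
    refine mul_le_mul_of_nonneg_right ?_ (abs_nonneg _)
    rw [Metric.mem_ball, Real.dist_eq] at hy
    have h1 : |y| ≤ |x| + 1 := by
      have := abs_add_le (y - x) x
      rw [sub_add_cancel] at this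
      linarith
    have h2 := le_abs_self R
    have h3 := neg_abs_le y
    have h4 := abs_nonneg y
    rw [abs_of_nonneg (le_max_right _ _)]
    exact max_le (by linarith [hs.2]) (by positivity)

/-- The two kernels differ by an affine function, `max (s - x) 0 = max (x - s) 0 + (s - x)`, and `w`
annihilates affine functions. One and the same function then has zero Cauchy data at `0` and
vanishes beyond `R`. -/
theorem IsTest.backwardPrimitive_eq {R : ℝ} {w : ℝ → ℝ} (hw : IsTest R w)
    (h0 : ∫ s in Ioc 0 R, w s = 0) (h1 : ∫ s in Ioc 0 R, s * w s = 0) (x : ℝ) :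
    (backwardPrimitive R w x : ℂ) = secondPrimitive (fun s => (w s : ℂ)) x := by
  have hi : IntegrableOn (fun s => s * w s) (Ioc 0 R) := by
    refine Integrable.bdd_mul (c := |R|) (hw.integrableOn R) (by fun_prop) ?_
    filter_upwards [ae_restrict_mem measurableSet_Ioc] with s hs
    rw [Real.norm_eq_abs, abs_of_pos hs.1]
    exact hs.2.trans (le_abs_self R)
  have hw' : ∀ R, IntegrableOn (fun s => (w s : ℂ)) (Ioc 0 R) := fun R => (hw.integrableOn R).ofReal
  have key : ∫ s in Ioc 0 R, max (x - s) 0 * w s = backwardPrimitive R w x := by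
    have h2 : ∀ s, max (s - x) 0 * w s = max (x - s) 0 * w s + (s * w s - x * w s) := by
      intro s
      rcases le_total s x with h | h
      · rw [max_eq_right (sub_nonpos.2 h), max_eq_left (sub_nonneg.2 h)]; ring
      · rw [max_eq_left (sub_nonneg.2 h), max_eq_right (sub_nonpos.2 h)]; ring
    rw [backwardPrimitive]
    simp only [h2]
    rw [integral_add, integral_sub hi ((hw.integrableOn R).const_mul x), integral_const_mul, h0,
      h1, mul_zero, sub_zero, add_zero]
    · have := (integrableOn_max_smul (hw' R) x).re
      refine this.congr (Eventually.of_forall fun s => ?_)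
      simp
    · exact hi.sub ((hw.integrableOn R).const_mul x)
  rw [← key]
  have h3 : ∫ s in Ioc 0 R, max (x - s) 0 • (w s : ℂ) = secondPrimitive (fun s => (w s : ℂ)) x := by
    rcases le_total x R with h | h
    · exact (secondPrimitive_eq h).symm
    · rw [secondPrimitive_eq (le_refl x)]
      refine (setIntegral_eq_of_subset_of_forall_sdiff_eq_zero measurableSet_Ioc
        (Ioc_subset_Ioc_right h) fun s hs => ?_).symm
      rw [hw.support s hs.2, Complex.ofReal_zero, smul_zero]
  rw [← h3, ← integral_complex_ofReal]
  simp

end Ode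

end WaveSpectrum

end

noncomputable section

namespace WaveSpectrum

/-! ### Real test functions in `L₂(0,∞)` -/

section TestFunctions

open Classical in
/-- The class of a real function in `L₂(0,∞)` (`0` if it is not square integrable). -/
def toL2 (φ : ℝ → ℝ) : L2Half :=
  if h : MemLp (fun x => (φ x : ℂ)) 2 halfLine then h.toLp _ else 0

theorem coeFn_toL2 {φ : ℝ → ℝ} (h : MemLp (fun x => (φ x : ℂ)) 2 halfLine) :
    toL2 φ =ᵐ[halfLine] fun x => (φ x : ℂ) := by
  rw [toL2, dif_pos h]
  exact h.coeFn_toLp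

theorem memLp_of_bounded {φ : ℝ → ℝ} {R C : ℝ} (hm : AEStronglyMeasurable φ halfLine)
    (hC : ∀ x, 0 < x → |φ x| ≤ C) (hR : ∀ x, R < x → φ x = 0) :
    MemLp (fun x => (φ x : ℂ)) 2 halfLine := by
  have hm' : AEStronglyMeasurable (fun x => (φ x : ℂ)) halfLine :=
    Complex.continuous_ofReal.comp_aestronglyMeasurable hm
  have h1 : MemLp ((Ioc 0 R).indicator fun x => (φ x : ℂ)) 2 halfLine := by
    rw [memLp_indicator_iff_restrict measurableSet_Ioc]
    have : IsFiniteMeasure (halfLine.restrict (Ioc 0 R)) := by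
      rw [Measure.restrict_restrict measurableSet_Ioc]
      refine isFiniteMeasure_restrict.2 ?_
      exact ((measure_mono inter_subset_left).trans_lt measure_Ioc_lt_top).ne
    refine MemLp.of_bound hm'.restrict C ?_
    filter_upwards [ae_restrict_mem measurableSet_Ioc] with x hx
    rw [Complex.norm_real]
    exact hC x hx.1
  refine h1.congr_norm hm' ?_
  filter_upwards [ae_restrict_mem measurableSet_Ioi] with x hx
  by_cases h : x ≤ R
  · rw [indicator_of_mem (show x ∈ Ioc 0 R from ⟨hx, h⟩)]
  · rw [indicator_of_notMem (fun h' => h h'.2), hR x (not_le.1 h), Complex.ofReal_zero]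

theorem inner_toL2 {φ : ℝ → ℝ} (h : MemLp (fun x => (φ x : ℂ)) 2 halfLine) (y : L2Half) :
    inner ℂ (toL2 φ) y = ∫ x in Ioi 0, φ x • y x := by
  rw [L2.inner_def]
  refine integral_congr_ae ?_
  filter_upwards [coeFn_toL2 h] with x hx
  rw [hx, RCLike.inner_apply, Complex.conj_ofReal, mul_comm, Complex.real_smul]

theorem setIntegral_Ioi_eq {F : ℝ → ℂ} {R : ℝ} (hF : ∀ x, R < x → F x = 0) :
    ∫ x in Ioi 0, F x = ∫ x in Ioc 0 R, F x :=
  setIntegral_eq_of_subset_of_forall_sdiff_eq_zero measurableSet_Ioi Ioc_subset_Ioi_self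
    fun x hx => hF x (by
      by_contra h
      exact hx.2 ⟨hx.1, not_lt.1 h⟩)

theorem memLp_Ioc (y : L2Half) (R : ℝ) : MemLp y 2 (volume.restrict (Ioc 0 R)) :=
  (Lp.memLp y).mono_measure (Measure.restrict_mono Ioc_subset_Ioi_self le_rfl)

theorem integrableOn_Ioc (y : L2Half) (R : ℝ) : IntegrableOn y (Ioc 0 R) :=
  (memLp_Ioc y R).integrable one_le_two

theorem ae_halfLine_of_forall {P : ℝ → Prop} (h : ∀ R : ℝ, 1 ≤ R →
    ∀ᵐ x ∂(volume.restrict (Ioc 0 R)), P x) : ∀ᵐ x ∂halfLine, P x := by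
  rw [ae_restrict_iff' measurableSet_Ioi]
  have h1 : ∀ n : ℕ, ∀ᵐ x : ℝ, x ∈ Ioc (0 : ℝ) (n + 1) → P x := fun n =>
    (ae_restrict_iff' measurableSet_Ioc).1 (h _ (by simp))
  filter_upwards [ae_all_iff.2 h1] with x hx h0
  obtain ⟨n, hn⟩ := exists_nat_ge x
  exact hx n ⟨h0, hn.trans (by linarith)⟩

theorem ae_Ioc_of_ae {P : ℝ → Prop} (h : ∀ᵐ x ∂halfLine, P x) (R : ℝ) :
    ∀ᵐ x ∂(volume.restrict (Ioc 0 R)), P x :=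
  ae_restrict_of_ae_restrict_of_subset Ioc_subset_Ioi_self h

end TestFunctions

/-! ### The minimal domain, and Green's formula against compactly supported functions -/

section Domain

variable {q : ℝ → ℝ}

theorem exists_domain {p : L2Half × L2Half} (hp : p ∈ sturmLiouvilleGraph q) :
    ∃ ζ : (sturmLiouville q).domain, (ζ : L2Half) = p.1 ∧ sturmLiouville q ζ = p.2 := by
  rw [← Submodule.toLinearPMap_graph_eq _ (sturmLiouvilleGraph_functional q),
    LinearPMap.mem_graph_iff] at hp
  exact hp

theorem mem_graph (ζ : (sturmLiouville q).domain) :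
    ((ζ : L2Half), sturmLiouville q ζ) ∈ sturmLiouvilleGraph q := by
  rw [← Submodule.toLinearPMap_graph_eq _ (sturmLiouvilleGraph_functional q),
    LinearPMap.mem_graph_iff]
  exact ⟨ζ, rfl, rfl⟩

/-- The second derivative `q b - f` of a solution `b` of `-b'' + q b = f`. -/
def secondDeriv (q : ℝ → ℝ) (b f : L2Half) (x : ℝ) : ℂ := q x * b x - f x

variable (hq : ContinuousOn q (Ici 0))

include hq

theorem exists_bound_Icc (R : ℝ) : ∃ C, 0 ≤ C ∧ ∀ x ∈ Icc 0 R, |q x| ≤ C := by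
  obtain ⟨C, hC⟩ := isCompact_Icc.exists_bound_of_continuousOn
    (hq.mono (Icc_subset_Ici_self : Icc 0 R ⊆ Ici 0))
  exact ⟨max C 0, le_max_right _ _, fun x hx => (hC x hx).trans (le_max_left _ _)⟩

theorem aestronglyMeasurable_coeff : AEStronglyMeasurable q halfLine :=
  (hq.mono Ioi_subset_Ici_self).aestronglyMeasurable measurableSet_Ioi

theorem memLp_coeff_mul {g : ℝ → ℂ} {R : ℝ} (hg : MemLp g 2 (volume.restrict (Ioc 0 R))) :
    MemLp (fun x => q x * g x) 2 (volume.restrict (Ioc 0 R)) := by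
  obtain ⟨C, -, hC⟩ := exists_bound_Icc hq R
  refine hg.of_le_mul (c := C) ?_ ?_
  · exact (Complex.continuous_ofReal.comp_aestronglyMeasurable
      ((aestronglyMeasurable_coeff hq).mono_measure
        (Measure.restrict_mono Ioc_subset_Ioi_self le_rfl))).mul hg.aestronglyMeasurable
  · filter_upwards [ae_restrict_mem measurableSet_Ioc] with x hx
    rw [norm_mul, Complex.norm_real]
    exact mul_le_mul_of_nonneg_right (hC x ⟨hx.1.le, hx.2⟩) (norm_nonneg _)

theorem memLp_secondDeriv (b f : L2Half) (R : ℝ) :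
    MemLp (secondDeriv q b f) 2 (volume.restrict (Ioc 0 R)) :=
  (memLp_coeff_mul hq (memLp_Ioc b R)).sub (memLp_Ioc f R)

theorem integrableOn_secondDeriv (b f : L2Half) (R : ℝ) :
    IntegrableOn (secondDeriv q b f) (Ioc 0 R) :=
  (memLp_secondDeriv hq b f R).integrable one_le_two

theorem exists_domain_of_eq_secondPrimitive {b f : L2Half}
    (h : b =ᵐ[halfLine] secondPrimitive (secondDeriv q b f)) :
    ∃ ζ : (sturmLiouville q).domain, (ζ : L2Half) = b ∧ sturmLiouville q ζ = f := by
  refine exists_domain (p := (b, f)) ⟨secondPrimitive (secondDeriv q b f),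
    fun x => ∫ s in Ioc 0 x, secondDeriv q b f s, secondDeriv q b f,
    ⟨h, memLp_secondDeriv hq b f, fun x _ =>
      (hasDerivAt_secondPrimitive (integrableOn_secondDeriv hq b f) x).hasDerivWithinAt,
      fun x hx => ?_⟩, secondPrimitive_of_nonpos _ le_rfl, by simp, ?_⟩
  · rw [intervalIntegral.integral_of_le hx]; simp
  · filter_upwards [h] with x hx
    rw [← hx, secondDeriv]
    ring

/-- Both functions vanish at `0` and have the same derivative. The second derivative enters only
through integrals, so its being known almost everywhere suffices. -/
theorem domain_eq_secondPrimitive (ζ : (sturmLiouville q).domain) :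
    (ζ : L2Half) =ᵐ[halfLine]
      secondPrimitive (secondDeriv q (ζ : L2Half) (sturmLiouville q ζ)) := by
  obtain ⟨u, v, w, h, hu, hv, hf⟩ := mem_graph ζ
  set H := secondDeriv q (ζ : L2Half) (sturmLiouville q ζ) with hH
  have hw : w =ᵐ[halfLine] H := by
    filter_upwards [hf, h.ae_eq] with x h1 h2
    rw [hH, secondDeriv, h1]
    rw [h2]
    ring
  have hint := integrableOn_secondDeriv hq (ζ : L2Half) (sturmLiouville q ζ)
  have hv' : ∀ x, 0 ≤ x → v x = ∫ s in Ioc 0 x, H s := by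
    intro x hx
    rw [h.primitive x hx, hv, zero_add, intervalIntegral.integral_of_le hx]
    exact integral_congr_ae (ae_Ioc_of_ae hw x)
  have hEq : ∀ x, 0 ≤ x → u x = secondPrimitive H x := by
    intro x hx
    have h1 : ∀ s ∈ Ico 0 x, HasDerivWithinAt (fun s => u s - secondPrimitive H s) 0 (Ici s) s := by
      intro s hs
      have h2 := ((h.deriv s hs.1).mono (Ici_subset_Ici.2 hs.1)).sub
        (hasDerivAt_secondPrimitive hint s).hasDerivWithinAt
      rwa [hv' s hs.1, sub_self] at h2
    have h3 := norm_image_sub_le_of_norm_deriv_right_le_segment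
      (f := fun s => u s - secondPrimitive H s) (C := 0) (fun s hs =>
      (((h.deriv s hs.1).continuousWithinAt).mono Icc_subset_Ici_self).sub
        (continuous_secondPrimitive hint).continuousAt.continuousWithinAt) h1 (by simp) x
        (right_mem_Icc.2 hx)
    rw [hu, secondPrimitive_of_nonpos _ le_rfl] at h3
    simpa [sub_eq_zero] using h3
  filter_upwards [h.ae_eq, ae_restrict_mem measurableSet_Ioi] with x h1 h2
  exact h1.trans (hEq x (le_of_lt h2))

theorem memLp_backwardPrimitive {R : ℝ} {w : ℝ → ℝ} (hR : 0 ≤ R) (hw : IsTest R w) :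
    MemLp (fun x => (backwardPrimitive R w x : ℂ)) 2 halfLine ∧
    MemLp (fun x => ((-w x + q x * backwardPrimitive R w x : ℝ) : ℂ)) 2 halfLine := by
  obtain ⟨C, hC⟩ := hw.bounded
  obtain ⟨K, hK0, hK⟩ := exists_bound_Icc hq R
  have hzb : ∀ x, 0 < x → |backwardPrimitive R w x| ≤ R * ∫ s in Ioc 0 R, |w s| := fun x hx =>
    abs_backwardPrimitive_le hR hw le_rfl hx.le
  have hz0 : ∀ x, R < x → backwardPrimitive R w x = 0 := fun x hx =>
    backwardPrimitive_eq_zero w hx.le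
  refine ⟨memLp_of_bounded (continuous_backwardPrimitive hw).aestronglyMeasurable hzb hz0, ?_⟩
  refine memLp_of_bounded (C := C + K * (R * ∫ s in Ioc 0 R, |w s|))
    (hw.measurable.aestronglyMeasurable.neg.add ((aestronglyMeasurable_coeff hq).mul
      (continuous_backwardPrimitive hw).aestronglyMeasurable)) (fun x hx => ?_)
    (fun x hx => ?_) (R := R)
  · refine (abs_add_le _ _).trans (add_le_add ?_ ?_)
    · rw [abs_neg]; exact hC x
    · rw [abs_mul]
      rcases le_or_gt x R with h | h
      · exact mul_le_mul (hK x ⟨hx.le, h⟩) (hzb x hx) (abs_nonneg _) hK0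
      · rw [hz0 x h, abs_zero, mul_zero]
        have : 0 ≤ ∫ s in Ioc 0 R, |w s| := integral_nonneg fun s => abs_nonneg _
        positivity
  · rw [hz0 x hx, hw.support x (fun h => not_lt.2 h.2 hx)]; simp

/-- The supply of test elements: the backward kernel gives compact support, the two vanishing
moments give the conditions at `0`, and `w` need not be smooth. -/
theorem exists_domain_of_test {R : ℝ} {w : ℝ → ℝ} (hR : 0 ≤ R) (hw : IsTest R w)
    (h0 : ∫ s in Ioc 0 R, w s = 0) (h1 : ∫ s in Ioc 0 R, s * w s = 0) :
    ∃ ζ : (sturmLiouville q).domain, (ζ : L2Half) = toL2 (backwardPrimitive R w) ∧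
      sturmLiouville q ζ = toL2 (fun x => -w x + q x * backwardPrimitive R w x) := by
  obtain ⟨C, hC⟩ := hw.bounded
  obtain ⟨hz, hA⟩ := memLp_backwardPrimitive hq hR hw
  have hmem : (toL2 (backwardPrimitive R w),
      toL2 (fun x => -w x + q x * backwardPrimitive R w x)) ∈ sturmLiouvilleGraph q := by
    refine ⟨secondPrimitive fun s => (w s : ℂ), fun x => ∫ s in Ioc 0 x, (w s : ℂ), fun s => (w s : ℂ),
      ⟨?_, fun R' => ?_, fun x _ => (hasDerivAt_secondPrimitive (fun R' =>
        (hw.integrableOn R').ofReal) x).hasDerivWithinAt, fun x hx => ?_⟩,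
      secondPrimitive_of_nonpos _ le_rfl, by simp, ?_⟩
    · filter_upwards [coeFn_toL2 hz] with x hx
      exact hx.trans (hw.backwardPrimitive_eq h0 h1 x)
    · exact MemLp.of_bound (Complex.continuous_ofReal.comp_aestronglyMeasurable
        hw.measurable.aestronglyMeasurable) C (Eventually.of_forall fun x => by
          rw [Complex.norm_real]; exact hC x)
    · rw [intervalIntegral.integral_of_le hx]; simp
    · filter_upwards [coeFn_toL2 hA] with x hx
      rw [hx, ← hw.backwardPrimitive_eq h0 h1 x]
      push_cast
      ring
  obtain ⟨ζ, hζ1, hζ2⟩ := exists_domain hmem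
  exact ⟨ζ, hζ1, hζ2⟩

/-- Green's formula, by Fubini. No moment condition is imposed on `w`, so that affine weights later
turn boundary values into inner products. -/
theorem inner_backwardPrimitive_sub {R : ℝ} {w : ℝ → ℝ} (hR : 0 ≤ R) (hw : IsTest R w)
    (b f : L2Half) :
    inner ℂ (toL2 (backwardPrimitive R w)) f -
      inner ℂ (toL2 fun x => -w x + q x * backwardPrimitive R w x) b =
      ∫ x in Ioc 0 R, w x • (b x - secondPrimitive (secondDeriv q b f) x) := by
  obtain ⟨hz, hA⟩ := memLp_backwardPrimitive hq hR hw
  have hzb : ∀ x, 0 < x → |backwardPrimitive R w x| ≤ R * ∫ s in Ioc 0 R, |w s| := fun x hx =>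
    abs_backwardPrimitive_le hR hw le_rfl hx.le
  have hz0 : ∀ x, R < x → backwardPrimitive R w x = 0 := fun x hx =>
    backwardPrimitive_eq_zero w hx.le
  rw [inner_toL2 hz, inner_toL2 hA,
    setIntegral_Ioi_eq (R := R) (fun x hx => by rw [hz0 x hx, zero_smul]),
    setIntegral_Ioi_eq (R := R) (fun x hx => by
      rw [hz0 x hx, hw.support x (fun h => not_lt.2 h.2 hx)]; simp)]
  obtain ⟨C, hC⟩ := hw.bounded
  have hint := integrableOn_secondDeriv hq b f
  have hwb : ∀ {g : ℝ → ℂ}, IntegrableOn g (Ioc 0 R) →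
      IntegrableOn (fun x => w x • g x) (Ioc 0 R) :=
    fun hg => Integrable.bdd_smul hg C hw.measurable.aestronglyMeasurable
      (Eventually.of_forall hC)
  have hzb' : ∀ {g : ℝ → ℂ}, IntegrableOn g (Ioc 0 R) →
      IntegrableOn (fun x => backwardPrimitive R w x • g x) (Ioc 0 R) :=
    fun hg => Integrable.bdd_smul hg (R * ∫ s in Ioc 0 R, |w s|)
      (continuous_backwardPrimitive hw).aestronglyMeasurable (by
        filter_upwards [ae_restrict_mem measurableSet_Ioc] with x hx using hzb x hx.1)
  have hqb : IntegrableOn (fun x => q x * b x) (Ioc 0 R) :=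
    (memLp_coeff_mul hq (memLp_Ioc b R)).integrable one_le_two
  simp only [smul_sub]
  rw [integral_sub (hwb (integrableOn_Ioc b R)) (hwb
    (continuous_secondPrimitive hint).integrableOn_Ioc),
    integral_smul_secondPrimitive (hw.integrableOn R) (hint R)]
  have h3 : ∀ x, backwardPrimitive R w x • secondDeriv q b f x =
      backwardPrimitive R w x • (q x * b x) - backwardPrimitive R w x • f x := fun x => by
    rw [secondDeriv, smul_sub]
  have h4 : ∀ x, (-w x + q x * backwardPrimitive R w x) • b x =
      backwardPrimitive R w x • (q x * b x) - w x • b x := fun x => by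
    simp only [Complex.real_smul]
    push_cast
    ring
  simp only [h3, h4]
  rw [integral_sub (hzb' hqb) (hwb (integrableOn_Ioc b R)),
    integral_sub (hzb' hqb) (hzb' (integrableOn_Ioc f R))]
  ring

/-- Weak solutions satisfy the equation up to an affine function. -/
theorem integral_smul_sub_secondPrimitive {b f : L2Half}
    (hbf : ∀ z : (sturmLiouville q).domain, inner ℂ b (sturmLiouville q z) = inner ℂ f (z : L2Half))
    {R : ℝ} {w : ℝ → ℝ} (hR : 0 ≤ R) (hw : IsTest R w)
    (h0 : ∫ s in Ioc 0 R, w s = 0) (h1 : ∫ s in Ioc 0 R, s * w s = 0) :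
    ∫ x in Ioc 0 R, w x • (b x - secondPrimitive (secondDeriv q b f) x) = 0 := by
  obtain ⟨ζ, hζ1, hζ2⟩ := exists_domain_of_test hq hR hw h0 h1
  have h2 : inner ℂ (sturmLiouville q ζ) b = inner ℂ (ζ : L2Half) f := by
    rw [← inner_conj_symm, hbf, inner_conj_symm]
  rw [← inner_backwardPrimitive_sub hq hR hw, ← hζ1, ← hζ2, h2, sub_self]

end Domain

end WaveSpectrum

end

noncomputable section

namespace WaveSpectrum

/-! ### Form-domain limits tested against weak limits of bounded energy -/

section Energy

variable {E : Type*} [NormedAddCommGroup E] [InnerProductSpace ℂ E] {A : E →ₗ.[ℂ] E}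

/-- The weak formulation extends to weak limits of vectors of bounded energy. -/
theorem IsPositiveDefinite.tendsto_inner_of_bounded_energy (hA : IsPositiveDefinite A) {b f : E}
    (hbf : ∀ z : A.domain, inner ℂ b (A z) = inner ℂ f (z : E)) {y : ℕ → A.domain}
    (hy : Tendsto (fun n => (y n : E)) atTop (𝓝 b))
    (hyc : Tendsto (fun p : ℕ × ℕ => (inner ℂ ((y p.1 - y p.2 : A.domain) : E)
      (A (y p.1 - y p.2))).re) (atTop ×ˢ atTop) (𝓝 0)) {ζ : ℕ → A.domain} {C : ℝ}
    (hC : ∀ k, (inner ℂ (ζ k : E) (A (ζ k))).re ≤ C) {Z : E}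
    (hZ : ∀ g, Tendsto (fun k => inner ℂ (ζ k : E) g) atTop (𝓝 (inner ℂ Z g))) :
    Tendsto (fun n => inner ℂ Z (A (y n))) atTop (𝓝 (inner ℂ Z f)) := by
  have hpos : ∀ z : A.domain, 0 ≤ (inner ℂ (z : E) (A z)).re := by
    obtain ⟨κ, hκ, h⟩ := hA
    exact fun z => le_trans (by positivity) (h z).2
  rw [Metric.tendsto_atTop]
  intro ε hε
  have hlim : Tendsto (fun p : ℕ × ℕ => C * (inner ℂ ((y p.1 - y p.2 : A.domain) : E)
      (A (y p.1 - y p.2))).re) (atTop ×ˢ atTop) (𝓝 0) := by simpa using hyc.const_mul C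
  have hev := hlim.eventually_lt_const (show (0 : ℝ) < (ε / 2) ^ 2 by positivity)
  rw [prod_atTop_atTop_eq, eventually_atTop] at hev
  obtain ⟨⟨N₁, N₂⟩, hN⟩ := hev
  refine ⟨max N₁ N₂, fun n hn => ?_⟩
  have h1 : ∀ k, ‖inner ℂ (ζ k : E) (A (y n)) - inner ℂ (ζ k : E) f‖ ≤ ε / 2 := by
    intro k
    -- The energy bound `C` makes this uniform in `k`, which allows `m → ∞` first and the weak limit
    -- in `k` afterwards.
    have h2 : ∀ m ≥ max N₁ N₂,
        ‖inner ℂ (ζ k : E) (A (y n)) - inner ℂ (ζ k : E) (A (y m))‖ ≤ ε / 2 := by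
      intro m hm
      rw [← inner_sub_right, ← LinearPMap.map_sub]
      refine le_of_sq_le_sq ?_ (by positivity)
      refine (hA.norm_inner_sq_le _ _).trans ?_
      refine (mul_le_mul_of_nonneg_right (hC k) (hpos _)).trans ?_
      exact (hN (n, m) ⟨le_trans (le_max_left _ _) hn, le_trans (le_max_right _ _) hm⟩).le
    have h3 : Tendsto (fun m => inner ℂ (ζ k : E) (A (y m))) atTop (𝓝 (inner ℂ (ζ k : E) f)) := by
      have h4 : inner ℂ (ζ k : E) f = inner ℂ (A (ζ k)) b := by
        rw [← inner_conj_symm, ← hbf, inner_conj_symm]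
      rw [h4]
      refine Tendsto.congr (fun m => hA.isSymmetric (ζ k) (y m)) ?_
      exact tendsto_const_nhds.inner hy
    exact le_of_tendsto (tendsto_const_nhds.sub h3).norm (eventually_atTop.2 ⟨_, h2⟩)
  have h5 := le_of_tendsto' ((hZ (A (y n))).sub (hZ f)).norm h1
  rw [dist_eq_norm]
  linarith

end Energy

/-! ### Smooth test functions -/

section Smooth

/-- The smooth real functions with compact support in `(0,∞)`. -/
structure IsBump (φ : ℝ → ℝ) : Prop where
  contDiff : ContDiff ℝ ∞ φ
  hasCompactSupport : HasCompactSupport φ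
  tsupport_subset : tsupport φ ⊆ Ioi 0

namespace IsBump

variable {φ : ℝ → ℝ}

theorem eq_zero (hφ : IsBump φ) {x : ℝ} (hx : x ≤ 0) : φ x = 0 :=
  image_eq_zero_of_notMem_tsupport fun h => not_lt.2 hx (hφ.tsupport_subset h)

theorem memLp (hφ : IsBump φ) : MemLp (fun x => (φ x : ℂ)) 2 halfLine :=
  ((Complex.continuous_ofReal.comp hφ.contDiff.continuous).memLp_of_hasCompactSupport
    (hφ.hasCompactSupport.comp_left Complex.ofReal_zero))

theorem deriv (hφ : IsBump φ) : IsBump (deriv φ) :=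
  ⟨((contDiff_succ_iff_deriv (n := ∞)).1 hφ.contDiff).2.2, hφ.hasCompactSupport.deriv,
    tsupport_deriv_subset.trans hφ.tsupport_subset⟩

end IsBump

/-- The differential expression `-φ'' + q φ`. -/
def diffExpr (q φ : ℝ → ℝ) (x : ℝ) : ℝ := -deriv (deriv φ) x + q x * φ x

variable {q : ℝ → ℝ} (hq : ContDiffOn ℝ ∞ q (Ici 0))

include hq

theorem IsBump.diffExpr {φ : ℝ → ℝ} (hφ : IsBump φ) :
    IsBump (diffExpr q φ) ∧ tsupport (diffExpr q φ) ⊆ tsupport φ := by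
  have hsub : Function.support (WaveSpectrum.diffExpr q φ) ⊆ tsupport φ := by
    intro x hx
    by_contra h
    have h1 : φ =ᶠ[𝓝 x] 0 := notMem_tsupport_iff_eventuallyEq.1 h
    have h2 : _root_.deriv (_root_.deriv φ) x = 0 := by
      have := h1.deriv.deriv_eq
      rw [this]
      simp
    apply hx
    rw [WaveSpectrum.diffExpr, h2, h1.eq_of_nhds]
    simp
  have hts : tsupport (WaveSpectrum.diffExpr q φ) ⊆ tsupport φ :=
    closure_minimal hsub (isClosed_tsupport φ)
  refine ⟨⟨?_, HasCompactSupport.of_support_subset_isCompact hφ.hasCompactSupport hsub,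
    hts.trans hφ.tsupport_subset⟩, hts⟩
  refine (hφ.deriv.deriv.contDiff.neg).add (contDiff_iff_contDiffAt.2 fun x => ?_)
  rcases lt_or_ge 0 x with hx | hx
  · exact (hq.contDiffAt (Ici_mem_nhds hx)).mul hφ.contDiff.contDiffAt
  · have h1 : φ =ᶠ[𝓝 x] 0 := notMem_tsupport_iff_eventuallyEq.1
      fun h => not_lt.2 hx (hφ.tsupport_subset h)
    refine (contDiffAt_const (c := (0 : ℝ))).congr_of_eventuallyEq ?_
    filter_upwards [h1] with y hy
    rw [hy]; simp

theorem IsBump.exists_domain {φ : ℝ → ℝ} (hφ : IsBump φ) :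
    ∃ ζ : (sturmLiouville q).domain, (ζ : L2Half) = toL2 φ ∧
      sturmLiouville q ζ = toL2 (WaveSpectrum.diffExpr q φ) := by
  have hmem : (toL2 φ, toL2 (WaveSpectrum.diffExpr q φ)) ∈ sturmLiouvilleGraph q := by
    refine ⟨fun x => (φ x : ℂ), fun x => ((_root_.deriv φ x : ℝ) : ℂ),
      fun x => ((_root_.deriv (_root_.deriv φ) x : ℝ) : ℂ),
      ⟨coeFn_toL2 hφ.memLp, fun R => ?_, fun x _ => ?_, fun x _ => ?_⟩, ?_, ?_, ?_⟩
    · exact (Complex.continuous_ofReal.comp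
        hφ.deriv.deriv.contDiff.continuous).memLp_of_hasCompactSupport
          (hφ.deriv.deriv.hasCompactSupport.comp_left Complex.ofReal_zero)
    · exact ((hφ.contDiff.differentiable (by simp)) x).hasDerivAt.ofReal_comp.hasDerivWithinAt
    · have hF : ∫ s in (0 : ℝ)..x, _root_.deriv (_root_.deriv φ) s =
          _root_.deriv φ x - _root_.deriv φ 0 := intervalIntegral.integral_deriv_eq_sub
        (fun s _ => (hφ.deriv.contDiff.differentiable (by simp)) s)
        (hφ.deriv.deriv.contDiff.continuous.intervalIntegrable _ _)
      rw [intervalIntegral.integral_ofReal, hF]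
      push_cast
      ring
    · simp [hφ.eq_zero le_rfl]
    · simp [hφ.deriv.eq_zero le_rfl]
    · filter_upwards [coeFn_toL2 (hφ.diffExpr hq).1.memLp] with x hx
      rw [hx, WaveSpectrum.diffExpr]
      push_cast
      ring
  exact WaveSpectrum.exists_domain hmem

omit hq in
theorem ae_eq_zero_of_inner_bump {y : L2Half} {U : Set ℝ} (hU : IsOpen U) (hU0 : U ⊆ Ioi 0)
    (h : ∀ φ, IsBump φ → tsupport φ ⊆ U → inner ℂ (toL2 φ) y = 0) :
    ∀ᵐ x ∂halfLine, x ∈ U → y x = 0 := by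
  refine hU.ae_eq_zero_of_integral_contDiff_smul_eq_zero
    (((Lp.memLp y).locallyIntegrable one_le_two).locallyIntegrableOn U) fun φ h1 h2 h3 => ?_
  have hφ : IsBump φ := ⟨h1, h2, h3.trans hU0⟩
  rw [← inner_toL2 hφ.memLp]
  exact h φ hφ h3

theorem dense_domain : Dense ((sturmLiouville q).domain : Set L2Half) := by
  rw [Submodule.dense_iff_topologicalClosure_eq_top, Submodule.topologicalClosure_eq_top_iff,
    Submodule.eq_bot_iff]
  intro y hy
  have h1 := ae_eq_zero_of_inner_bump (y := y) isOpen_Ioi subset_rfl fun φ hφ _ => by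
    obtain ⟨ζ, hζ, -⟩ := hφ.exists_domain hq
    rw [← hζ]
    exact hy _ ζ.2
  refine Lp.ext ?_
  filter_upwards [h1, ae_restrict_mem measurableSet_Ioi, Lp.coeFn_zero ℂ 2 halfLine] with x h2 h3 h4
  rw [h2 h3, h4]
  rfl

end Smooth

/-! ### Weak solutions -/

section WeakSolutions

variable {q : ℝ → ℝ}

/-- The value at `0` of a solution of `-b'' + q b = f`. -/
def boundaryValue (q : ℝ → ℝ) (b f : L2Half) : ℂ :=
  -- `4 - 6 s` and `12 s - 6` have the moments of order `0, 1` equal to `(1, 0)` and `(0, 1)` on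
  -- `(0,1]`: they extract the coefficients of an affine function, also from a function known only
  -- almost everywhere.
  ∫ s in Ioc (0 : ℝ) 1, (4 - 6 * s) • (b s - secondPrimitive (secondDeriv q b f) s)

/-- The derivative at `0` of a solution of `-b'' + q b = f`. -/
def boundaryDeriv (q : ℝ → ℝ) (b f : L2Half) : ℂ :=
  ∫ s in Ioc (0 : ℝ) 1, (12 * s - 6) • (b s - secondPrimitive (secondDeriv q b f) s)

theorem integral_affine (a b : ℝ) : ∫ s in Ioc (0 : ℝ) 1, (a + b * s) = a + b / 2 := by
  rw [← intervalIntegral.integral_of_le zero_le_one]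
  rw [intervalIntegral.integral_add (Continuous.intervalIntegrable (by fun_prop) _ _)
    (Continuous.intervalIntegrable (by fun_prop) _ _), intervalIntegral.integral_const_mul,
    integral_id]
  simp
  ring

theorem integral_mul_affine (a b : ℝ) :
    ∫ s in Ioc (0 : ℝ) 1, s * (a + b * s) = a / 2 + b / 3 := by
  rw [← intervalIntegral.integral_of_le zero_le_one]
  have h : ∀ s : ℝ, s * (a + b * s) = a * s + b * s ^ 2 := fun s => by ring
  simp only [h]
  rw [intervalIntegral.integral_add (Continuous.intervalIntegrable (by fun_prop) _ _)
    (Continuous.intervalIntegrable (by fun_prop) _ _)]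
  rw [intervalIntegral.integral_const_mul, intervalIntegral.integral_const_mul, integral_id,
    integral_pow]
  norm_num
  ring

theorem setIntegral_indicator_smul {R : ℝ} (hR : 1 ≤ R) (c : ℝ → ℝ) (g : ℝ → ℂ) :
    ∫ s in Ioc 0 R, (Ioc (0 : ℝ) 1).indicator c s • g s = ∫ s in Ioc (0 : ℝ) 1, c s • g s := by
  have h : ∀ s, (Ioc (0 : ℝ) 1).indicator c s • g s =
      (Ioc (0 : ℝ) 1).indicator (fun s => c s • g s) s := fun s => by
    by_cases hs : s ∈ Ioc (0 : ℝ) 1 <;> simp [hs]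
  simp only [h]
  rw [setIntegral_indicator measurableSet_Ioc, inter_eq_right.2 (Ioc_subset_Ioc_right hR)]

theorem setIntegral_indicator_real {R : ℝ} (hR : 1 ≤ R) (c : ℝ → ℝ) :
    ∫ s in Ioc 0 R, (Ioc (0 : ℝ) 1).indicator c s = ∫ s in Ioc (0 : ℝ) 1, c s := by
  rw [setIntegral_indicator measurableSet_Ioc, inter_eq_right.2 (Ioc_subset_Ioc_right hR)]

theorem setIntegral_mul_indicator_real {R : ℝ} (hR : 1 ≤ R) (c : ℝ → ℝ) :
    ∫ s in Ioc 0 R, s * (Ioc (0 : ℝ) 1).indicator c s = ∫ s in Ioc (0 : ℝ) 1, s * c s := by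
  rw [← setIntegral_indicator_real hR]
  congr 1
  ext s
  by_cases hs : s ∈ Ioc (0 : ℝ) 1 <;> simp [hs]

namespace IsTest

variable {R : ℝ} {u : ℝ → ℝ}

theorem integrableOn_mul (hu : IsTest R u) : IntegrableOn (fun s => s * u s) (Ioc 0 R) := by
  refine Integrable.bdd_mul (c := |R|) (hu.integrableOn R) (by fun_prop) ?_
  filter_upwards [ae_restrict_mem measurableSet_Ioc] with s hs
  rw [Real.norm_eq_abs, abs_of_pos hs.1]
  exact hs.2.trans (le_abs_self R)

/-- Subtraction of the component of `u` along the affine functions. -/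
theorem sub_affine (hR : 1 ≤ R) (hu : IsTest R u) :
    ∃ w : ℝ → ℝ, IsTest R w ∧ (∫ s in Ioc 0 R, w s = 0) ∧ (∫ s in Ioc 0 R, s * w s = 0) ∧
      ∀ s, w s = u s - (∫ s in Ioc 0 R, u s) *
        (Ioc (0 : ℝ) 1).indicator (fun s => 4 + (-6) * s) s -
        (∫ s in Ioc 0 R, s * u s) * (Ioc (0 : ℝ) 1).indicator (fun s => -6 + 12 * s) s := by
  set a := ∫ s in Ioc 0 R, u s
  set b := ∫ s in Ioc 0 R, s * u s
  have h1 := IsTest.affine hR 4 (-6)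
  have h2 := IsTest.affine hR (-6) 12
  have ha := h1.const_mul a
  have hb := h2.const_mul b
  have hw := (hu.sub ha).sub hb
  refine ⟨_, hw, ?_, ?_, fun s => rfl⟩
  · rw [integral_sub ((hu.sub ha).integrableOn R) (hb.integrableOn R),
      integral_sub (hu.integrableOn R) (ha.integrableOn R), integral_const_mul, integral_const_mul,
      setIntegral_indicator_real hR, setIntegral_indicator_real hR, integral_affine,
      integral_affine]
    change a - _ - _ = 0
    ring
  · simp only [mul_sub]
    rw [integral_sub (by simpa only [mul_sub, IntegrableOn] using (hu.sub ha).integrableOn_mul)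
        hb.integrableOn_mul,
      integral_sub hu.integrableOn_mul ha.integrableOn_mul]
    have h3 : ∀ (c : ℝ) (v : ℝ → ℝ), ∫ s in Ioc 0 R, s * (c * v s) = c * ∫ s in Ioc 0 R, s * v s :=
      fun c v => by rw [← integral_const_mul]; congr 1; ext s; ring
    rw [h3, h3, setIntegral_mul_indicator_real hR, setIntegral_mul_indicator_real hR,
      integral_mul_affine, integral_mul_affine]
    change b - _ - _ = 0
    ring

end IsTest

variable (hq : ContinuousOn q (Ici 0))

include hq

/-- The affine combination with the same two moments is subtracted from `u`; what remains is an
admissible test for the weak equation. -/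
theorem integral_smul_eq_boundary {b f : L2Half}
    (hbf : ∀ z : (sturmLiouville q).domain, inner ℂ b (sturmLiouville q z) = inner ℂ f (z : L2Half))
    {R : ℝ} {u : ℝ → ℝ} (hR : 1 ≤ R) (hu : IsTest R u) :
    ∫ x in Ioc 0 R, u x • (b x - secondPrimitive (secondDeriv q b f) x) =
      (∫ s in Ioc 0 R, u s) • boundaryValue q b f +
        (∫ s in Ioc 0 R, s * u s) • boundaryDeriv q b f := by
  obtain ⟨w, hw, h0, h1, hwe⟩ := hu.sub_affine hR
  have h2 := integral_smul_sub_secondPrimitive hq hbf (zero_le_one.trans hR) hw h0 h1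
  have hg : IntegrableOn (fun x => b x - secondPrimitive (secondDeriv q b f) x) (Ioc 0 R) :=
    (integrableOn_Ioc b R).sub
      (continuous_secondPrimitive (integrableOn_secondDeriv hq b f)).integrableOn_Ioc
  have hwb : ∀ {w : ℝ → ℝ}, IsTest R w → IntegrableOn
      (fun x => w x • (b x - secondPrimitive (secondDeriv q b f) x)) (Ioc 0 R) := by
    intro w hw
    obtain ⟨C, hC⟩ := hw.bounded
    exact Integrable.bdd_smul hg C hw.measurable.aestronglyMeasurable (Eventually.of_forall hC)
  have ha := (IsTest.affine hR 4 (-6)).const_mul (∫ s in Ioc 0 R, u s)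
  have hb := (IsTest.affine hR (-6) 12).const_mul (∫ s in Ioc 0 R, s * u s)
  simp only [hwe, sub_smul] at h2
  rw [integral_sub (by simpa only [sub_smul, IntegrableOn] using hwb (hu.sub ha)) (hwb hb),
    integral_sub (hwb hu) (hwb ha)] at h2
  simp only [mul_smul, integral_smul] at h2
  rw [setIntegral_indicator_smul hR, setIntegral_indicator_smul hR, sub_sub, sub_eq_zero] at h2
  rw [h2, boundaryValue, boundaryDeriv]
  congr 3 <;> ext s <;> congr 1 <;> ring

/-- The du Bois-Reymond lemma of order two: with indicators as weights, the difference from the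
affine function integrates to zero over every measurable set. -/
theorem ae_eq_affine_add {b f : L2Half}
    (hbf : ∀ z : (sturmLiouville q).domain, inner ℂ b (sturmLiouville q z) =
      inner ℂ f (z : L2Half)) :
    b =ᵐ[halfLine] fun x => boundaryValue q b f + x • boundaryDeriv q b f +
      secondPrimitive (secondDeriv q b f) x := by
  refine ae_halfLine_of_forall fun R hR => ?_
  have hg : IntegrableOn (fun x => b x - secondPrimitive (secondDeriv q b f) x) (Ioc 0 R) :=
    (integrableOn_Ioc b R).sub
      (continuous_secondPrimitive (integrableOn_secondDeriv hq b f)).integrableOn_Ioc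
  have hc : Continuous fun x : ℝ => boundaryValue q b f + x • boundaryDeriv q b f := by fun_prop
  have h := Integrable.ae_eq_of_forall_setIntegral_eq _ _ hg hc.integrableOn_Ioc fun S hS _ => ?_
  · filter_upwards [h] with x hx
    rw [← hx]; ring
  · have hS' := hS.inter (measurableSet_Ioc (a := (0 : ℝ)) (b := R))
    have hu := IsTest.indicator hS' inter_subset_right
    have h1 := integral_smul_eq_boundary hq hbf hR hu
    have h2 : ∀ {F : Type} [NormedAddCommGroup F] [NormedSpace ℝ F] (g : ℝ → F),
        ∫ x in Ioc 0 R, (S ∩ Ioc 0 R).indicator (1 : ℝ → ℝ) x • g x =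
        ∫ x in S ∩ Ioc 0 R, g x := by
      intro F _ _ g
      have : ∀ x, (S ∩ Ioc 0 R).indicator (1 : ℝ → ℝ) x • g x = (S ∩ Ioc 0 R).indicator g x := by
        intro x
        by_cases hx : x ∈ S ∩ Ioc 0 R <;> simp [hx]
      simp only [this]
      rw [setIntegral_indicator hS', inter_eq_right.2 inter_subset_right]
    have h3 : ∫ s in Ioc 0 R, (S ∩ Ioc 0 R).indicator (1 : ℝ → ℝ) s =
        ∫ s in S ∩ Ioc 0 R, (1 : ℝ) := by
      rw [← h2]; simp
    have h4 : ∫ s in Ioc 0 R, s * (S ∩ Ioc 0 R).indicator (1 : ℝ → ℝ) s =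
        ∫ s in S ∩ Ioc 0 R, s := by
      rw [← h2]; simp [mul_comm]
    have hi : IntegrableOn (fun s : ℝ => s) (S ∩ Ioc 0 R) :=
      continuous_id.integrableOn_Ioc.mono_set inter_subset_right
    have hi1 : IntegrableOn (fun _ : ℝ => (1 : ℝ)) (S ∩ Ioc 0 R) :=
      continuous_const.integrableOn_Ioc.mono_set inter_subset_right
    rw [h2, h3, h4] at h1
    rw [Measure.restrict_restrict hS, h1, ← integral_smul_const, ← integral_smul_const,
      ← integral_add (hi1.smul_const _) (hi.smul_const _)]
    simp

end WeakSolutions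

end WaveSpectrum

end

noncomputable section

namespace WaveSpectrum

/-! ### The Dirichlet condition -/

section Dirichlet

theorem integrableOn_max_mul {R R' : ℝ} {w : ℝ → ℝ} (hw : IsTest R w) (x : ℝ) :
    IntegrableOn (fun s => max (s - x) 0 * w s) (Ioc 0 R') := by
  refine Integrable.bdd_mul (c := |x| + |R'|) (hw.integrableOn R')
    (Continuous.aestronglyMeasurable (by fun_prop)) ?_
  filter_upwards [ae_restrict_mem measurableSet_Ioc] with s hs
  rw [Real.norm_eq_abs, abs_of_nonneg (le_max_right _ _)]
  exact max_le (by linarith [neg_abs_le x, le_abs_self R', hs.2]) (by positivity)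

theorem backwardPrimitive_sub {R R' : ℝ} {w w' : ℝ → ℝ} (hw : IsTest R w) (hw' : IsTest R w')
    (x : ℝ) : backwardPrimitive R' (fun s => w s - w' s) x =
      backwardPrimitive R' w x - backwardPrimitive R' w' x := by
  simp only [backwardPrimitive, mul_sub]
  exact integral_sub (integrableOn_max_mul hw x) (integrableOn_max_mul hw' x)

theorem backwardPrimitive_const_mul (R c : ℝ) (w : ℝ → ℝ) (x : ℝ) :
    backwardPrimitive R (fun s => c * w s) x = c * backwardPrimitive R w x := by
  simp only [backwardPrimitive]
  rw [← integral_const_mul]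
  congr 1
  ext s
  ring

theorem norm_inner_toL2_le {φ : ℝ → ℝ} {C : ℝ} (h : MemLp (fun x => (φ x : ℂ)) 2 halfLine)
    (hφ : ∀ x, 1 < x → φ x = 0) (hC : ∀ x ∈ Ioc (0 : ℝ) 1, |φ x| ≤ C) (g : L2Half) :
    ‖inner ℂ (toL2 φ) g‖ ≤ C * ∫ x in Ioc (0 : ℝ) 1, ‖g x‖ := by
  rw [inner_toL2 h, setIntegral_Ioi_eq (R := 1) (fun x hx => by rw [hφ x hx, zero_smul]),
    ← integral_const_mul]
  refine norm_integral_le_of_norm_le ((integrableOn_Ioc g 1).norm.const_mul C) ?_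
  filter_upwards [ae_restrict_mem measurableSet_Ioc] with x hx
  rw [norm_smul]
  exact mul_le_mul_of_nonneg_right (hC x hx) (norm_nonneg _)

variable {q : ℝ → ℝ}

/-- Approximation of a function with nonzero derivative at `0` by functions of bounded energy in
the domain of the minimal operator. -/
theorem exists_bounded_energy (hq : ContinuousOn q (Ici 0)) :
    ∃ (ζ : ℕ → (sturmLiouville q).domain) (C : ℝ),
      (∀ k, (inner ℂ (ζ k : L2Half) (sturmLiouville q (ζ k))).re ≤ C) ∧
      ∀ g : L2Half, Tendsto (fun k => inner ℂ (ζ k : L2Half) g) atTop (𝓝 (inner ℂ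
        (-toL2 (backwardPrimitive 1 ((Ioc (0 : ℝ) 1).indicator fun s => 4 + (-6) * s))) g)) := by
  set w₁ : ℝ → ℝ := (Ioc (0 : ℝ) 1).indicator fun s => 4 + (-6) * s with hw₁
  set w₂ : ℝ → ℝ := (Ioc (0 : ℝ) 1).indicator fun s => -6 + 12 * s with hw₂
  have ht₁ : IsTest 1 w₁ := IsTest.affine le_rfl 4 (-6)
  have ht₂ : IsTest 1 w₂ := IsTest.affine le_rfl (-6) 12
  have hpos : ∀ k : ℕ, (0 : ℝ) < k + 1 := fun k => by positivity
  have hle : ∀ k : ℕ, 1 / ((k : ℝ) + 1) ≤ 1 := fun k =>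
    div_le_one_of_le₀ (by linarith [(Nat.cast_nonneg k : (0 : ℝ) ≤ k)]) (hpos k).le
  -- Unit masses concentrating at `0`. Then `w k = u k - w₁ - m k w₂` has vanishing moments and `m k
  -- → 0`, so its backward primitive tends uniformly to minus that of `w₁`, whose slope at `0` is
  -- not zero.
  let u : ℕ → ℝ → ℝ := fun k x => ((k : ℝ) + 1) * (Ioc (0 : ℝ) (1 / (k + 1))).indicator 1 x
  have hu : ∀ k : ℕ, IsTest (1 / ((k : ℝ) + 1)) (u k) := fun k =>
    (IsTest.indicator measurableSet_Ioc subset_rfl).const_mul _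
  have hu1 : ∀ k : ℕ, IsTest 1 (u k) := fun k =>
    (IsTest.indicator measurableSet_Ioc (Ioc_subset_Ioc_right (hle k))).const_mul _
  have hu_nonneg : ∀ (k : ℕ) s, 0 ≤ u k s := fun k s =>
    mul_nonneg (hpos k).le (indicator_nonneg (fun _ _ => zero_le_one) s)
  have hu_int : ∀ k : ℕ, ∫ s in Ioc (0 : ℝ) 1, u k s = 1 := by
    intro k
    simp only [u]
    rw [integral_const_mul, setIntegral_indicator measurableSet_Ioc,
      inter_eq_right.2 (Ioc_subset_Ioc_right (hle k))]
    have : (0 : ℝ) ≤ 1 / (k + 1) := (one_div_pos.2 (hpos k)).le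
    simp only [Pi.one_apply]
    rw [← intervalIntegral.integral_of_le this]
    simp [(hpos k).ne']
  have hu_abs : ∀ k : ℕ, ∫ s in Ioc (0 : ℝ) 1, |u k s| = 1 := fun k => by
    simp only [abs_of_nonneg (hu_nonneg k _), hu_int k]
  have hbu : ∀ (k : ℕ) x, 0 ≤ x → |backwardPrimitive 1 (u k) x| ≤ 1 / ((k : ℝ) + 1) := by
    intro k x hx
    have := abs_backwardPrimitive_le (one_div_pos.2 (hpos k)).le (hu k) (hu_abs k).le hx
    rwa [mul_one] at this
  let m : ℕ → ℝ := fun k => ∫ s in Ioc (0 : ℝ) 1, s * u k s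
  have hm : ∀ k : ℕ, |m k| ≤ 1 / ((k : ℝ) + 1) := by
    intro k
    have h1 : m k = backwardPrimitive 1 (u k) 0 := by
      refine setIntegral_congr_fun measurableSet_Ioc fun s hs => ?_
      simp only [sub_zero, max_eq_left hs.1.le]
    rw [h1]
    exact hbu k 0 le_rfl
  choose w hw h0 h1 hwe using fun k => (hu1 k).sub_affine le_rfl
  have hwe' : ∀ k : ℕ, w k = fun s => (u k s - w₁ s) - m k * w₂ s := by
    intro k
    ext s
    rw [hwe k s, hu_int k, one_mul]
  choose ζ hζ1 hζ2 using fun k => exists_domain_of_test hq zero_le_one (hw k) (h0 k) (h1 k)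
  set K₁ := ∫ s in Ioc (0 : ℝ) 1, |w₁ s| with hK₁
  set K₂ := ∫ s in Ioc (0 : ℝ) 1, |w₂ s| with hK₂
  have hK₂0 : 0 ≤ K₂ := integral_nonneg fun s => abs_nonneg _
  have hz : ∀ (k : ℕ) x, backwardPrimitive 1 (w k) x =
      (backwardPrimitive 1 (u k) x - backwardPrimitive 1 w₁ x) -
        m k * backwardPrimitive 1 w₂ x := by
    intro k x
    rw [hwe' k, backwardPrimitive_sub ((hu1 k).sub ht₁) (ht₂.const_mul (m k)),
      backwardPrimitive_sub (hu1 k) ht₁, backwardPrimitive_const_mul 1 (m k) w₂]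
  have hwint : ∀ k : ℕ, ∫ s in Ioc (0 : ℝ) 1, |w k s| ≤ 1 + K₁ + K₂ := by
    intro k
    have h2 : ∫ s in Ioc (0 : ℝ) 1, |w k s| ≤
        ∫ s in Ioc (0 : ℝ) 1, ((|u k s| + |w₁ s|) + |w₂ s|) := by
      refine integral_mono ((hw k).integrableOn 1).abs ((((hu1 k).integrableOn 1).abs.add
        (ht₁.integrableOn 1).abs).add (ht₂.integrableOn 1).abs) fun s => ?_
      rw [hwe' k]
      refine (abs_sub _ _).trans (add_le_add (abs_sub _ _) ?_)
      rw [abs_mul]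
      exact mul_le_of_le_one_left (abs_nonneg _) ((hm k).trans (hle k))
    refine h2.trans_eq ?_
    have e1 := integral_add (((hu1 k).integrableOn 1).abs.add (ht₁.integrableOn 1).abs)
      (ht₂.integrableOn 1).abs
    simp only [Pi.add_apply] at e1
    rw [e1, integral_add ((hu1 k).integrableOn 1).abs (ht₁.integrableOn 1).abs, hu_abs k]
  set Cz := 1 * (1 + K₁ + K₂) with hCz
  have hzb : ∀ (k : ℕ) x, 0 ≤ x → |backwardPrimitive 1 (w k) x| ≤ Cz := fun k x hx =>
    abs_backwardPrimitive_le zero_le_one (hw k) (hwint k) hx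
  have hCz0 : 0 ≤ Cz := (abs_nonneg _).trans (hzb 0 0 le_rfl)
  obtain ⟨K, hK0, hK⟩ := exists_bound_Icc hq 1
  refine ⟨ζ, Cz * (Cz + K * Cz), fun k => ?_, fun g => ?_⟩
  -- The energy is at most the sup norm of `ζ k` times the `L₁` norm of its image. Both stay
  -- bounded, although the `L₂` norm of `u k` does not.
  · obtain ⟨hm1, hm2⟩ := memLp_backwardPrimitive hq zero_le_one (hw k)
    refine (Complex.re_le_norm _).trans ?_
    rw [hζ1, hζ2]
    refine (norm_inner_toL2_le hm1 (fun x hx => backwardPrimitive_eq_zero _ hx.le)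
      (fun x hx => hzb k x hx.1.le) _).trans (mul_le_mul_of_nonneg_left ?_ hCz0)
    have h2 : ∫ x in Ioc (0 : ℝ) 1, ‖toL2 (fun x => -w k x + q x * backwardPrimitive 1 (w k) x) x‖
        ≤ ∫ x in Ioc (0 : ℝ) 1, (|w k x| + K * Cz) := by
      refine integral_mono_ae (integrableOn_Ioc _ 1).norm
        (((hw k).integrableOn 1).abs.add (integrable_const _)) ?_
      filter_upwards [ae_Ioc_of_ae (coeFn_toL2 hm2) 1, ae_restrict_mem measurableSet_Ioc]
        with x hx hx'
      rw [hx, Complex.norm_real, Real.norm_eq_abs]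
      refine (abs_add_le _ _).trans (add_le_add (abs_neg _).le ?_)
      rw [abs_mul]
      exact mul_le_mul (hK x ⟨hx'.1.le, hx'.2⟩) (hzb k x hx'.1.le) (abs_nonneg _) hK0
    refine h2.trans ?_
    rw [integral_add ((hw k).integrableOn 1).abs (integrable_const _)]
    refine add_le_add ((hwint k).trans_eq (one_mul _).symm) ?_
    simp
  · obtain ⟨hm0, -⟩ := memLp_backwardPrimitive hq zero_le_one ht₁
    have hlim : Tendsto (fun k : ℕ => (1 / ((k : ℝ) + 1) + 1 / ((k : ℝ) + 1) * (1 * K₂)) *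
        ∫ x in Ioc (0 : ℝ) 1, ‖g x‖) atTop (𝓝 0) := by
      have h2 := tendsto_one_div_add_atTop_nhds_zero_nat (𝕜 := ℝ)
      simpa using (h2.add (h2.mul_const (1 * K₂))).mul_const (∫ x in Ioc (0 : ℝ) 1, ‖g x‖)
    rw [tendsto_iff_norm_sub_tendsto_zero]
    refine squeeze_zero (fun k => norm_nonneg _) (fun k => ?_) hlim
    obtain ⟨hm1, -⟩ := memLp_backwardPrimitive hq zero_le_one (hw k)
    have hd : MemLp (fun x => ((backwardPrimitive 1 (w k) x + backwardPrimitive 1 w₁ x : ℝ) : ℂ)) 2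
        halfLine := by
      have := hm1.add hm0
      refine this.ae_eq (Eventually.of_forall fun x => ?_)
      simp
    have heq : inner ℂ (ζ k : L2Half) g - inner ℂ (-toL2 (backwardPrimitive 1 w₁)) g =
        inner ℂ (toL2 fun x => backwardPrimitive 1 (w k) x + backwardPrimitive 1 w₁ x) g := by
      rw [inner_neg_left, sub_neg_eq_add, ← inner_add_left, hζ1]
      congr 1
      refine Lp.ext ?_
      filter_upwards [Lp.coeFn_add (toL2 (backwardPrimitive 1 (w k)))
        (toL2 (backwardPrimitive 1 w₁)), coeFn_toL2 hm1, coeFn_toL2 hm0, coeFn_toL2 hd]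
        with x e1 e2 e3 e4
      rw [e1, Pi.add_apply, e2, e3, e4]
      push_cast
      ring
    rw [heq]
    refine norm_inner_toL2_le hd (fun x hx => ?_) (fun x hx => ?_) g
    · rw [backwardPrimitive_eq_zero _ hx.le, backwardPrimitive_eq_zero _ hx.le, add_zero]
    · rw [hz]
      have h3 : |backwardPrimitive 1 w₂ x| ≤ 1 * K₂ :=
        abs_backwardPrimitive_le zero_le_one ht₂ le_rfl hx.1.le
      calc |backwardPrimitive 1 (u k) x - backwardPrimitive 1 w₁ x -
            m k * backwardPrimitive 1 w₂ x + backwardPrimitive 1 w₁ x|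
          = |backwardPrimitive 1 (u k) x - m k * backwardPrimitive 1 w₂ x| := by congr 1; ring
        _ ≤ |backwardPrimitive 1 (u k) x| + |m k * backwardPrimitive 1 w₂ x| := abs_sub _ _
        _ ≤ _ := by
          rw [abs_mul]
          exact add_le_add (hbu k x hx.1.le) (mul_le_mul (hm k) h3 (abs_nonneg _)
            (one_div_pos.2 (hpos k)).le)

/-- As a difference of inner products with fixed vectors the boundary value is continuous in `b` and
`f`. The first of these vectors is, up to sign, the weak limit from `exists_bounded_energy`. -/
theorem boundaryValue_eq (hq : ContinuousOn q (Ici 0)) (b f : L2Half) :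
    boundaryValue q b f =
      inner ℂ (toL2 (backwardPrimitive 1 ((Ioc (0 : ℝ) 1).indicator fun s => 4 + (-6) * s))) f -
      inner ℂ (toL2 fun x => -(Ioc (0 : ℝ) 1).indicator (fun s => 4 + (-6) * s) x +
        q x * backwardPrimitive 1 ((Ioc (0 : ℝ) 1).indicator fun s => 4 + (-6) * s) x) b := by
  rw [inner_backwardPrimitive_sub hq zero_le_one (IsTest.affine le_rfl 4 (-6)),
    setIntegral_indicator_smul le_rfl, boundaryValue]
  congr 1; ext s; congr 1; ring

theorem boundaryDeriv_eq (hq : ContinuousOn q (Ici 0)) (b f : L2Half) :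
    boundaryDeriv q b f =
      inner ℂ (toL2 (backwardPrimitive 1 ((Ioc (0 : ℝ) 1).indicator fun s => -6 + 12 * s))) f -
      inner ℂ (toL2 fun x => -(Ioc (0 : ℝ) 1).indicator (fun s => -6 + 12 * s) x +
        q x * backwardPrimitive 1 ((Ioc (0 : ℝ) 1).indicator fun s => -6 + 12 * s) x) b := by
  rw [inner_backwardPrimitive_sub hq zero_le_one (IsTest.affine le_rfl (-6) 12),
    setIntegral_indicator_smul le_rfl, boundaryDeriv]
  congr 1; ext s; congr 1; ring

theorem boundary_of_domain (hq : ContinuousOn q (Ici 0)) (ζ : (sturmLiouville q).domain) :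
    boundaryValue q ζ (sturmLiouville q ζ) = 0 ∧ boundaryDeriv q ζ (sturmLiouville q ζ) = 0 := by
  have h := ae_Ioc_of_ae (domain_eq_secondPrimitive hq ζ) 1
  constructor
  all_goals
    refine integral_eq_zero_of_ae ?_
    filter_upwards [h] with s hs
    rw [← hs, sub_self, smul_zero]
    rfl

/-- The elements of the form domain vanish at `0`. -/
theorem boundaryValue_eq_zero (hq : ContinuousOn q (Ici 0))
    (hA : IsPositiveDefinite (sturmLiouville q)) {b f : L2Half}
    (hb : b ∈ formDomain (sturmLiouville q))
    (hbf : ∀ z : (sturmLiouville q).domain, inner ℂ b (sturmLiouville q z) =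
      inner ℂ f (z : L2Half)) : boundaryValue q b f = 0 := by
  obtain ⟨y, hy, hyc⟩ := hb
  obtain ⟨ζ, C, hC, hZ⟩ := exists_bounded_energy hq
  -- The images of `yₙ` need not converge to `f` in norm, but their pairings with a weak limit of
  -- bounded energy converge. That suffices to carry the zero boundary value of `yₙ` over to `b`.
  have h1 := hA.tendsto_inner_of_bounded_energy hbf hy hyc hC hZ
  have h2 := h1.neg
  simp only [inner_neg_left, neg_neg] at h2
  have h3 : Tendsto (fun n => inner ℂ (toL2
    fun x => -(Ioc (0 : ℝ) 1).indicator (fun s => 4 + (-6) * s) x +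
        q x * backwardPrimitive 1 ((Ioc (0 : ℝ) 1).indicator fun s => 4 + (-6) * s) x)
        (y n : L2Half)) atTop (𝓝 (inner ℂ (toL2
    fun x => -(Ioc (0 : ℝ) 1).indicator (fun s => 4 + (-6) * s) x +
        q x * backwardPrimitive 1 ((Ioc (0 : ℝ) 1).indicator fun s => 4 + (-6) * s) x) b)) :=
    tendsto_const_nhds.inner hy
  have h4 := h2.sub h3
  rw [← boundaryValue_eq hq] at h4
  refine tendsto_nhds_unique h4 (tendsto_const_nhds.congr fun n => ?_)
  rw [← boundaryValue_eq hq, (boundary_of_domain hq (y n)).1]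

end Dirichlet

end WaveSpectrum

end

noncomputable section

namespace WaveSpectrum

/-! ### Point evaluation of the solutions of the Dirichlet problem -/

section Evaluation

/-- `∫₀ᴿ |f| ≤ C ‖f‖`. -/
theorem exists_integral_norm_le (R : ℝ) :
    ∃ C : ℝ, 0 ≤ C ∧ ∀ f : L2Half, ∫ x in Ioc 0 R, ‖f x‖ ≤ C * ‖f‖ := by
  refine ⟨(((volume.restrict (Ioc 0 R)) univ) ^ (1 / (1 : ENNReal).toReal -
    1 / (2 : ENNReal).toReal)).toReal, ENNReal.toReal_nonneg, fun f => ?_⟩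
  have h1 : ∫ x in Ioc 0 R, ‖f x‖ = (eLpNorm f 1 (volume.restrict (Ioc 0 R))).toReal := by
    rw [integral_norm_eq_lintegral_enorm (memLp_Ioc f R).aestronglyMeasurable,
      eLpNorm_one_eq_lintegral_enorm]
  have h2 := eLpNorm_le_eLpNorm_mul_rpow_measure_univ (μ := volume.restrict (Ioc 0 R))
    (one_le_two : (1 : ENNReal) ≤ 2) (memLp_Ioc f R).aestronglyMeasurable
  have h3 : eLpNorm f 2 (volume.restrict (Ioc 0 R)) ≤ eLpNorm f 2 halfLine :=
    eLpNorm_mono_measure _ (Measure.restrict_mono Ioc_subset_Ioi_self le_rfl)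
  rw [h1, Lp.norm_def, mul_comm, ← ENNReal.toReal_mul]
  refine ENNReal.toReal_mono (ENNReal.mul_ne_top (Lp.eLpNorm_ne_top f) ?_)
    (h2.trans (by gcongr))
  refine (ENNReal.rpow_lt_top_of_nonneg (by norm_num) ?_).ne
  simp

variable (q : ℝ → ℝ)

/-- The functional `f ↦ (L⁻¹ f)'(0)`. -/
def initialSlope : L2Half →L[ℂ] ℂ :=
  innerSL ℂ (toL2 (backwardPrimitive 1 ((Ioc (0 : ℝ) 1).indicator fun s => -6 + 12 * s))) -
  innerSL ℂ (toL2 fun x => -(Ioc (0 : ℝ) 1).indicator (fun s => -6 + 12 * s) x +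
    q x * backwardPrimitive 1 ((Ioc (0 : ℝ) 1).indicator fun s => -6 + 12 * s) x) ∘L
    boundedInverse (friedrichs (sturmLiouville q))

/-- The functional `f ↦ (L⁻¹ f)(x)`. -/
def solutionEval (x : ℝ) : L2Half →L[ℂ] ℂ :=
  (x : ℂ) • initialSlope q + (innerSL ℂ (toL2 fun s => q s * max (x - s) 0) ∘L
    boundedInverse (friedrichs (sturmLiouville q)) - innerSL ℂ (toL2 fun s => max (x - s) 0))

variable {q} (hq : ContinuousOn q (Ici 0))

include hq

theorem initialSlope_apply (f : L2Half) : initialSlope q f =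
    boundaryDeriv q (boundedInverse (friedrichs (sturmLiouville q)) f) f := by
  rw [boundaryDeriv_eq hq]
  rfl

theorem solutionEval_apply (x : ℝ) (f : L2Half) : solutionEval q x f =
    x • boundaryDeriv q (boundedInverse (friedrichs (sturmLiouville q)) f) f +
      secondPrimitive (secondDeriv q (boundedInverse (friedrichs (sturmLiouville q)) f) f) x := by
  set b := boundedInverse (friedrichs (sturmLiouville q)) f with hb
  obtain ⟨C, hC0, hC⟩ := exists_bound_Icc hq x
  have h0 : ∀ s, x < s → max (x - s) 0 = 0 := fun s hs => max_eq_right (by linarith)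
  have hle : ∀ s, 0 < s → max (x - s) 0 ≤ |x| := fun s hs =>
    max_le (by linarith [le_abs_self x]) (abs_nonneg x)
  have hm1 : MemLp (fun s => ((max (x - s) 0 : ℝ) : ℂ)) 2 halfLine :=
    memLp_of_bounded (C := |x|) (R := x) (Continuous.aestronglyMeasurable (by fun_prop))
      (fun s hs => by rw [abs_of_nonneg (le_max_right _ _)]; exact hle s hs) h0
  have hm2 : MemLp (fun s => ((q s * max (x - s) 0 : ℝ) : ℂ)) 2 halfLine := by
    refine memLp_of_bounded (C := C * |x|) (R := x) ((aestronglyMeasurable_coeff hq).mul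
      (Continuous.aestronglyMeasurable (by fun_prop))) (fun s hs => ?_)
      (fun s hs => by rw [h0 s hs, mul_zero])
    by_cases hsx : s ≤ x
    · rw [abs_mul, abs_of_nonneg (le_max_right (x - s) 0)]
      exact mul_le_mul (hC s ⟨hs.le, hsx⟩) (hle s hs) (le_max_right _ _) hC0
    · rw [h0 s (not_le.1 hsx), mul_zero, abs_zero]
      positivity
  have h1 : solutionEval q x f = x • initialSlope q f +
      (inner ℂ (toL2 fun s => q s * max (x - s) 0) b - inner ℂ (toL2 fun s => max (x - s) 0) f) :=
    rfl
  rw [h1, initialSlope_apply hq, inner_toL2 hm1, inner_toL2 hm2,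
    setIntegral_Ioi_eq (R := x) (fun s hs => by rw [h0 s hs, mul_zero, zero_smul]),
    setIntegral_Ioi_eq (R := x) (fun s hs => by rw [h0 s hs, zero_smul]), ← integral_sub]
  · congr 1
    refine setIntegral_congr_fun measurableSet_Ioc fun s hs => ?_
    simp only [secondDeriv, max_eq_left (sub_nonneg.2 hs.2), Complex.real_smul]
    push_cast
    ring
  · have := (integrableOn_max_smul (x := x) (R := x) (h := fun s => (q s : ℂ) * b s)
      ((memLp_coeff_mul hq (memLp_Ioc b x)).integrable one_le_two))
    refine this.congr (Eventually.of_forall fun s => ?_)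
    simp only [Complex.real_smul]
    push_cast
    ring
  · exact integrableOn_max_smul (integrableOn_Ioc f x) x

theorem hasDerivAt_solutionEval_apply (f : L2Half) (x : ℝ) :
    HasDerivAt (fun x => solutionEval q x f) (initialSlope q f + ∫ s in Ioc 0 x,
      secondDeriv q (boundedInverse (friedrichs (sturmLiouville q)) f) f s) x := by
  simp only [solutionEval_apply hq, initialSlope_apply hq]
  refine HasDerivAt.add ?_ (hasDerivAt_secondPrimitive (fun R => integrableOn_secondDeriv hq _ _ R) x)
  simpa using (hasDerivAt_id x).smul_const
    (boundaryDeriv q (boundedInverse (friedrichs (sturmLiouville q)) f) f)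

theorem solutionEval_zero : solutionEval q 0 = 0 := by
  ext f
  rw [solutionEval_apply hq, secondPrimitive_of_nonpos _ le_rfl]
  simp

/-- The `x`-derivative of the value at `f` is at most a constant times `‖f‖`, locally uniformly in
`x`; hence a local Lipschitz bound in operator norm. Norm continuity is what allows functionals to
be integrated in `oddDeriv`. -/
theorem continuous_solutionEval : Continuous (solutionEval q) := by
  have key : ∀ R : ℝ, ∃ K : ℝ, 0 ≤ K ∧ ∀ x ∈ Icc (-R) R, ∀ y ∈ Icc (-R) R,
      ‖solutionEval q y - solutionEval q x‖ ≤ K * ‖y - x‖ := by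
    intro R
    obtain ⟨C, hC0, hC⟩ := exists_bound_Icc hq R
    obtain ⟨D, hD0, hD⟩ := exists_integral_norm_le R
    set B := boundedInverse (friedrichs (sturmLiouville q))
    refine ⟨‖initialSlope q‖ + (C * (D * ‖B‖) + D), by positivity, fun x hx y hy => ?_⟩
    refine ContinuousLinearMap.opNorm_le_bound _ (by positivity) fun f => ?_
    have hb : ∀ z ∈ Icc (-R) R, ‖initialSlope q f + ∫ s in Ioc 0 z, secondDeriv q (B f) f s‖ ≤
        (‖initialSlope q‖ + (C * (D * ‖B‖) + D)) * ‖f‖ := by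
      intro z hz
      have h1 : ‖∫ s in Ioc 0 z, secondDeriv q (B f) f s‖ ≤
          ∫ s in Ioc 0 R, (C * ‖B f s‖ + ‖f s‖) := by
        have hi : IntegrableOn (fun s => C * ‖B f s‖ + ‖f s‖) (Ioc 0 R) :=
          ((integrableOn_Ioc (B f) R).norm.const_mul C).add (integrableOn_Ioc f R).norm
        refine (norm_integral_le_of_norm_le
          (hi.mono_set (Ioc_subset_Ioc_right hz.2)) ?_).trans (setIntegral_mono_set hi
          (Eventually.of_forall fun s => by positivity)
          (Ioc_subset_Ioc_right hz.2).eventuallyLE)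
        filter_upwards [ae_restrict_mem measurableSet_Ioc] with s hs
        refine (norm_sub_le _ _).trans (add_le_add ?_ le_rfl)
        rw [norm_mul, Complex.norm_real]
        exact mul_le_mul_of_nonneg_right (hC s ⟨hs.1.le, hs.2.trans hz.2⟩) (norm_nonneg _)
      rw [integral_add ((integrableOn_Ioc (B f) R).norm.const_mul C) (integrableOn_Ioc f R).norm,
        integral_const_mul] at h1
      have h2 : C * ∫ s in Ioc 0 R, ‖B f s‖ ≤ C * (D * (‖B‖ * ‖f‖)) :=
        mul_le_mul_of_nonneg_left ((hD (B f)).trans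
          (mul_le_mul_of_nonneg_left (B.le_opNorm f) hD0)) hC0
      have h3 := hD f
      have h4 := (initialSlope q).le_opNorm f
      refine (norm_add_le _ _).trans ?_
      linarith
    have := (convex_Icc (-R) R).norm_image_sub_le_of_norm_hasDerivWithin_le
      (fun z hz => (hasDerivAt_solutionEval_apply hq f z).hasDerivWithinAt) hb hx hy
    rw [_root_.sub_apply]
    refine this.trans_eq (by ring)
  rw [continuous_iff_continuousAt]
  intro x
  obtain ⟨K, hK0, hK⟩ := key (|x| + 1)
  have hx : Icc (-(|x| + 1)) (|x| + 1) ∈ 𝓝 x :=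
    Icc_mem_nhds (by linarith [neg_abs_le x]) (by linarith [le_abs_self x])
  rw [ContinuousAt, tendsto_iff_norm_sub_tendsto_zero]
  have hlim : Tendsto (fun y => K * ‖y - x‖) (𝓝 x) (𝓝 0) := by
    have : ContinuousAt (fun y => K * ‖y - x‖) x := by fun_prop
    simpa [ContinuousAt] using this
  refine squeeze_zero' (Eventually.of_forall fun y => norm_nonneg _) ?_ hlim
  filter_upwards [hx] with y hy using hK x (mem_of_mem_nhds hx) y hy

variable (hA : IsPositiveDefinite (sturmLiouville q))
  (hd : Dense ((sturmLiouville q).domain : Set L2Half))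

include hA hd

/-- The range of `L⁻¹` lies in the form domain, so the constant term of the general weak solution
drops out. -/
theorem ae_eq_solutionEval (f : L2Half) :
    boundedInverse (friedrichs (sturmLiouville q)) f =ᵐ[halfLine] fun x => solutionEval q x f := by
  have h := hA.inner_boundedInverse_apply hd f
  filter_upwards [ae_eq_affine_add hq h] with x hx
  rw [hx, boundaryValue_eq_zero hq hA (hA.boundedInverse_mem_formDomain hd f) h, zero_add,
    solutionEval_apply hq]

/-- `L⁻¹ f` vanishes at `0` in any case; without slope it has zero Cauchy data, which is all that
the minimal domain asks for. -/
theorem exists_domain_of_initialSlope {f : L2Half} (hf : initialSlope q f = 0) :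
    ∃ ζ : (sturmLiouville q).domain,
      (ζ : L2Half) = boundedInverse (friedrichs (sturmLiouville q)) f ∧ sturmLiouville q ζ = f := by
  refine exists_domain_of_eq_secondPrimitive hq ?_
  filter_upwards [ae_eq_solutionEval hq hA hd f] with x hx
  rw [hx, solutionEval_apply hq, ← initialSlope_apply hq, hf, smul_zero, zero_add]

theorem initialSlope_of_domain (ζ : (sturmLiouville q).domain) :
    initialSlope q (sturmLiouville q ζ) = 0 := by
  rw [initialSlope_apply hq, hA.boundedInverse_apply hd]
  exact (boundary_of_domain hq ζ).2

end Evaluation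

/-! ### Odd reflection across the Dirichlet endpoint -/

section OddExtension

variable (q : ℝ → ℝ)

/-- The odd extension of `solutionEval` to the real line. -/
def oddEval (x : ℝ) : L2Half →L[ℂ] ℂ := solutionEval q (max x 0) - solutionEval q (max (-x) 0)

/-- The second derivative of `x ↦ (L⁻² f)(x)`, extended to the real line. -/
def oddSecond (x : ℝ) : L2Half →L[ℂ] ℂ :=
  (q |x| : ℂ) • (oddEval q x ∘L boundedInverse (friedrichs (sturmLiouville q))) - oddEval q x

/-- The derivative of `x ↦ (L⁻² f)(x)`, extended to the real line. -/
def oddDeriv (x : ℝ) : L2Half →L[ℂ] ℂ :=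
  initialSlope q ∘L boundedInverse (friedrichs (sturmLiouville q)) +
    ∫ s in (0 : ℝ)..x, oddSecond q s

theorem oddEval_neg (x : ℝ) : oddEval q (-x) = -oddEval q x := by
  simp [oddEval]

theorem oddSecond_neg (x : ℝ) : oddSecond q (-x) = -oddSecond q x := by
  rw [oddSecond, oddSecond, oddEval_neg, abs_neg]
  ext f
  simp
  ring

theorem oddDeriv_neg (x : ℝ) : oddDeriv q (-x) = oddDeriv q x := by
  rw [oddDeriv, oddDeriv, intervalIntegral.integral_symm]
  have h := intervalIntegral.integral_comp_neg (fun s => oddSecond q s) (a := 0) (b := x)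
  simp only [oddSecond_neg, intervalIntegral.integral_neg, neg_zero] at h
  rw [← h, neg_neg]

variable {q} (hq : ContinuousOn q (Ici 0))

include hq

theorem oddEval_of_nonneg {x : ℝ} (hx : 0 ≤ x) : oddEval q x = solutionEval q x := by
  rw [oddEval, max_eq_left hx, max_eq_right (by linarith), solutionEval_zero hq, sub_zero]

theorem continuous_oddEval : Continuous (oddEval q) := by
  have := continuous_solutionEval hq
  unfold oddEval
  fun_prop

theorem continuous_coeff_abs : Continuous fun x => q |x| :=
  hq.comp_continuous continuous_abs abs_nonneg

theorem continuous_oddSecond : Continuous (oddSecond q) := by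
  have h1 := continuous_oddEval hq
  have h2 := continuous_coeff_abs hq
  unfold oddSecond
  exact ((Complex.continuous_ofReal.comp h2).smul (h1.clm_comp continuous_const)).sub h1

theorem hasDerivAt_oddDeriv (x : ℝ) : HasDerivAt (oddDeriv q) (oddSecond q x) x :=
  ((continuous_oddSecond hq).integral_hasStrictDerivAt 0 x).hasDerivAt.const_add _

theorem continuous_oddDeriv : Continuous (oddDeriv q) :=
  continuous_iff_continuousAt.2 fun x => (hasDerivAt_oddDeriv hq x).continuousAt

variable (hA : IsPositiveDefinite (sturmLiouville q))
  (hd : Dense ((sturmLiouville q).domain : Set L2Half))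

include hA hd

theorem oddDeriv_apply {x : ℝ} (hx : 0 ≤ x) (f : L2Half) : oddDeriv q x f =
    initialSlope q (boundedInverse (friedrichs (sturmLiouville q)) f) + ∫ s in Ioc 0 x,
      secondDeriv q (boundedInverse (friedrichs (sturmLiouville q))
        (boundedInverse (friedrichs (sturmLiouville q)) f))
        (boundedInverse (friedrichs (sturmLiouville q)) f) s := by
  rw [oddDeriv, _root_.add_apply, ContinuousLinearMap.comp_apply,
    ContinuousLinearMap.intervalIntegral_apply
      ((continuous_oddSecond hq).intervalIntegrable 0 x),
    intervalIntegral.integral_of_le hx]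
  congr 1
  refine integral_congr_ae ?_
  filter_upwards [ae_Ioc_of_ae (ae_eq_solutionEval hq hA hd f) x, ae_Ioc_of_ae
    (ae_eq_solutionEval hq hA hd (boundedInverse (friedrichs (sturmLiouville q)) f)) x,
    ae_restrict_mem measurableSet_Ioc] with s h1 h2 hs
  rw [secondDeriv, h1, h2, oddSecond, oddEval_of_nonneg hq hs.1.le, abs_of_pos hs.1]
  rfl

/-- The fundamental theorem of calculus for `L⁻² f` when `x ≥ 0`; negative `x` follow by parity, the
left side being odd and the integrand even. -/
theorem oddEval_comp_eq_integral (x : ℝ) :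
    oddEval q x ∘L boundedInverse (friedrichs (sturmLiouville q)) =
      ∫ s in (0 : ℝ)..x, oddDeriv q s := by
  have hnn : ∀ x, 0 ≤ x → oddEval q x ∘L boundedInverse (friedrichs (sturmLiouville q)) =
      ∫ s in (0 : ℝ)..x, oddDeriv q s := by
    intro x hx
    ext f
    have hc := continuous_oddDeriv hq
    rw [ContinuousLinearMap.intervalIntegral_apply (hc.intervalIntegrable 0 x),
      intervalIntegral.integral_eq_sub_of_hasDerivAt (f := fun s => solutionEval q s
        (boundedInverse (friedrichs (sturmLiouville q)) f)),
      solutionEval_zero hq, ContinuousLinearMap.comp_apply, oddEval_of_nonneg hq hx]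
    · simp
    · intro s hs
      rw [uIcc_of_le hx] at hs
      rw [oddDeriv_apply hq hA hd hs.1]
      exact hasDerivAt_solutionEval_apply hq _ s
    · exact (hc.clm_apply continuous_const).intervalIntegrable 0 x
  rcases le_total 0 x with hx | hx
  · exact hnn x hx
  · have h := hnn (-x) (by linarith)
    have h2 := intervalIntegral.integral_comp_neg (fun s => oddDeriv q s) (a := 0) (b := x)
    simp only [oddDeriv_neg, neg_zero] at h2
    rw [intervalIntegral.integral_symm, ← h2, oddEval_neg, ContinuousLinearMap.neg_comp] at h
    exact neg_injective h

theorem hasDerivAt_oddEval (x : ℝ) : HasDerivAt (fun x => oddEval q x ∘L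
    boundedInverse (friedrichs (sturmLiouville q))) (oddDeriv q x) x := by
  have : (fun x => oddEval q x ∘L boundedInverse (friedrichs (sturmLiouville q))) =
      fun x => ∫ s in (0 : ℝ)..x, oddDeriv q s := funext (oddEval_comp_eq_integral hq hA hd)
  rw [this]
  exact ((continuous_oddDeriv hq).integral_hasStrictDerivAt 0 x).hasDerivAt

end OddExtension

end WaveSpectrum

end

noncomputable section

namespace WaveSpectrum

/-! ### Smooth waves on the half-line: finite speed of propagation and unique continuation -/

section WaveOrbit

theorem hasDerivAt_comp_affine {F : Type*} [NormedAddCommGroup F] [NormedSpace ℝ F] {f f' : ℝ → F}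
    (hf : ∀ x, HasDerivAt f (f' x) x) (a c s : ℝ) :
    HasDerivAt (fun s => f (a + c * s)) (c • f' (a + c * s)) s :=
  (hf (a + c * s)).scomp s (by simpa using ((hasDerivAt_id s).const_mul c).const_add a)

variable {q : ℝ → ℝ}

/-- `g` is a twice differentiable solution of `g'' + L g = 0`, written with `B = L⁻¹`. -/
structure IsWaveOrbit (q : ℝ → ℝ) (g g' g'' : ℝ → L2Half) : Prop where
  deriv : ∀ t, HasDerivAt g (g' t) t
  deriv' : ∀ t, HasDerivAt g' (g'' t) t
  eq : ∀ t, boundedInverse (friedrichs (sturmLiouville q)) (g'' t) = -g t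

theorem exists_bound_triangle {F : ℝ → ℝ → ℂ} (hF : Continuous fun z : ℝ × ℝ => F z.1 z.2)
    (r₀ T : ℝ) : ∃ C : ℝ, ∀ s r, 0 ≤ s → |r - r₀| ≤ T - s → ‖F s r‖ ≤ C := by
  obtain ⟨C, hC⟩ := ((isCompact_Icc (a := (0 : ℝ)) (b := T)).prod
    (isCompact_Icc (a := r₀ - T) (b := r₀ + T))).exists_bound_of_continuousOn hF.continuousOn
  refine ⟨C, fun s r hs hr => hC (s, r) ⟨⟨hs, ?_⟩, ?_, ?_⟩⟩
  · linarith [abs_nonneg (r - r₀)]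
  · linarith [(abs_le.1 hr).1]
  · linarith [(abs_le.1 hr).2]

variable (hq : ContinuousOn q (Ici 0)) (hA : IsPositiveDefinite (sturmLiouville q))
  (hd : Dense ((sturmLiouville q).domain : Set L2Half)) {g g' g'' : ℝ → L2Half}
  (hg : IsWaveOrbit q g g' g'')

include hg in
-- The wave equation for `W(t, x) = (L⁻² g(t))(x)`: the orbit equation gives `W_tt = -(L⁻¹ g)(x)`,
-- and `W_xx = q W - (L⁻¹ g)(x)`.
theorem IsWaveOrbit.oddSecond_sub (x t : ℝ) : oddSecond q x (g t) -
    oddEval q x (boundedInverse (friedrichs (sturmLiouville q)) (g'' t)) =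
      (q |x| : ℂ) * oddEval q x (boundedInverse (friedrichs (sturmLiouville q)) (g t)) := by
  rw [hg.eq, oddSecond, map_neg, _root_.sub_apply, _root_.smul_apply,
    ContinuousLinearMap.comp_apply, smul_eq_mul]
  ring

include hq hg in
theorem IsWaveOrbit.continuous_oddEval {φ ψ : ℝ × ℝ → ℝ} (hφ : Continuous φ) (hψ : Continuous ψ) :
    Continuous fun z => oddEval q (φ z)
      (boundedInverse (friedrichs (sturmLiouville q)) (g (ψ z))) := by
  have h1 : Continuous g := continuous_iff_continuousAt.2 fun t => (hg.deriv t).continuousAt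
  exact ((WaveSpectrum.continuous_oddEval hq).comp hφ).clm_apply
    ((boundedInverse (friedrichs (sturmLiouville q))).continuous.comp (h1.comp hψ))

include hq hA hd hg

/-- Uniqueness for the Cauchy problem with data at `t = 0`. -/
theorem IsWaveOrbit.eq_zero_of_initial_data {p T : ℝ} (h0 : ∀ r, |r - p| ≤ T →
      oddEval q r (boundedInverse (friedrichs (sturmLiouville q)) (g 0)) = 0 ∧
      oddEval q r (boundedInverse (friedrichs (sturmLiouville q)) (g' 0)) = 0 ∧
      oddDeriv q r (g 0) = 0) (s r : ℝ) (hs : 0 ≤ s) (hr : |r - p| ≤ T - s) :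
    oddEval q r (boundedInverse (friedrichs (sturmLiouville q)) (g s)) = 0 := by
  set B := boundedInverse (friedrichs (sturmLiouville q)) with hB
  have hε := hasDerivAt_oddEval hq hA hd
  have hδ := hasDerivAt_oddDeriv hq
  obtain ⟨C, hC⟩ := exists_bound_triangle (F := fun s r => -(q |r| : ℂ))
    (Complex.continuous_ofReal.comp ((continuous_coeff_abs hq).comp continuous_snd)).neg p T
  obtain ⟨M, hM⟩ := exists_bound_triangle (F := fun s r => oddEval q r (B (g s)))
    (hg.continuous_oddEval hq continuous_snd continuous_fst) p T
  refine eq_zero_of_cauchy_data (W := fun s r => oddEval q r (B (g s)))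
    (Ws := fun s r => oddEval q r (B (g' s))) (Wr := fun s r => oddDeriv q r (g s))
    -- The two inverse powers of `L` in `W` make `Ws ± Wr` differentiable along characteristics
    -- although `g''` is merely `L₂`-valued.
    (p := fun s r => -(q |r| : ℂ)) (fun r s => ?_) (fun r s => ?_) (fun r s => ?_) hC hM h0 s r hs hr
  · exact (oddEval q r ∘L B).hasFDerivAt.restrictScalars ℝ |>.comp_hasDerivAt s (hg.deriv s)
  · have h1 : HasDerivAt (fun s => oddEval q (r - s) ∘L B) (-oddDeriv q (r - s)) s := by
      exact (hε (r - s)).comp_const_sub r s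
    have h2 : HasDerivAt (fun s => oddDeriv q (r - s)) (-oddSecond q (r - s)) s := by
      exact (hδ (r - s)).comp_const_sub r s
    have h3 := (hasDerivAt_clm_apply h1 (hg.deriv' s)).add (hasDerivAt_clm_apply h2 (hg.deriv s))
    refine h3.congr_deriv ?_
    have := hg.oddSecond_sub (r - s) s
    simp only [ContinuousLinearMap.comp_apply, _root_.neg_apply]
    linear_combination -this
  · have h1 : HasDerivAt (fun s => oddEval q (r + s) ∘L B) (oddDeriv q (r + s)) s := by
      exact (hε (r + s)).comp_const_add r s
    have h2 : HasDerivAt (fun s => oddDeriv q (r + s)) (oddSecond q (r + s)) s := by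
      exact (hδ (r + s)).comp_const_add r s
    have h3 := (hasDerivAt_clm_apply h1 (hg.deriv' s)).sub (hasDerivAt_clm_apply h2 (hg.deriv s))
    refine h3.congr_deriv ?_
    have := hg.oddSecond_sub (r + s) s
    simp only [ContinuousLinearMap.comp_apply]
    linear_combination -this

/-- Uniqueness for the lateral Cauchy problem with data at the point `p`. -/
theorem IsWaveOrbit.eq_zero_of_lateral_data {p T : ℝ} (h0 : ∀ r, |r| ≤ T →
      oddEval q p (boundedInverse (friedrichs (sturmLiouville q)) (g r)) = 0 ∧
      oddEval q p (boundedInverse (friedrichs (sturmLiouville q)) (g' r)) = 0 ∧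
      oddDeriv q p (g r) = 0) (x : ℝ) (hx : |x - p| ≤ T) :
    oddEval q x (boundedInverse (friedrichs (sturmLiouville q)) (g 0)) = 0 := by
  set B := boundedInverse (friedrichs (sturmLiouville q)) with hB
  have hε := hasDerivAt_oddEval hq hA hd
  have hδ := hasDerivAt_oddDeriv hq
  -- Space becomes the evolution variable: `σ = ±1` is the direction from `p` to `x`, `s` the
  -- distance covered, `r` the physical time. The equation keeps its form, with the sign of the
  -- potential reversed.
  obtain ⟨σ, s, hσ, hs, hxs⟩ : ∃ σ s : ℝ, σ * σ = 1 ∧ s = |x - p| ∧ x = p + σ * s := by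
    rcases abs_choice (x - p) with h | h
    · exact ⟨1, _, by norm_num, rfl, by rw [h]; ring⟩
    · exact ⟨-1, _, by norm_num, rfl, by rw [h]; ring⟩
  obtain ⟨C, hC⟩ := exists_bound_triangle (F := fun s r => (q |p + σ * s| : ℂ))
    (Complex.continuous_ofReal.comp ((continuous_coeff_abs hq).comp (by fun_prop))) 0 T
  obtain ⟨M, hM⟩ := exists_bound_triangle (F := fun s r => oddEval q (p + σ * s) (B (g r)))
    (hg.continuous_oddEval hq (by fun_prop) continuous_snd) 0 T
  have hε' : ∀ s, HasDerivAt (fun s => oddEval q (p + σ * s) ∘L B)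
      (σ • oddDeriv q (p + σ * s)) s := fun s =>
    hasDerivAt_comp_affine hε p σ s
  have hδ' : ∀ s, HasDerivAt (fun s => oddDeriv q (p + σ * s))
      (σ • oddSecond q (p + σ * s)) s := fun s =>
    hasDerivAt_comp_affine hδ p σ s
  have hσ' : (σ : ℂ) * σ = 1 := by exact_mod_cast hσ
  have key := eq_zero_of_cauchy_data (W := fun s r => oddEval q (p + σ * s) (B (g r)))
    (Ws := fun s r => (σ : ℂ) * oddDeriv q (p + σ * s) (g r))
    (Wr := fun s r => oddEval q (p + σ * s) (B (g' r)))
    (p := fun s r => (q |p + σ * s| : ℂ)) (r₀ := 0) (T := T)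
    (fun r s => ?_) (fun r s => ?_) (fun r s => ?_) hC hM (fun r hr => ?_) s 0
    (by rw [hs]; positivity) (by rw [hs]; simpa using hx)
  · rw [hxs]; exact key
  · refine (hasDerivAt_clm_apply (hε' s) (hasDerivAt_const s (g r))).congr_deriv ?_
    simp
  · have h1 : HasDerivAt (fun s => g (r - s)) (-g' (r - s)) s := by
      exact (hg.deriv (r - s)).comp_const_sub r s
    have h2 : HasDerivAt (fun s => g' (r - s)) (-g'' (r - s)) s := by
      exact (hg.deriv' (r - s)).comp_const_sub r s
    have h3 := ((hasDerivAt_clm_apply (hδ' s) h1).const_mul (σ : ℂ)).add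
      (hasDerivAt_clm_apply (hε' s) h2)
    refine h3.congr_deriv ?_
    have := hg.oddSecond_sub (p + σ * s) (r - s)
    simp only [ContinuousLinearMap.comp_apply, _root_.smul_apply, map_neg, Complex.real_smul]
    linear_combination this + hσ' * oddSecond q (p + σ * s) (g (r - s))
  · have h1 : HasDerivAt (fun s => g (r + s)) (g' (r + s)) s := by
      exact (hg.deriv (r + s)).comp_const_add r s
    have h2 : HasDerivAt (fun s => g' (r + s)) (g'' (r + s)) s := by
      exact (hg.deriv' (r + s)).comp_const_add r s
    have h3 := ((hasDerivAt_clm_apply (hδ' s) h1).const_mul (σ : ℂ)).sub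
      (hasDerivAt_clm_apply (hε' s) h2)
    refine h3.congr_deriv ?_
    have := hg.oddSecond_sub (p + σ * s) (r + s)
    simp only [ContinuousLinearMap.comp_apply, _root_.smul_apply, Complex.real_smul]
    linear_combination this + hσ' * oddSecond q (p + σ * s) (g (r + s))
  · obtain ⟨h1, h2, h3⟩ := h0 r (by simpa using hr)
    simp only [mul_zero, add_zero]
    exact ⟨h1, by rw [h3, mul_zero], h2⟩

end WaveOrbit

/-! ### Finite speed of propagation -/

section FiniteSpeed

variable {q : ℝ → ℝ} (hq : ContDiffOn ℝ ∞ q (Ici 0))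
  (hA : IsPositiveDefinite (sturmLiouville q))

include hq hA

theorem boundedInverse_diffExpr {φ : ℝ → ℝ} (hφ : IsBump φ) :
    boundedInverse (friedrichs (sturmLiouville q)) (toL2 (diffExpr q φ)) = toL2 φ := by
  obtain ⟨ζ, h1, h2⟩ := hφ.exists_domain hq
  rw [← h1, ← h2, hA.boundedInverse_apply (dense_domain hq)]

theorem solutionEval_diffExpr {φ : ℝ → ℝ} (hφ : IsBump φ) {x : ℝ} (hx : 0 ≤ x) :
    solutionEval q x (toL2 (diffExpr q φ)) = φ x := by
  have hc := hq.continuousOn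
  rcases hx.eq_or_lt with rfl | hx
  · rw [solutionEval_zero hc, hφ.eq_zero le_rfl]
    simp
  · have h1 := ae_eq_solutionEval hc hA (dense_domain hq) (toL2 (diffExpr q φ))
    rw [boundedInverse_diffExpr hq hA hφ] at h1
    have h2 : (fun x => solutionEval q x (toL2 (diffExpr q φ))) =ᵐ[halfLine] fun x => (φ x : ℂ) :=
      h1.symm.trans (coeFn_toL2 hφ.memLp)
    exact Measure.eqOn_open_of_ae_eq h2 isOpen_Ioi
      ((continuous_solutionEval hc).clm_apply continuous_const).continuousOn
      (Complex.continuous_ofReal.comp hφ.contDiff.continuous).continuousOn hx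

theorem oddEval_diffExpr_eq_zero {φ : ℝ → ℝ} (hφ : IsBump φ) {x : ℝ} (hx : φ |x| = 0) :
    oddEval q x (toL2 (diffExpr q φ)) = 0 := by
  have key : ∀ x, 0 ≤ x → φ x = 0 → oddEval q x (toL2 (diffExpr q φ)) = 0 := fun x hx h => by
    rw [oddEval_of_nonneg hq.continuousOn hx, solutionEval_diffExpr hq hA hφ hx, h,
      Complex.ofReal_zero]
  rcases abs_choice x with h | h
  · exact key x (abs_eq_self.1 h) (h ▸ hx)
  · rw [← neg_neg x, oddEval_neg, _root_.neg_apply, key (-x) (h ▸ abs_nonneg x) (h ▸ hx), neg_zero]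

/-- Finite speed of propagation for smooth data. -/
theorem sineFamily_bump_eq_zero {φ : ℝ → ℝ} (hφ : IsBump φ) {t : ℝ} (ht : 0 ≤ t) :
    ∀ᵐ x ∂halfLine, (∀ r, |r - x| ≤ t → φ |r| = 0) →
      sineFamily (sturmLiouville q) t (toL2 φ) x = 0 := by
  have hd := dense_domain hq
  have hc := hq.continuousOn
  obtain ⟨h1, -⟩ := hφ.diffExpr hq
  obtain ⟨h2, -⟩ := h1.diffExpr hq
  set B := boundedInverse (friedrichs (sturmLiouville q)) with hB
  have e1 : B (toL2 (diffExpr q φ)) = toL2 φ := boundedInverse_diffExpr hq hA hφ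
  have e2 : B (toL2 (diffExpr q (diffExpr q φ))) = toL2 (diffExpr q φ) :=
    boundedInverse_diffExpr hq hA h1
  have e3 : B (toL2 (diffExpr q (diffExpr q (diffExpr q φ)))) =
    toL2 (diffExpr q (diffExpr q φ)) := boundedInverse_diffExpr hq hA h2
  -- `diffExpr` acts on bumps as `L`, so that `z₂ = L² φ` and `z₃ = L³ φ`. Then `S(t) φ = L⁻² S(t)
  -- z₂`, and `S(t) z₂` is a twice differentiable orbit.
  set z₂ := toL2 (diffExpr q (diffExpr q φ)) with hz₂
  set z₃ := toL2 (diffExpr q (diffExpr q (diffExpr q φ))) with hz₃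
  have hg : IsWaveOrbit q (fun t => sineFamily (sturmLiouville q) t z₂)
      (fun t => cosineFamily (sturmLiouville q) t z₃)
      (fun t => -sineFamily (sturmLiouville q) t z₃) := by
    refine ⟨fun t => ?_, fun t => hasDerivAt_cosineFamily hA hd t z₃, fun t => ?_⟩
    · have := hasDerivAt_sineFamily hA hd t z₃
      rwa [← hB, e3] at this
    · rw [map_neg, boundedInverse_sineFamily hA hd, ← hB, e3]
  have e4 : sineFamily (sturmLiouville q) t (toL2 φ) =
      B (B (sineFamily (sturmLiouville q) t z₂)) := by
    rw [hB, boundedInverse_sineFamily hA hd, boundedInverse_sineFamily hA hd, ← hB, e2, e1]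
  rw [e4]
  filter_upwards [ae_eq_solutionEval hc hA hd (B (sineFamily (sturmLiouville q) t z₂)),
    ae_restrict_mem measurableSet_Ioi] with x hx hx0 hr
  rw [hx, ← oddEval_of_nonneg hc (mem_Ioi.1 hx0).le]
  refine hg.eq_zero_of_initial_data hc hA hd (p := x) (T := t) (fun r hr' => ⟨?_, ?_, ?_⟩) t x ht
    (by simp)
  · simp [sineFamily_zero]
  · rw [cosineFamily_zero hA hd, ← hB, e3, e2]
    exact oddEval_diffExpr_eq_zero hq hA hφ (hr r hr')
  · simp [sineFamily_zero]

/-- Finite speed of propagation. -/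
theorem sineFamily_eq_zero_of_lt_dist {y : L2Half} {E U : Set ℝ} {t : ℝ} (ht : 0 ≤ t)
    (hy : y ∈ L2On E) (hU : IsOpen U) (hU0 : U ⊆ Ioi 0)
    (hEU : ∀ u ∈ U, ∀ x ∈ E, 0 < x → t < |u - x|) :
    ∀ᵐ x ∂halfLine, x ∈ U → sineFamily (sturmLiouville q) t y x = 0 := by
  refine ae_eq_zero_of_inner_bump hU hU0 fun φ hφ hφU => ?_
  -- Self-adjointness moves the wave onto the bump `φ`, where the pointwise statement is available;
  -- `y` itself is only in `L₂`.
  rw [← inner_sineFamily, L2.inner_def]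
  refine integral_eq_zero_of_ae ?_
  have hy' : ∀ᵐ x ∂halfLine, x ∉ E → y x = 0 := hy
  filter_upwards [sineFamily_bump_eq_zero hq hA hφ ht, hy', ae_restrict_mem measurableSet_Ioi]
    with x h1 h2 hx
  by_cases hxE : x ∈ E
  · rw [h1 fun r hr => ?_]
    · simp
    · by_contra h
      have := hEU |r| (hφU (subset_tsupport _ h)) x hxE hx
      have h3 := abs_abs_sub_abs_le_abs_sub r x
      rw [abs_of_pos (mem_Ioi.1 hx)] at h3
      linarith
  · rw [h2 hxE]
    simp

end FiniteSpeed

end WaveSpectrum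

end

noncomputable section

namespace WaveSpectrum

/-! ### The subspaces `L₂(E)` -/

section L2On

variable {E F : Set ℝ}

theorem mem_L2On {y : L2Half} : y ∈ L2On E ↔ ∀ᵐ x ∂halfLine, x ∉ E → y x = 0 := Iff.rfl

theorem L2On_mono (h : ∀ᵐ x ∂halfLine, x ∈ E → x ∈ F) : L2On E ≤ L2On F := by
  intro y hy
  rw [mem_L2On] at hy ⊢
  filter_upwards [h, hy] with x h1 h2 hx using h2 fun hE => hx (h1 hE)

theorem L2On_congr (h : ∀ᵐ x ∂halfLine, x ∈ E ↔ x ∈ F) : L2On E = L2On F :=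
  le_antisymm (L2On_mono (h.mono fun _ hx => hx.1)) (L2On_mono (h.mono fun _ hx => hx.2))

theorem L2On_univ : L2On univ = ⊤ :=
  top_unique fun _ _ => mem_L2On.2 (Eventually.of_forall fun x hx => absurd (mem_univ x) hx)

theorem L2On_empty : L2On ∅ = ⊥ := by
  refine bot_unique fun y hy => ?_
  have : y = 0 := (Lp.eq_zero_iff_ae_eq_zero).2 ((mem_L2On.1 hy).mono fun x hx => hx (notMem_empty x))
  exact this

theorem L2On_inf : L2On E ⊓ L2On F = L2On (E ∩ F) := by
  refine le_antisymm (fun y hy => ?_) (le_inf (L2On_mono (Eventually.of_forall fun x hx => hx.1))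
    (L2On_mono (Eventually.of_forall fun x hx => hx.2)))
  rw [mem_L2On]
  filter_upwards [mem_L2On.1 hy.1, mem_L2On.1 hy.2] with x h1 h2 hx
  by_cases hE : x ∈ E
  · exact h2 fun hF => hx ⟨hE, hF⟩
  · exact h1 hE

/-- The restriction of a function to `E`. -/
def restrictTo (E : Set ℝ) (hE : MeasurableSet E) (y : L2Half) : L2Half :=
  ((Lp.memLp y).indicator hE).toLp _

theorem coeFn_restrictTo (hE : MeasurableSet E) (y : L2Half) :
    restrictTo E hE y =ᵐ[halfLine] E.indicator y :=
  MemLp.coeFn_toLp _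

theorem restrictTo_mem (hE : MeasurableSet E) (y : L2Half) : restrictTo E hE y ∈ L2On E := by
  rw [mem_L2On]
  filter_upwards [coeFn_restrictTo hE y] with x hx hxE
  rw [hx, indicator_of_notMem hxE]

theorem inner_eq_zero_of_mem {y z : L2Half} (hy : y ∈ L2On E) (hz : z ∈ L2On Eᶜ) :
    inner ℂ y z = 0 := by
  rw [L2.inner_def]
  refine integral_eq_zero_of_ae ?_
  filter_upwards [mem_L2On.1 hy, mem_L2On.1 hz] with x h1 h2
  by_cases hx : x ∈ E
  · rw [h2 (not_not.2 hx)]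
    simp
  · rw [h1 hx]
    simp

theorem orthogonal_L2On (hE : MeasurableSet E) : (L2On E).orthogonal = L2On Eᶜ := by
  refine le_antisymm (fun y hy => ?_) fun y hy =>
    (ClosedSubmodule.mem_orthogonal _ _).2 fun z hz => inner_eq_zero_of_mem hz hy
  have h1 := (ClosedSubmodule.mem_orthogonal _ _).1 hy _ (restrictTo_mem hE y)
  have h2 : inner ℂ (restrictTo E hE y) y = inner ℂ (restrictTo E hE y) (restrictTo E hE y) := by
    rw [L2.inner_def, L2.inner_def]
    refine integral_congr_ae ?_
    filter_upwards [coeFn_restrictTo hE y] with x hx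
    by_cases hxE : x ∈ E
    · simp only [hx, indicator_of_mem hxE]
    · simp only [hx, indicator_of_notMem hxE, inner_zero_left]
  rw [h2, inner_self_eq_zero] at h1
  have h3 := coeFn_restrictTo hE y
  rw [h1] at h3
  rw [mem_L2On]
  filter_upwards [h3, Lp.coeFn_zero ℂ 2 halfLine] with x h4 h5 hx
  rw [h5, indicator_of_mem (not_not.1 hx)] at h4
  exact h4.symm

theorem L2On_sup (hE : MeasurableSet E) : L2On E ⊔ L2On F = L2On (E ∪ F) := by
  refine le_antisymm (sup_le (L2On_mono (Eventually.of_forall fun x hx => Or.inl hx))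
    (L2On_mono (Eventually.of_forall fun x hx => Or.inr hx))) fun y hy => ?_
  have h1 : restrictTo E hE y ∈ L2On E ⊔ L2On F :=
    (le_sup_left : L2On E ≤ L2On E ⊔ L2On F) (restrictTo_mem hE y)
  have h2 : y - restrictTo E hE y ∈ L2On F := by
    rw [mem_L2On]
    filter_upwards [coeFn_restrictTo hE y, Lp.coeFn_sub y (restrictTo E hE y), mem_L2On.1 hy]
      with x h1 h2 h3 hx
    rw [h2, Pi.sub_apply, h1]
    by_cases hxE : x ∈ E
    · rw [indicator_of_mem hxE, sub_self]
    · rw [indicator_of_notMem hxE, h3 (fun h => h.elim hxE hx), sub_zero]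
  have h3 : y - restrictTo E hE y ∈ L2On E ⊔ L2On F :=
    (le_sup_right : L2On F ≤ L2On E ⊔ L2On F) h2
  have := (L2On E ⊔ L2On F).toSubmodule.add_mem h3 h1
  rwa [sub_add_cancel] at this

/-- The double orthogonal complement; this is how completeness of waves is reduced to unique
continuation. -/
theorem mem_of_forall_orthogonal {E : Type*} [NormedAddCommGroup E] [InnerProductSpace ℂ E]
    [CompleteSpace E] {K : ClosedSubmodule ℂ E} {x : E}
    (h : ∀ y, (∀ z ∈ K, inner ℂ z y = 0) → inner ℂ y x = 0) : x ∈ K := by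
  have : CompleteSpace K.toSubmodule := K.isClosed.completeSpace_coe
  rw [← ClosedSubmodule.mem_toSubmodule_iff, ← Submodule.orthogonal_orthogonal K.toSubmodule,
    Submodule.mem_orthogonal]
  exact fun y hy => h y ((Submodule.mem_orthogonal _ _).1 hy)

theorem integral_mem_closedSubmodule {X E : Type*} [MeasurableSpace X] {μ : Measure X}
    [NormedAddCommGroup E] [InnerProductSpace ℂ E] [CompleteSpace E] {K : ClosedSubmodule ℂ E}
    {f : X → E} (h : ∀ᵐ x ∂μ, f x ∈ K) : ∫ x, f x ∂μ ∈ K := by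
  by_cases hf : Integrable f μ
  · refine mem_of_forall_orthogonal fun y hy => ?_
    rw [← integral_inner hf]
    refine integral_eq_zero_of_ae ?_
    filter_upwards [h] with x hx
    rw [← inner_conj_symm, hy _ hx]
    simp
  · rw [integral_undef hf]
    exact K.toSubmodule.zero_mem

end L2On

/-! ### Unique continuation -/

section UniqueContinuation

/-- Real test functions on `(-T, T)`. -/
structure IsCutoff (T : ℝ) (φ : ℝ → ℝ) : Prop where
  contDiff : ContDiff ℝ ∞ φ
  hasCompactSupport : HasCompactSupport φ
  tsupport_subset : tsupport φ ⊆ Ioo (-T) T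

theorem IsCutoff.deriv {T : ℝ} {φ : ℝ → ℝ} (hφ : IsCutoff T φ) : IsCutoff T (deriv φ) :=
  ⟨((contDiff_succ_iff_deriv (n := ∞)).1 hφ.contDiff).2.2, hφ.hasCompactSupport.deriv,
    tsupport_deriv_subset.trans hφ.tsupport_subset⟩

theorem IsCutoff.contDiff_two {T : ℝ} {φ : ℝ → ℝ} (hφ : IsCutoff T φ) : ContDiff ℝ 2 φ :=
  mod_cast contDiff_infty.1 hφ.contDiff 2

theorem IsCutoff.translate {T δ : ℝ} {φ : ℝ → ℝ} (hφ : IsCutoff δ φ) {r : ℝ}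
    (hr : |r| + δ ≤ T) : IsCutoff T fun s => φ (s + r) := by
  have h : tsupport (fun s => φ (s + r)) = (Homeomorph.addRight r) ⁻¹' tsupport φ :=
    tsupport_comp_eq_preimage φ (Homeomorph.addRight r)
  refine ⟨hφ.contDiff.comp (contDiff_id.add contDiff_const),
    hφ.hasCompactSupport.comp_homeomorph (Homeomorph.addRight r), ?_⟩
  rw [h]
  intro s hs
  have := hφ.tsupport_subset hs
  simp only [Homeomorph.coe_addRight, mem_Ioo] at this ⊢
  have h1 := abs_le.1 (le_refl |r|)
  constructor <;> linarith [this.1, this.2, h1.1, h1.2]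

theorem mollify_eq_zero_time {E : Type*} [NormedAddCommGroup E] [InnerProductSpace ℂ E]
    (φ : ℝ → ℝ) (K : ℝ → E) (t : ℝ) : mollify φ K t = mollify (fun s => φ (s + t)) K 0 := by
  rw [mollify_apply, mollify_apply,
    ← integral_add_right_eq_self (fun s => φ s • K (t - s)) t]
  congr 1
  ext s
  congr 2
  ring

/-- The mean `∫ φ(s) S(-s) y ds` of the wave with the data `y`, to which `L²` is applied. -/
def meanWave (q : ℝ → ℝ) (y : L2Half) (φ : ℝ → ℝ) (t : ℝ) : L2Half :=
  mollify (deriv (deriv (deriv (deriv φ)))) (fun s => sineFamily (sturmLiouville q) s y) t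

theorem meanWave_translate (q : ℝ → ℝ) (y : L2Half) (φ : ℝ → ℝ) (t : ℝ) :
    meanWave q y φ t = meanWave q y (fun s => φ (s + t)) 0 := by
  have h : ∀ f : ℝ → ℝ, deriv (fun s => f (s + t)) = fun s => deriv f (s + t) := fun f =>
    funext fun s => deriv_comp_add_const _ _ _
  rw [meanWave, meanWave, mollify_eq_zero_time, h, h, h, h]

variable {q : ℝ → ℝ} (hq : ContinuousOn q (Ici 0)) (hA : IsPositiveDefinite (sturmLiouville q))
  (hd : Dense ((sturmLiouville q).domain : Set L2Half))

include hA hd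

theorem IsCutoff.boundedInverse_meanWave {T : ℝ} {φ : ℝ → ℝ} (hφ : IsCutoff T φ) (y : L2Half)
    (t : ℝ) : boundedInverse (friedrichs (sturmLiouville q)) (meanWave q y φ t) =
      -mollify (_root_.deriv (_root_.deriv φ)) (fun s => sineFamily (sturmLiouville q) s y) t :=
  boundedInverse_mollify_sineFamily hA hd hφ.deriv.deriv.contDiff_two
    hφ.deriv.deriv.hasCompactSupport y t

theorem IsCutoff.boundedInverse_boundedInverse_meanWave {T : ℝ} {φ : ℝ → ℝ} (hφ : IsCutoff T φ)
    (y : L2Half) (t : ℝ) : boundedInverse (friedrichs (sturmLiouville q))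
      (boundedInverse (friedrichs (sturmLiouville q)) (meanWave q y φ t)) =
      mollify φ (fun s => sineFamily (sturmLiouville q) s y) t := by
  rw [hφ.boundedInverse_meanWave hA hd, map_neg, boundedInverse_mollify_sineFamily hA hd
    hφ.contDiff_two hφ.hasCompactSupport, neg_neg]

/-- Time derivatives fall on the weight, and `B` removes two of them at the price of a sign; no
regularity of `y` is needed. -/
theorem IsCutoff.isWaveOrbit {T : ℝ} {φ : ℝ → ℝ} (hφ : IsCutoff T φ) (y : L2Half) :
    IsWaveOrbit q (meanWave q y φ) (meanWave q y (_root_.deriv φ))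
      (meanWave q y (_root_.deriv (_root_.deriv φ))) := by
  have hK : LocallyIntegrable fun s => sineFamily (sturmLiouville q) s y :=
    (continuous_sineFamily_apply hA hd y).locallyIntegrable
  have key : ∀ {φ : ℝ → ℝ}, IsCutoff T φ → ∀ t,
      HasDerivAt (meanWave q y φ) (meanWave q y (_root_.deriv φ) t) t := fun hφ t =>
    hasDerivAt_mollify (hφ.deriv.deriv.deriv.deriv.contDiff.of_le (by exact_mod_cast le_top))
      hφ.deriv.deriv.deriv.deriv.hasCompactSupport hK t
  refine ⟨key hφ, key hφ.deriv, fun t => ?_⟩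
  exact hφ.deriv.deriv.boundedInverse_meanWave hA hd y t

theorem inner_mollify {φ : ℝ → ℝ} (hφ : Continuous φ) (hc : HasCompactSupport φ) (n y : L2Half) :
    inner ℂ n (mollify φ (fun s => sineFamily (sturmLiouville q) s y) 0) =
      ∫ s, φ s • inner ℂ n (sineFamily (sturmLiouville q) (-s) y) := by
  refine (integral_inner (𝕜 := ℂ) (integrable_mollify hφ hc
    (continuous_sineFamily_apply hA hd y) 0) n).symm.trans (integral_congr_ae ?_)
  refine Eventually.of_forall fun s => ?_
  simp only [zero_sub]
  exact inner_smul_right_eq_smul _ _ _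

/-- A vector is determined by its mean waves. -/
theorem inner_eq_zero_of_mean {δ : ℝ} (hδ : 0 < δ) {n y : L2Half} (h : ∀ φ, IsCutoff δ φ →
      inner ℂ n (mollify φ (fun s => sineFamily (sturmLiouville q) s y) 0) = 0) :
    inner ℂ n y = 0 := by
  have hc : Continuous fun s => inner ℂ n (sineFamily (sturmLiouville q) (-s) y) :=
    continuous_const.inner ((continuous_sineFamily_apply hA hd y).comp continuous_neg)
  have h1 : ∀ᵐ s, s ∈ Ioo (-δ) δ → inner ℂ n (sineFamily (sturmLiouville q) (-s) y) = 0 := by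
    refine isOpen_Ioo.ae_eq_zero_of_integral_contDiff_smul_eq_zero
      (hc.locallyIntegrable.locallyIntegrableOn _) fun φ h1 h2 h3 => ?_
    rw [← inner_mollify hA hd h1.continuous h2]
    exact h φ ⟨h1, h2, h3⟩
  have h2 := Measure.eqOn_open_of_ae_eq ((ae_restrict_iff' measurableSet_Ioo).2 h1) isOpen_Ioo
    hc.continuousOn (continuousOn_const (c := (0 : ℂ)))
  refine inner_eq_zero_of_sineFamily hA hd hδ fun s hs => ?_
  have h3 := h2 (x := -s) ⟨by linarith [(abs_lt.1 hs).2], by linarith [(abs_lt.1 hs).1]⟩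
  simpa using h3

end UniqueContinuation

/-! ### Unique continuation from a point -/

section UniqueContinuation

variable {q : ℝ → ℝ} (hq : ContDiffOn ℝ ∞ q (Ici 0)) (hA : IsPositiveDefinite (sturmLiouville q))

include hq hA

/-- Unique continuation from the point `p`: a wave that vanishes at `p` together with its
`x`-derivative for the times in `(-T, T)` has data that vanish at the distance less than `T`. -/
theorem eq_zero_of_meanWave {y : L2Half} {p T : ℝ} (h : ∀ φ, IsCutoff T φ →
      oddEval q p (boundedInverse (friedrichs (sturmLiouville q)) (meanWave q y φ 0)) = 0 ∧
      oddDeriv q p (meanWave q y φ 0) = 0) :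
    ∀ᵐ x ∂halfLine, |x - p| < T → y x = 0 := by
  have hc := hq.continuousOn
  have hd := dense_domain hq
  -- `δ` is room for translation: a cutoff on `(-δ, δ)` shifted by at most `T - δ` is a cutoff on
  -- `(-T, T)`. Thus the hypothesis, stated at time `0` for all cutoffs, supplies lateral data at
  -- all times `r`.
  have key : ∀ δ, 0 < δ → ∀ φ, IsCutoff δ φ → ∀ᵐ x ∂halfLine, |x - p| ≤ T - δ →
      mollify φ (fun s => sineFamily (sturmLiouville q) s y) 0 x = 0 := by
    intro δ hδ φ hφ
    rw [← hφ.boundedInverse_boundedInverse_meanWave hA hd]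
    filter_upwards [ae_eq_solutionEval hc hA hd
      (boundedInverse (friedrichs (sturmLiouville q)) (meanWave q y φ 0)),
      ae_restrict_mem measurableSet_Ioi] with x hx hx0 hxp
    rw [hx, ← oddEval_of_nonneg hc (mem_Ioi.1 hx0).le]
    refine (hφ.isWaveOrbit hA hd y).eq_zero_of_lateral_data hc hA hd (fun r hr => ?_) x hxp
    have hr' : |r| + δ ≤ T := by linarith
    obtain ⟨h1, h2⟩ := h _ (hφ.translate hr')
    obtain ⟨h3, -⟩ := h _ (hφ.deriv.translate hr')
    rw [meanWave_translate, meanWave_translate q y (deriv φ)]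
    exact ⟨h1, h3, h2⟩
  have step : ∀ n : ℕ, ∀ᵐ x ∂halfLine,
      x ∈ Metric.ball p (T - 1 / ((n : ℝ) + 1)) ∩ Ioi 0 → y x = 0 := by
    intro n
    -- Pairing with a bump before the averaging is undone: if all averages near time `0` are
    -- orthogonal to `ψ`, then so is `y`.
    refine ae_eq_zero_of_inner_bump (Metric.isOpen_ball.inter isOpen_Ioi) inter_subset_right
      fun ψ hψ hψU => inner_eq_zero_of_mean hA hd
        (Nat.one_div_pos_of_nat (n := n)) fun φ hφ => ?_
    rw [inner_toL2 hψ.memLp]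
    refine integral_eq_zero_of_ae ?_
    filter_upwards [key _ Nat.one_div_pos_of_nat φ hφ] with x hx
    by_cases hxU : x ∈ tsupport ψ
    · have := (hψU hxU).1
      rw [Metric.mem_ball, Real.dist_eq] at this
      rw [hx this.le, smul_zero]
      rfl
    · rw [image_eq_zero_of_notMem_tsupport hxU, zero_smul]
      rfl
  filter_upwards [ae_all_iff.2 step, ae_restrict_mem measurableSet_Ioi] with x hx hx0 hxp
  obtain ⟨n, hn⟩ := exists_nat_one_div_lt (sub_pos.2 hxp)
  refine hx n ⟨?_, hx0⟩
  rw [Metric.mem_ball, Real.dist_eq]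
  linarith

end UniqueContinuation

end WaveSpectrum

end

noncomputable section

namespace WaveSpectrum

/-! ### The wave isotony on the subspaces `L₂(E)` -/

section Isotony

variable {q : ℝ → ℝ} (hq : ContDiffOn ℝ ∞ q (Ici 0)) (hA : IsPositiveDefinite (sturmLiouville q))

/-- The essential closure of a subset of the half-line. -/
def essentialClosure (E : Set ℝ) : Set ℝ := (volume.restrict (E ∩ Ioi 0)).support

theorem essentialClosure_subset (E : Set ℝ) : essentialClosure E ⊆ Ici 0 :=
  Measure.support_restrict_subset.trans
    (inter_subset_left.trans ((closure_mono inter_subset_right).trans (closure_Ioi 0).subset))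

theorem ae_mem_essentialClosure {E : Set ℝ} (hE : MeasurableSet E) :
    ∀ᵐ x ∂halfLine, x ∈ E → x ∈ essentialClosure E := by
  have h : ∀ᵐ x ∂(volume.restrict (E ∩ Ioi 0)), x ∈ essentialClosure E := Measure.support_mem_ae
  rw [ae_restrict_iff' (hE.inter measurableSet_Ioi)] at h
  rw [ae_restrict_iff' measurableSet_Ioi]
  filter_upwards [h] with x hx h1 h2 using hx ⟨h2, h1⟩

/-- A differentiable function that vanishes a.e. on `E` has, at the points of the essential closure
of `E`, the value and the derivative zero. -/
theorem eq_zero_of_mem_essentialClosure {E : Set ℝ} (hE : MeasurableSet E) {f : ℝ → ℂ} {f' : ℂ}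
    {p : ℝ} (hf : HasDerivAt f f' p) (h : ∀ᵐ x ∂halfLine, x ∈ E → f x = 0)
    (hp : p ∈ essentialClosure E) : f p = 0 ∧ f' = 0 := by
  have h0 : ∀ᵐ x ∂(volume.restrict (E ∩ Ioi 0)), f x = 0 ∧ x ≠ p := by
    rw [ae_restrict_iff' (hE.inter measurableSet_Ioi)]
    rw [ae_restrict_iff' measurableSet_Ioi] at h
    filter_upwards [h, Measure.ae_ne volume p] with x h1 h2 h3 using ⟨h1 h3.2 h3.1, h2⟩
  -- Every neighbourhood of `p` meets `E` in positive measure, so zeros of `f` other than `p`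
  -- accumulate at `p`; a nonzero value or derivative would exclude this.
  have hfreq : ∃ᶠ x in 𝓝[≠] p, f x = 0 := by
    rw [frequently_nhdsWithin_iff, frequently_iff]
    intro U hU
    have hpos := Measure.mem_support_iff_forall p |>.1 hp U hU
    by_contra hcon
    push Not at hcon
    refine hpos.ne' (measure_mono_null (fun x hx => ?_) (ae_iff.1 h0))
    rintro ⟨h1, h2⟩
    exact hcon x hx h1 h2
  constructor
  · by_contra hne
    have h1 : ∀ᶠ x in 𝓝[≠] p, f x ≠ 0 :=
      (hf.continuousAt.eventually_ne hne).filter_mono nhdsWithin_le_nhds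
    exact hfreq (h1.mono fun x hx h2 => hx h2)
  · by_contra hne
    exact hfreq ((hf.eventually_ne (c := 0) hne).mono fun x hx h2 => hx h2)

include hq hA

/-- Finite speed is applied off the closed `s`-neighbourhood, whose complement is open; `s < t`
places it inside the open `t`-neighbourhood. -/
theorem sineFamily_mem_L2On {E : Set ℝ} (hE : MeasurableSet E) {y : L2Half} (hy : y ∈ L2On E)
    {s t : ℝ} (hs : 0 ≤ s) (hst : s < t) :
    sineFamily (sturmLiouville q) s y ∈ L2On (Metric.thickening t (essentialClosure E)) := by
  have hy' : y ∈ L2On (essentialClosure E) := L2On_mono (ae_mem_essentialClosure hE) hy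
  have h := sineFamily_eq_zero_of_lt_dist hq hA hs hy'
    (U := Ioi 0 ∩ (Metric.cthickening s (essentialClosure E))ᶜ)
    (isOpen_Ioi.inter Metric.isClosed_cthickening.isOpen_compl) inter_subset_left
    fun u hu x hx _ => by
      by_contra hcon
      exact hu.2 (Metric.mem_cthickening_of_dist_le u x s _ hx (by
        rw [Real.dist_eq]; exact not_lt.1 hcon))
  rw [mem_L2On]
  filter_upwards [h, ae_restrict_mem measurableSet_Ioi] with x h1 hx h2
  exact h1 ⟨hx, fun h3 => h2 (Metric.cthickening_subset_thickening' (hs.trans_lt hst) hst _ h3)⟩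

theorem waveIsotony_L2On_le {E : Set ℝ} (hE : MeasurableSet E) {t : ℝ≥0} (ht : t ≠ 0) :
    waveIsotony (sturmLiouville q) t (L2On E) ≤
      L2On (Metric.thickening t (essentialClosure E)) := by
  rw [waveIsotony, if_neg ht, Submodule.closure_le, Submodule.span_le]
  rintro _ ⟨g, ⟨-, hg⟩, rfl⟩
  have ht' : (0 : ℝ) < t := NNReal.coe_pos.2 (pos_iff_ne_zero.2 ht)
  rw [duhamel, intervalIntegral.integral_of_le ht'.le]
  refine integral_mem_closedSubmodule ?_
  have hg' : ∀ᵐ s ∂(volume.restrict (Ioc (0 : ℝ) t)), g s ∈ L2On E :=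
    ae_restrict_of_ae_restrict_of_subset Ioc_subset_Ioi_self hg
  filter_upwards [hg', ae_restrict_mem measurableSet_Ioc] with s h1 h2
  exact sineFamily_mem_L2On hq hA hE h1 (by linarith [h2.2]) (by linarith [h2.1])

/-- The source `conj (c s) • k`, with `c s` the pairing of `y` with `S(t - s) k`, turns
orthogonality into `∫ |c|² = 0`; continuity gives `c = 0` throughout. Negative times follow since
`S` is odd. -/
theorem inner_sineFamily_eq_zero {G : ClosedSubmodule ℂ L2Half} {t : ℝ≥0} (ht : t ≠ 0) {y : L2Half}
    (hy : ∀ z ∈ waveIsotony (sturmLiouville q) t G, inner ℂ z y = 0) {k : L2Half} (hk : k ∈ G)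
    {s : ℝ} (hs : |s| < t) : inner ℂ y (sineFamily (sturmLiouville q) s k) = 0 := by
  have hd := dense_domain hq
  have ht' : (0 : ℝ) < t := NNReal.coe_pos.2 (pos_iff_ne_zero.2 ht)
  set c : ℝ → ℂ := fun s => inner ℂ y (sineFamily (sturmLiouville q) (t - s) k) with hc
  have hcc : Continuous c := continuous_const.inner
    ((continuous_sineFamily_apply hA hd k).comp (continuous_const.sub continuous_id))
  set g : ℝ → L2Half := fun s => starRingEnd ℂ (c s) • k with hg
  have hgc : Continuous g := (Complex.continuous_conj.comp hcc).smul continuous_const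
  have hsrc : IsSource G g := by
    refine ⟨fun T => ?_, Eventually.of_forall fun s => G.toSubmodule.smul_mem _ hk⟩
    obtain ⟨C, hC⟩ := (isCompact_Icc (a := (0 : ℝ)) (b := T)).exists_bound_of_continuousOn
      hgc.continuousOn
    refine MemLp.of_bound hgc.aestronglyMeasurable C ?_
    filter_upwards [ae_restrict_mem measurableSet_Ioc] with s hs using hC s (Ioc_subset_Icc_self hs)
  have hmem : duhamel (sturmLiouville q) g t ∈ waveIsotony (sturmLiouville q) t G := by
    rw [waveIsotony, if_neg ht, Submodule.mem_closure_iff]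
    exact Submodule.le_topologicalClosure _ (Submodule.subset_span ⟨g, hsrc, rfl⟩)
  have hint : IntervalIntegrable (fun s => sineFamily (sturmLiouville q) (t - s) (g s)) volume
      0 t := (((continuous_sineFamily hA hd).comp (continuous_const.sub continuous_id)).clm_apply
        hgc).intervalIntegrable _ _
  have h0 : inner ℂ y (duhamel (sturmLiouville q) g t) = 0 := by
    rw [← inner_conj_symm, hy _ hmem, map_zero]
  have h1 : ∫ s in (0 : ℝ)..t, ‖c s‖ ^ 2 = 0 := by
    have h2 : inner ℂ y (duhamel (sturmLiouville q) g t) =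
        ∫ s in (0 : ℝ)..t, ((‖c s‖ ^ 2 : ℝ) : ℂ) := by
      rw [duhamel, intervalIntegral.integral_of_le ht'.le, intervalIntegral.integral_of_le ht'.le]
      refine (integral_inner (𝕜 := ℂ) hint.1 y).symm.trans
        (integral_congr_ae (Eventually.of_forall fun s => ?_))
      simp only [hg, map_smul, inner_smul_right]
      rw [Complex.ofReal_pow, ← Complex.conj_mul']
    rw [h0, intervalIntegral.integral_ofReal] at h2
    exact_mod_cast h2.symm
  have h2 : ∀ s ∈ Icc (0 : ℝ) t, c s = 0 := by
    by_contra hcon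
    push Not at hcon
    obtain ⟨s, hs, hs'⟩ := hcon
    refine (intervalIntegral.integral_pos ht' (hcc.norm.pow 2).continuousOn
      (fun s _ => sq_nonneg _) ⟨s, hs, pow_pos (norm_pos_iff.2 hs') 2⟩).ne' h1
  obtain ⟨h3, h4⟩ := abs_lt.1 hs
  rcases le_total 0 s with h | h
  · have := h2 (t - s) ⟨by linarith, by linarith⟩
    simpa [hc] using this
  · have := h2 (t + s) ⟨by linarith, by linarith⟩
    simpa [hc, sineFamily_neg] using this

/-- Duality: for `y` orthogonal to the right side the averaged waves vanish on `E`, hence to first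
order at each point of the essential closure, and unique continuation from there removes `y` from
the whole neighbourhood. -/
theorem le_waveIsotony_L2On {E : Set ℝ} (hE : MeasurableSet E) {t : ℝ≥0} (ht : t ≠ 0) :
    L2On (Metric.thickening t (essentialClosure E)) ≤
      waveIsotony (sturmLiouville q) t (L2On E) := by
  have hd := dense_domain hq
  have hc := hq.continuousOn
  intro z hz
  refine mem_of_forall_orthogonal fun y hy => ?_
  have hv : ∀ φ, IsCutoff t φ → ∀ᵐ x ∂halfLine, x ∈ E →
      mollify φ (fun s => sineFamily (sturmLiouville q) s y) 0 x = 0 := by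
    intro φ hφ
    have h1 : mollify φ (fun s => sineFamily (sturmLiouville q) s y) 0 ∈ (L2On E).orthogonal := by
      refine (ClosedSubmodule.mem_orthogonal _ _).2 fun k hk => ?_
      rw [inner_mollify hA hd hφ.contDiff.continuous hφ.hasCompactSupport]
      refine integral_eq_zero_of_ae (Eventually.of_forall fun s => ?_)
      by_cases hs : s ∈ tsupport φ
      · have h2 := hφ.tsupport_subset hs
        have h3 := inner_sineFamily_eq_zero hq hA ht hy hk (s := -s)
          (by rw [abs_neg]; exact abs_lt.2 ⟨h2.1, h2.2⟩)
        change φ s • inner ℂ k (sineFamily (sturmLiouville q) (-s) y) = 0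
        rw [← inner_conj_symm, inner_sineFamily, h3, map_zero, smul_zero]
      · change φ s • inner ℂ k (sineFamily (sturmLiouville q) (-s) y) = 0
        rw [image_eq_zero_of_notMem_tsupport hs, zero_smul]
    rw [orthogonal_L2On hE, mem_L2On] at h1
    filter_upwards [h1] with x hx hxE using hx (not_not.2 hxE)
  have hzero : ∀ p ∈ essentialClosure E, ∀ᵐ x ∂halfLine, |x - p| < t → y x = 0 := by
    intro p hp
    refine eq_zero_of_meanWave hq hA fun φ hφ => ?_
    refine eq_zero_of_mem_essentialClosure hE (f := fun x => oddEval q x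
      (boundedInverse (friedrichs (sturmLiouville q)) (meanWave q y φ 0))) ?_ ?_ hp
    · refine (hasDerivAt_clm_apply (hasDerivAt_oddEval hc hA hd p)
        (hasDerivAt_const p (meanWave q y φ 0))).congr_deriv ?_
      simp
    · have h1 := hv φ hφ
      rw [← hφ.boundedInverse_boundedInverse_meanWave hA hd] at h1
      filter_upwards [h1, ae_eq_solutionEval hc hA hd
        (boundedInverse (friedrichs (sturmLiouville q)) (meanWave q y φ 0)),
        ae_restrict_mem measurableSet_Ioi] with x h2 h3 h4 h5
      rw [oddEval_of_nonneg hc (mem_Ioi.1 h4).le, ← h3, h2 h5]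
  have hy0 : y ∈ L2On (Metric.thickening t (essentialClosure E))ᶜ := by
    rw [mem_L2On, ae_iff]
    refine measure_null_of_locally_null _ fun x hx => ?_
    simp only [not_not, mem_compl_iff, Classical.not_imp, mem_ofPred_eq] at hx
    obtain ⟨p, hp, hxp⟩ := Metric.mem_thickening_iff.1 hx.1
    refine ⟨{x | ¬(|x - p| < t → y x = 0)}, ?_, ae_iff.1 (hzero p hp)⟩
    filter_upwards [self_mem_nhdsWithin,
      mem_nhdsWithin_of_mem_nhds (Metric.isOpen_ball.mem_nhds (Metric.mem_ball.2 hxp))]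
      with w h1 h2
    simp only [not_not, mem_compl_iff, Classical.not_imp] at h1 ⊢
    exact ⟨by rwa [Metric.mem_ball, Real.dist_eq] at h2, h1.2⟩
  rw [← inner_conj_symm, inner_eq_zero_of_mem hz hy0, map_zero]

/-- The action of the wave isotony on the subspaces `L₂(E)`. -/
theorem waveIsotony_L2On {E : Set ℝ} (hE : MeasurableSet E) {t : ℝ≥0} (ht : t ≠ 0) :
    waveIsotony (sturmLiouville q) t (L2On E) =
      L2On (Metric.thickening t (essentialClosure E)) :=
  le_antisymm (waveIsotony_L2On_le hq hA hE ht) (le_waveIsotony_L2On hq hA hE ht)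

end Isotony

end WaveSpectrum

end

noncomputable section

namespace WaveSpectrum

/-! ### Waves generated by boundary controls -/

section BoundaryControl

/-- A control profile odd about the final time `T`. Its support lies in `(0, 2T)`, so it vanishes
near `t = 0`, and it is zero at `T` itself. -/
theorem IsCutoff.isBump_odd {T : ℝ} {φ : ℝ → ℝ} (hφ : IsCutoff T φ) :
    IsBump fun s => φ (T - s) - φ (-(T - s)) := by
  set K : Set ℝ := (fun s => T - s) ⁻¹' tsupport φ ∪ (fun s => -(T - s)) ⁻¹' tsupport φ with hK
  have hKc : IsClosed K := ((isClosed_tsupport φ).preimage (by fun_prop)).union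
    ((isClosed_tsupport φ).preimage (by fun_prop))
  have hKs : K ⊆ Ioo 0 (2 * T) := by
    rintro s (h | h)
    · have := hφ.tsupport_subset h
      constructor <;> linarith [this.1, this.2]
    · have := hφ.tsupport_subset h
      constructor <;> linarith [this.1, this.2]
  have hsupp : tsupport (fun s => φ (T - s) - φ (-(T - s))) ⊆ K := by
    refine closure_minimal (fun s hs => ?_) hKc
    by_contra hsK
    rw [hK, mem_union, not_or] at hsK
    refine hs ?_
    simp only [image_eq_zero_of_notMem_tsupport hsK.1, image_eq_zero_of_notMem_tsupport hsK.2,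
      sub_zero]
  refine ⟨(hφ.contDiff.comp (contDiff_const.sub contDiff_id)).sub
    (hφ.contDiff.comp (contDiff_const.sub contDiff_id).neg), ?_,
    fun s hs => (hKs (hsupp hs)).1⟩
  exact (isCompact_Icc (a := (0 : ℝ)) (b := 2 * T)).of_isClosed_subset (isClosed_tsupport _)
    (hsupp.trans (hKs.trans Ioo_subset_Icc_self))

theorem IsCutoff.deriv_deriv_odd {T : ℝ} {φ : ℝ → ℝ} (hφ : IsCutoff T φ) :
    _root_.deriv (_root_.deriv fun s => φ (T - s) - φ (-(T - s))) =
      fun s => _root_.deriv (_root_.deriv φ) (T - s) -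
        _root_.deriv (_root_.deriv φ) (-(T - s)) := by
  have hφd : ∀ {f : ℝ → ℝ}, IsCutoff T f → ∀ s, HasDerivAt f (_root_.deriv f s) s := fun hf s =>
    (hf.contDiff.differentiable (by simp) s).hasDerivAt
  have hneg : ∀ {f f' : ℝ → ℝ}, (∀ s, HasDerivAt f (f' s) s) → ∀ s,
      HasDerivAt (fun s => f (T - s)) (-f' (T - s)) s ∧
      HasDerivAt (fun s => f (-(T - s))) (f' (-(T - s))) s := fun hf s =>
    ⟨(hf (T - s)).comp_const_sub T s, by
      have := hasDerivAt_comp_affine hf (-T) 1 s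
      simpa [sub_eq_add_neg, add_comm] using this⟩
  have hc1 : _root_.deriv (fun s => φ (T - s) - φ (-(T - s))) =
      fun s => -_root_.deriv φ (T - s) - _root_.deriv φ (-(T - s)) := funext fun s =>
    ((hneg (hφd hφ) s).1.sub (hneg (hφd hφ) s).2).deriv
  rw [hc1]
  funext s
  have := ((hneg (hφd hφ.deriv) s).1.neg.sub (hneg (hφd hφ.deriv) s).2).deriv
  rw [neg_neg] at this
  exact this

variable {E : Type*} [NormedAddCommGroup E] [InnerProductSpace ℂ E] [CompleteSpace E]
  {A : E →ₗ.[ℂ] E} (hA : IsPositiveDefinite A) (hd : Dense (A.domain : Set E))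

/-- The sine family applied to `k`, cut off at the negative times. -/
def causalSine (A : E →ₗ.[ℂ] E) (k : E) (s : ℝ) : E := sineFamily A (max s 0) k

include hA hd

theorem continuous_causalSine (k : E) : Continuous (causalSine A k) :=
  (continuous_sineFamily_apply hA hd k).comp (continuous_id.max continuous_const)

omit hA hd in
theorem mollify_causalSine {c : ℝ → ℝ} (hc : ∀ s, s ≤ 0 → c s = 0) (k : E) {t : ℝ} (ht : 0 ≤ t) :
    mollify c (causalSine A k) t = ∫ s in (0 : ℝ)..t, c (t - s) • sineFamily A s k := by
  rw [mollify_apply', intervalIntegral.integral_of_le ht,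
    ← setIntegral_eq_integral_of_forall_compl_eq_zero (s := Ioc 0 t)]
  · refine setIntegral_congr_fun measurableSet_Ioc fun s hs => ?_
    simp only [causalSine, max_eq_left hs.1.le]
  · intro s hs
    rw [mem_Ioc, not_and_or, not_lt, not_le] at hs
    rcases hs with h | h
    · rw [causalSine, max_eq_right h, sineFamily_zero, _root_.zero_apply, smul_zero]
    · rw [hc _ (by linarith), zero_smul]

/-- The equation `w'' + L w = h''` for the wave `w` with the source `h'' = c'' k`. -/
theorem boundedInverse_mollify_causalSine {c : ℝ → ℝ} (hc : IsBump c) (k : E) {t : ℝ}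
    (ht : 0 ≤ t) : boundedInverse (friedrichs A) (mollify (deriv (deriv c)) (causalSine A k) t) =
      c t • boundedInverse (friedrichs A) k - mollify c (causalSine A k) t := by
  have hi : ∀ {c : ℝ → ℝ}, IsBump c → ∀ k : E,
      IntervalIntegrable (fun s => c (t - s) • sineFamily A s k) volume 0 t := fun hc k =>
    ((hc.contDiff.continuous.comp (continuous_const.sub continuous_id)).smul
      (continuous_sineFamily_apply hA hd k)).intervalIntegrable _ _
  rw [mollify_causalSine (fun s hs => hc.deriv.deriv.eq_zero hs) k ht,
    mollify_causalSine (fun s hs => hc.eq_zero hs) k ht,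
    ← ContinuousLinearMap.intervalIntegral_comp_comm _ (hi hc.deriv.deriv k), eq_sub_iff_add_eq]
  set B := boundedInverse (friedrichs A) with hB
  have h1 : ∀ s, B (deriv (deriv c) (t - s) • sineFamily A s k) =
      deriv (deriv c) (t - s) • sineFamily A s (B k) := fun s => by
    rw [B.map_smul_of_tower, hB, boundedInverse_sineFamily hA hd]
  simp only [h1]
  rw [← intervalIntegral.integral_add (hi hc.deriv.deriv (B k)) (hi hc k)]
  have hder : ∀ {c : ℝ → ℝ}, IsBump c → ∀ s,
      HasDerivAt (fun s => c (t - s)) (-deriv c (t - s)) s := fun {c} hc s =>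
    HasDerivAt.comp_const_sub t s ((hc.contDiff.differentiable (by simp)) (t - s)).hasDerivAt
  have key : ∀ s, HasDerivAt
      (fun s => -(deriv c (t - s) • sineFamily A s (B k)) - c (t - s) • cosineFamily A s k)
      (deriv (deriv c) (t - s) • sineFamily A s (B k) + c (t - s) • sineFamily A s k) s := by
    intro s
    have h2 := ((hder hc.deriv s).smul (hasDerivAt_sineFamily hA hd s k)).neg.sub
      ((hder hc s).smul (hasDerivAt_cosineFamily hA hd s k))
    refine h2.congr_deriv ?_
    simp only [neg_smul, smul_neg]
    abel
  rw [intervalIntegral.integral_eq_sub_of_hasDerivAt (fun s _ => key s)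
    ((hi hc.deriv.deriv (B k)).add (hi hc k))]
  simp only [sub_self, sub_zero, hc.eq_zero le_rfl, hc.deriv.eq_zero le_rfl, sineFamily_zero,
    cosineFamily_zero hA hd, _root_.zero_apply, zero_smul, smul_zero, neg_zero]
  simp [hB]

theorem hasDerivAt_mollify_causalSine {c : ℝ → ℝ} (hc : IsBump c) (k : E) (t : ℝ) :
    HasDerivAt (mollify c (causalSine A k)) (mollify (deriv c) (causalSine A k) t) t :=
  hasDerivAt_mollify (hc.contDiff.of_le (by exact_mod_cast le_top)) hc.hasCompactSupport
    (continuous_causalSine hA hd k).locallyIntegrable t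

/-- The states of the waves generated by the boundary controls `c k` with `k ∈ Ker A*`. -/
theorem mollify_causalSine_mem_reachableSet {c : ℝ → ℝ} (hc : IsBump c) {k : A.adjoint.domain}
    (hk : A.adjoint k = 0) (T : ℝ) :
    -(c T • (k : E)) + mollify (deriv (deriv c)) (causalSine A k) T ∈ reachableSet A T := by
  set u : ℝ → E := fun t => -(c t • (k : E)) + mollify (deriv (deriv c)) (causalSine A k) t with hu
  have hderiv : ∀ {c : ℝ → ℝ}, IsBump c → ∀ t, HasDerivAt
      (fun t => -(c t • (k : E)) + mollify (deriv (deriv c)) (causalSine A k) t)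
      (-(deriv c t • (k : E)) + mollify (deriv (deriv (deriv c))) (causalSine A k) t) t :=
    fun {c} hc t => ((((hc.contDiff.differentiable (by simp)) t).hasDerivAt.smul_const _).neg).add
      (hasDerivAt_mollify_causalSine hA hd hc.deriv.deriv k t)
  have hu1 : deriv u = fun t => -(deriv c t • (k : E)) +
      mollify (deriv (deriv (deriv c))) (causalSine A k) t := funext fun t => (hderiv hc t).deriv
  have hu2 : deriv (deriv u) = fun t => -(deriv (deriv c) t • (k : E)) +
      mollify (deriv (deriv (deriv (deriv c)))) (causalSine A k) t := by
    rw [hu1]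
    exact funext fun t => (hderiv hc.deriv t).deriv
  have hsmooth : ContDiff ℝ ∞ u :=
    (hc.contDiff.smul contDiff_const).neg.add (hc.deriv.deriv.hasCompactSupport.contDiff_convolution_left
      _ hc.deriv.deriv.contDiff (continuous_causalSine hA hd (k : E)).locallyIntegrable)
  have hmz : ∀ {c : ℝ → ℝ}, IsBump c → mollify c (causalSine A (k : E)) 0 = 0 := fun hc => by
    rw [mollify_causalSine (fun s hs => hc.eq_zero hs) _ le_rfl, intervalIntegral.integral_same]
  refine ⟨fun t => c t • (k : E), u, ⟨(hc.contDiff.smul contDiff_const).contDiffOn, fun t _ => ?_, ?_⟩,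
    ⟨hsmooth.contDiffOn, ?_, ?_, fun t ht => ?_⟩, rfl⟩
  · refine ⟨(c t : ℂ) • k, by simp, ?_⟩
    rw [LinearPMap.map_smul, hk, smul_zero]
  · have h0 : ∀ᶠ t in 𝓝 (0 : ℝ), c t = 0 :=
      notMem_tsupport_iff_eventuallyEq.1 fun h => lt_irrefl (0 : ℝ) (hc.tsupport_subset h)
    obtain ⟨ε, hε, h⟩ := Metric.eventually_nhds_iff_ball.1 h0
    refine ⟨ε / 2, half_pos hε, fun t ht => ?_⟩
    change c t • (k : E) = 0
    rw [h t (by rw [Metric.mem_ball, Real.dist_0_eq_abs, abs_of_nonneg ht.1]; linarith [ht.2]),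
      zero_smul]
  · simp only [hu, hc.eq_zero le_rfl, zero_smul, neg_zero, zero_add]
    exact hmz hc.deriv.deriv
  · rw [((hderiv hc 0).hasDerivWithinAt).derivWithin (uniqueDiffOn_Ici 0 0 self_mem_Ici),
      hc.deriv.eq_zero le_rfl, hmz hc.deriv.deriv.deriv, zero_smul, neg_zero, add_zero]
  -- With `h = c k` and `w` the wave with the source `h''`, `u = -h + w` and `f = h'' - w'' = L w`.
  -- As `h ∈ Ker A*`, this gives `A* u = f = -u''` and `Γ₁ u = B f - u = h`.
  · set f := deriv (deriv c) t • (k : E) -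
      mollify (deriv (deriv (deriv (deriv c)))) (causalSine A k) t with hf
    have hBf : boundedInverse (friedrichs A) f =
        mollify (deriv (deriv c)) (causalSine A (k : E)) t := by
      rw [hf, map_sub, ContinuousLinearMap.map_smul_of_tower,
        boundedInverse_mollify_causalSine hA hd hc.deriv.deriv _ ht, sub_sub_cancel]
    set y : A.adjoint.domain := -((c t : ℂ) • k) +
      ⟨boundedInverse (friedrichs A) f, hA.boundedInverse_mem_adjoint hd f⟩ with hy
    have hyu : (y : E) = u t := by
      simp only [hy, hu, Submodule.coe_add, Submodule.coe_neg, hBf, Complex.coe_smul]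
      rfl
    have hAy : A.adjoint y = f := by
      rw [hy, LinearPMap.map_add, LinearPMap.map_neg, LinearPMap.map_smul, hk, smul_zero, neg_zero,
        zero_add, hA.adjoint_boundedInverse hd]
    refine ⟨y, hyu, ?_, fun ht0 => ?_⟩
    · rw [boundaryMap, hAy, hyu, hBf, hu]
      simp
    · have h2 : iteratedDerivWithin 2 u (Ici 0) t = deriv (deriv u) t := by
        rw [iteratedDerivWithin_eq_iteratedDeriv (uniqueDiffOn_Ici 0)
          (contDiff_infty.1 hsmooth 2).contDiffAt ht, iteratedDeriv_succ,
          iteratedDeriv_one]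
      rw [h2, hAy, hu2, hf]
      simp only
      rw [neg_add_eq_sub, sub_add_sub_cancel, sub_self]

/-- The boundary controls with odd profiles excite complete sine waves. -/
theorem integral_odd_smul_causalSine {φ : ℝ → ℝ} (hφ : Continuous φ) (hc : HasCompactSupport φ)
    (k : E) : ∫ s, (φ s - φ (-s)) • causalSine A k s = ∫ s, φ s • sineFamily A s k := by
  have hK := continuous_causalSine hA hd k
  have hc' : HasCompactSupport fun s => φ (-s) := hc.comp_homeomorph (Homeomorph.neg ℝ)
  have h1 : Integrable fun s => φ s • causalSine A k s :=
    (hφ.smul hK).integrable_of_hasCompactSupport hc.smul_right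
  have h2 : Integrable fun s => φ (-s) • causalSine A k s :=
    ((hφ.comp continuous_neg).smul hK).integrable_of_hasCompactSupport hc'.smul_right
  have h3 : Integrable fun s => φ s • causalSine A k (-s) :=
    (hφ.smul (hK.comp continuous_neg)).integrable_of_hasCompactSupport hc.smul_right
  have h4 : ∫ s, φ (-s) • causalSine A k s = ∫ s, φ s • causalSine A k (-s) := by
    rw [← integral_neg_eq_self]
    simp only [neg_neg]
  simp only [sub_smul]
  rw [integral_sub h1 h2, h4, ← integral_sub h1 h3]
  congr 1
  ext s
  rw [← smul_sub]
  congr 1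
  rcases le_total 0 s with h | h
  · rw [causalSine, causalSine, max_eq_left h, max_eq_right (by linarith), sineFamily_zero,
      _root_.zero_apply, sub_zero]
  · rw [causalSine, causalSine, max_eq_right h, max_eq_left (by linarith), sineFamily_zero,
      _root_.zero_apply, zero_sub, sineFamily_neg, _root_.neg_apply, neg_neg]

/-- For a profile odd about `T` the term `-c(T) k` disappears, and the causal integral unfolds, `S`
being odd, into an average of `S` over all of `(-T, T)`. -/
theorem IsCutoff.neg_mollify_mem_reachableSet {T : ℝ} {φ : ℝ → ℝ} (hφ : IsCutoff T φ)
    {k : A.adjoint.domain} (hk : A.adjoint k = 0) :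
    -mollify (_root_.deriv (_root_.deriv φ)) (fun s => sineFamily A s k) 0 ∈ reachableSet A T := by
  have hw := mollify_causalSine_mem_reachableSet hA hd hφ.isBump_odd hk T
  have hcut := hφ.deriv.deriv
  rw [hφ.deriv_deriv_odd, mollify_apply'] at hw
  simp only [sub_self, sub_sub_cancel, neg_zero, zero_smul, zero_add] at hw
  rw [integral_odd_smul_causalSine hA hd hcut.contDiff.continuous hcut.hasCompactSupport] at hw
  rw [mollify_apply]
  simp only [zero_sub, sineFamily_neg, _root_.neg_apply, smul_neg]
  rwa [integral_neg, neg_neg]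

omit hA in
/-- A continuous functional that vanishes on `Ran A` vanishes on the orthogonal complement
of `Ker A*`. -/
theorem eq_zero_of_orthogonal_ker_adjoint {ℓ : E →L[ℂ] ℂ} (hℓ : ∀ z : A.domain, ℓ (A z) = 0) {n : E}
    (hn : ∀ k : A.adjoint.domain, A.adjoint k = 0 → inner ℂ (k : E) n = 0) : ℓ n = 0 := by
  -- The closure of `Ran A` is the orthogonal complement of `Ker A*`.
  have h : n ∈ (LinearMap.range A.toFun).closure := by
    refine mem_of_forall_orthogonal fun z hz => ?_
    have hz' : ∀ x : A.domain, inner ℂ (0 : E) (x : E) = inner ℂ z (A x) := fun x => by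
      have h := hz (A x) (Submodule.le_topologicalClosure _ ⟨x, rfl⟩)
      rw [← inner_conj_symm z, h, map_zero, inner_zero_left]
    have hzm : z ∈ A.adjoint.domain := LinearPMap.mem_adjoint_domain_of_exists z ⟨0, hz'⟩
    exact hn ⟨z, hzm⟩ (LinearPMap.adjoint_apply_eq hd ⟨z, hzm⟩ hz')
  have hle : (LinearMap.range A.toFun).topologicalClosure ≤ LinearMap.ker ℓ.toLinearMap := by
    refine Submodule.topologicalClosure_minimal _ ?_ ℓ.isClosed_ker
    rintro _ ⟨x, rfl⟩
    exact hℓ x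
  exact hle h

end BoundaryControl

end WaveSpectrum

end

noncomputable section

namespace WaveSpectrum

/-! ### The reachable subspaces -/

section Reachable

variable {q : ℝ → ℝ} (hq : ContDiffOn ℝ ∞ q (Ici 0)) (hA : IsPositiveDefinite (sturmLiouville q))

include hq hA

theorem sineFamily_bump_eq_zero_of_lt {φ : ℝ → ℝ} (hφ : IsBump φ) {a s : ℝ} (hs : 0 ≤ s)
    (ha : ∀ r, r < a + s → φ r = 0) :
    ∀ᵐ x ∂halfLine, x < a → sineFamily (sturmLiouville q) s (toL2 φ) x = 0 := by
  filter_upwards [sineFamily_bump_eq_zero hq hA hφ hs, ae_restrict_mem measurableSet_Ioi]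
    with x h1 hx hxa
  refine h1 fun r hr => ha _ ?_
  have := abs_abs_sub_abs_le_abs_sub r x
  rw [abs_of_pos (mem_Ioi.1 hx)] at this
  linarith [(abs_le.1 (this.trans hr)).2]

/-- As long as the wave does not reach the boundary, it stays in the domain of the minimal
operator. -/
theorem exists_domain_sineFamily {φ : ℝ → ℝ} (hφ : IsBump φ) {a s : ℝ} (ha0 : 0 < a) (hs : 0 ≤ s)
    (ha : ∀ r, r < a + s → φ r = 0) : ∃ ζ : (sturmLiouville q).domain,
      (ζ : L2Half) = sineFamily (sturmLiouville q) s (toL2 φ) ∧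
      sturmLiouville q ζ = sineFamily (sturmLiouville q) s (toL2 (diffExpr q φ)) := by
  have hd := dense_domain hq
  have hc := hq.continuousOn
  have hB : boundedInverse (friedrichs (sturmLiouville q))
      (sineFamily (sturmLiouville q) s (toL2 (diffExpr q φ))) =
      sineFamily (sturmLiouville q) s (toL2 φ) := by
    rw [boundedInverse_sineFamily hA hd, boundedInverse_diffExpr hq hA hφ]
  set f := sineFamily (sturmLiouville q) s (toL2 (diffExpr q φ)) with hf
  -- The wave is zero near the boundary, so its slope at `0` vanishes, and the slope is all that
  -- separates it from the minimal domain.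
  suffices h : initialSlope q f = 0 by
    obtain ⟨ζ, h1, h2⟩ := exists_domain_of_initialSlope hc hA hd h
    exact ⟨ζ, h1.trans hB, h2⟩
  have h1 : ∀ᵐ x ∂halfLine, x ∈ Iio a → solutionEval q x f = 0 := by
    filter_upwards [sineFamily_bump_eq_zero_of_lt hq hA hφ hs ha, ae_eq_solutionEval hc hA hd f]
      with x h2 h3 hx
    rw [← h3, hB, h2 hx]
  have hder := hasDerivAt_solutionEval_apply hc f 0
  rw [Ioc_self, setIntegral_empty, add_zero] at hder
  have h2 : ∀ᵐ x ∂(volume.restrict (Ioo 0 a)), solutionEval q x f = 0 := by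
    rw [ae_restrict_iff' measurableSet_Ioi] at h1
    rw [ae_restrict_iff' measurableSet_Ioo]
    filter_upwards [h1] with x hx hxa using hx hxa.1 hxa.2
  have h3 := Measure.eqOn_open_of_ae_eq h2 isOpen_Ioo
    ((continuous_solutionEval hc).clm_apply continuous_const).continuousOn continuousOn_const
  by_contra hne
  have h4 : ∀ᶠ x in 𝓝[>] (0 : ℝ), solutionEval q x f ≠ 0 :=
    (hder.eventually_ne (c := 0) hne).filter_mono
      (nhdsWithin_mono _ fun x hx => (mem_Ioi.1 hx).ne')
  obtain ⟨x, hx, hx'⟩ := (h4.and (Ioo_mem_nhdsGT ha0)).exists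
  exact hx (h3 hx')

/-- The waves generated by boundary controls have unit speed of propagation. -/
theorem reachableSet_subset {T : ℝ} (hT : 0 ≤ T) :
    reachableSet (sturmLiouville q) T ⊆ L2On (Ioo 0 T) := by
  have hd := dense_domain hq
  rintro _ ⟨h, u, -, hu, rfl⟩
  have key : ∀ᵐ x ∂halfLine, x ∈ Ioi T → u T x = 0 := by
    refine ae_eq_zero_of_inner_bump isOpen_Ioi (Ioi_subset_Ioi hT) fun φ hφ hφT => ?_
    -- The gap between `T` and the support of `φ`: the wave run backwards from `φ` over a time at
    -- most `T` never reaches the boundary.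
    obtain ⟨a, ha0, ha⟩ : ∃ a, 0 < a ∧ ∀ r, r < a + T → φ r = 0 := by
      rcases (tsupport φ).eq_empty_or_nonempty with h0 | h0
      · exact ⟨1, one_pos, fun r _ => image_eq_zero_of_notMem_tsupport (by simp [h0])⟩
      · obtain ⟨m, hm, hmin⟩ := hφ.hasCompactSupport.isCompact.exists_isMinOn h0 continuousOn_id
        refine ⟨m - T, sub_pos.2 (hφT hm), fun r hr => image_eq_zero_of_notMem_tsupport fun hrt => ?_⟩
        have : m ≤ r := hmin hrt
        linarith
    set f := toL2 φ
    set Af := toL2 (diffExpr q φ) with hAf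
    have hBAf : boundedInverse (friedrichs (sturmLiouville q)) Af = f :=
      boundedInverse_diffExpr hq hA hφ
    set z : ℝ → L2Half := fun t => sineFamily (sturmLiouville q) (T - t) f with hz
    set z' : ℝ → L2Half := fun t => -cosineFamily (sturmLiouville q) (T - t) Af with hz'
    have hzd : ∀ t, HasDerivAt z (z' t) t := fun t => by
      have := (hasDerivAt_sineFamily hA hd (T - t) Af).comp_const_sub T t
      rwa [hBAf] at this
    have hzd' : ∀ t, HasDerivAt z' (-sineFamily (sturmLiouville q) (T - t) Af) t := fun t => by
      have := ((hasDerivAt_cosineFamily hA hd (T - t) Af).comp_const_sub T t).neg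
      rwa [neg_neg] at this
    set u' : ℝ → L2Half := derivWithin u (Ici 0) with hu'
    have hus : ContDiffOn ℝ ∞ u' (Ici 0) := (hu.smooth.derivWithin (uniqueDiffOn_Ici 0) (by simp))
    -- The Wronskian of `u` with the backward wave `z`. Since `z` stays in `Dom L₀`, `m' = -(A* u,
    -- z) + (u, L₀ z) = 0` without boundary terms; `m` is zero at `0` and equals `(u(T), φ)` at `T`.
    set m : ℝ → ℂ := fun t => inner ℂ (u' t) (z t) - inner ℂ (u t) (z' t) with hm
    have hmc : ContinuousOn m (Icc 0 T) := by
      have h1 : ContinuousOn u (Icc 0 T) := hu.smooth.continuousOn.mono Icc_subset_Ici_self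
      have h2 : ContinuousOn u' (Icc 0 T) := hus.continuousOn.mono Icc_subset_Ici_self
      have h3 : Continuous z := continuous_iff_continuousAt.2 fun t => (hzd t).continuousAt
      have h4 : Continuous z' := continuous_iff_continuousAt.2 fun t => (hzd' t).continuousAt
      exact (h2.inner h3.continuousOn).sub (h1.inner h4.continuousOn)
    have hmd : ∀ t ∈ Ioo 0 T, HasDerivAt m 0 t := by
      intro t ht
      have hnhds : Ici (0 : ℝ) ∈ 𝓝 t := Ici_mem_nhds ht.1
      have h1 : HasDerivAt u (u' t) t :=
        ((hu.smooth.differentiableOn (by simp)) t ht.1.le).hasDerivWithinAt.hasDerivAt hnhds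
      have h2 : HasDerivAt u' (iteratedDerivWithin 2 u (Ici 0) t) t := by
        rw [iteratedDerivWithin_succ, iteratedDerivWithin_one]
        exact ((hus.differentiableOn (by simp)) t ht.1.le).hasDerivWithinAt.hasDerivAt hnhds
      obtain ⟨y, hy, -, heq⟩ := hu.equation t ht.1.le
      have h3 : HasDerivAt u' (-(sturmLiouville q).adjoint y) t :=
        h2.congr_deriv (eq_neg_of_add_eq_zero_left (heq ht.1))
      refine ((h3.inner ℂ (hzd t)).sub (h1.inner ℂ (hzd' t))).congr_deriv ?_
      obtain ⟨ζ, hζ1, hζ2⟩ := exists_domain_sineFamily hq hA hφ (a := a) (s := T - t) ha0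
        (by linarith [ht.2]) (fun r hr => ha r (by linarith [ht.1]))
      have hadj := LinearPMap.adjoint_isFormalAdjoint hd y ζ
      rw [inner_neg_left, ← hy, ← hζ2,
        show z t = (ζ : L2Half) from hζ1.symm, hadj]
      simp only [inner_neg_right]
      ring
    have hint := intervalIntegral.integral_eq_sub_of_hasDerivAt_of_le hT hmc hmd
      intervalIntegrable_const
    simp only [intervalIntegral.integral_zero] at hint
    have hu0 : u' 0 = 0 := hu.init_deriv
    have hm0 : m 0 = 0 := by simp only [hm, hu.init, hu0, inner_zero_left, sub_zero]
    have hmT : m T = inner ℂ (u T) f := by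
      simp only [hm, hz, hz', sub_self, sineFamily_zero, cosineFamily_zero hA hd, hBAf]
      simp
    rw [hm0, hmT, sub_zero] at hint
    rw [← inner_conj_symm, ← hint, map_zero]
  change ∀ᵐ x ∂halfLine, x ∉ Ioo 0 T → u T x = 0
  filter_upwards [key, ae_restrict_mem measurableSet_Ioi,
    ae_restrict_of_ae (Measure.ae_ne volume T)] with x h1 hx hxT h2
  refine h1 (lt_of_le_of_ne ?_ hxT.symm)
  by_contra hlt
  exact h2 ⟨hx, not_le.1 hlt⟩

omit hq in
theorem inner_mollify_comm (hd : Dense ((sturmLiouville q).domain : Set L2Half)) {φ : ℝ → ℝ}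
    (hφ : Continuous φ) (hc : HasCompactSupport φ) (k y : L2Half) :
    inner ℂ k (mollify φ (fun s => sineFamily (sturmLiouville q) s y) 0) =
      inner ℂ (mollify φ (fun s => sineFamily (sturmLiouville q) s k) 0) y := by
  rw [← inner_conj_symm _ y, inner_mollify hA hd hφ hc, inner_mollify hA hd hφ hc, ← integral_conj]
  congr 1
  ext s
  rw [← inner_sineFamily, ← inner_conj_symm, Complex.real_smul, Complex.real_smul, map_mul,
    Complex.conj_ofReal]

/-- The waves generated by boundary controls are complete in the filled region. -/
theorem le_closure_reachableSet (T : ℝ) :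
    L2On (Ioo 0 T) ≤ (Submodule.span ℂ (reachableSet (sturmLiouville q) T)).closure := by
  have hd := dense_domain hq
  have hc := hq.continuousOn
  intro z hz
  refine mem_of_forall_orthogonal fun y hy => ?_
  suffices h : ∀ᵐ x ∂halfLine, |x - 0| < T → y x = 0 by
    rw [← inner_conj_symm, inner_eq_zero_of_mem hz, map_zero]
    rw [mem_L2On]
    filter_upwards [h] with x h1 h2
    rw [mem_compl_iff, not_not] at h2
    exact h1 (by rw [sub_zero, abs_of_pos h2.1]; exact h2.2)
  have hort : ∀ w ∈ reachableSet (sturmLiouville q) T, inner ℂ y w = 0 := fun w hw => by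
    rw [← inner_conj_symm, hy w (Submodule.le_topologicalClosure _ (Submodule.subset_span hw)),
      map_zero]
  -- Continuation from `p = 0`. Only the slope of the averaged wave has to be treated; it depends on
  -- a vector that orthogonality to the controlled waves makes orthogonal to `Ker L₀*`.
  refine eq_zero_of_meanWave hq hA fun φ hφ => ?_
  have hev : oddEval q 0 = 0 := by rw [oddEval_of_nonneg hc le_rfl, solutionEval_zero hc]
  refine ⟨by rw [hev, _root_.zero_apply], ?_⟩
  rw [oddDeriv, intervalIntegral.integral_same, add_zero, ContinuousLinearMap.comp_apply]
  refine eq_zero_of_orthogonal_ker_adjoint hd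
    (fun ζ => initialSlope_of_domain hc hA hd ζ) fun k hk => ?_
  rw [hφ.boundedInverse_meanWave hA hd, inner_neg_right, neg_eq_zero]
  have hcut := hφ.deriv.deriv
  have hw := hort _ (hφ.neg_mollify_mem_reachableSet hA hd hk)
  rw [inner_neg_right, neg_eq_zero] at hw
  rw [inner_mollify_comm hA hd hcut.contDiff.continuous hcut.hasCompactSupport, ← inner_conj_symm,
    hw, map_zero]

/-- The reachable subspaces. -/
theorem closure_reachableSet {T : ℝ} (hT : 0 ≤ T) :
    (Submodule.span ℂ (reachableSet (sturmLiouville q) T)).closure = L2On (Ioo 0 T) :=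
  le_antisymm (Submodule.closure_le.2 (Submodule.span_le.2 (reachableSet_subset hq hA hT)))
    (le_closure_reachableSet hq hA T)

end Reachable

end WaveSpectrum

end

noncomputable section

namespace WaveSpectrum

/-! ### Convergence of the subspaces `L₂(E)` -/

section Convergence

theorem starProjection_L2On {E : Set ℝ} (hE : MeasurableSet E) (y : L2Half) :
    (L2On E).toSubmodule.starProjection y = restrictTo E hE y := by
  refine Submodule.eq_starProjection_of_mem_of_inner_eq_zero (restrictTo_mem hE y) fun w hw => ?_
  rw [← inner_conj_symm, inner_eq_zero_of_mem hw, map_zero]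
  rw [mem_L2On]
  filter_upwards [coeFn_restrictTo hE y, Lp.coeFn_sub y (restrictTo E hE y)] with x h1 h2 hx
  rw [h2, Pi.sub_apply, h1, indicator_of_mem (not_not.1 hx), sub_self]

theorem restrictTo_of_mem {E : Set ℝ} (hE : MeasurableSet E) {y : L2Half} (hy : y ∈ L2On E) :
    restrictTo E hE y = y := by
  refine Lp.ext ?_
  filter_upwards [coeFn_restrictTo hE y, mem_L2On.1 hy] with x h1 h2
  rw [h1]
  by_cases hx : x ∈ E
  · rw [indicator_of_mem hx]
  · rw [indicator_of_notMem hx, h2 hx]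

/-- Dominated convergence with the majorant `(2 ‖y‖)²`. Only points where `y` does not vanish are
tested, so the sets may behave arbitrarily elsewhere. -/
theorem tendsto_restrictTo {E : ℕ → Set ℝ} {F : Set ℝ} (hE : ∀ n, MeasurableSet (E n))
    (hF : MeasurableSet F) {y : L2Half}
    (h : ∀ᵐ x ∂halfLine, y x ≠ 0 → ∀ᶠ n in atTop, (x ∈ E n ↔ x ∈ F)) :
    Tendsto (fun n => restrictTo (E n) (hE n) y) atTop (𝓝 (restrictTo F hF y)) := by
  have hle : ∀ (S : Set ℝ) (x : ℝ), ‖S.indicator y x‖ ≤ ‖y x‖ := fun S x =>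
    norm_indicator_le_norm_self _ _
  set g : ℕ → L2Half := fun n => restrictTo (E n) (hE n) y - restrictTo F hF y with hg
  have hgx : ∀ n, g n =ᵐ[halfLine] fun x => (E n).indicator y x - F.indicator y x := by
    intro n
    filter_upwards [coeFn_restrictTo (hE n) y, coeFn_restrictTo hF y,
      Lp.coeFn_sub (restrictTo (E n) (hE n) y) (restrictTo F hF y)] with x h1 h2 h3
    rw [hg, h3, Pi.sub_apply, h1, h2]
  have hbound : Integrable (fun x => (2 * ‖y x‖) ^ 2) halfLine := by
    have := ((Lp.memLp y).integrable_norm_pow (by norm_num)).const_mul (4 : ℝ)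
    refine this.congr (Eventually.of_forall fun x => ?_)
    norm_num
    ring
  have hlim : Tendsto (fun n => ∫ x, ‖g n x‖ ^ 2 ∂halfLine) atTop (𝓝 0) := by
    have := tendsto_integral_of_dominated_convergence (μ := halfLine) (f := fun _ => (0 : ℝ))
      (F := fun n x => ‖g n x‖ ^ 2) (fun x => (2 * ‖y x‖) ^ 2)
      (fun n => (Lp.aestronglyMeasurable (g n)).norm.pow 2) hbound (fun n => ?_) ?_
    · simpa using this
    · filter_upwards [hgx n] with x hx
      rw [hx, Real.norm_of_nonneg (by positivity)]
      refine pow_le_pow_left₀ (norm_nonneg _) ((norm_sub_le _ _).trans ?_) 2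
      linarith [hle (E n) x, hle F x]
    · filter_upwards [h, ae_all_iff.2 hgx] with x h1 h2
      refine tendsto_const_nhds.congr' ?_
      by_cases hx : y x = 0
      · refine Eventually.of_forall fun n => ?_
        have : ∀ S : Set ℝ, S.indicator y x = 0 := fun S => by
          by_cases hxS : x ∈ S <;> simp [hxS, hx]
        simp only [h2, this, sub_zero, norm_zero]
        norm_num
      · filter_upwards [h1 hx] with n hn
        have : (E n).indicator y x = F.indicator y x := by
          by_cases hxF : x ∈ F
          · rw [indicator_of_mem hxF, indicator_of_mem (hn.2 hxF)]
          · rw [indicator_of_notMem hxF, indicator_of_notMem fun h => hxF (hn.1 h)]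
        rw [h2, this]
        simp
  have hnorm : ∀ n, ∫ x, ‖g n x‖ ^ 2 ∂halfLine = ‖g n‖ ^ 2 := by
    intro n
    have h1 : inner ℂ (g n) (g n) = ((∫ x, ‖g n x‖ ^ 2 ∂halfLine : ℝ) : ℂ) := by
      rw [L2.inner_def]
      refine (integral_congr_ae (Eventually.of_forall fun x => ?_)).trans integral_ofReal
      simp only [inner_self_eq_norm_sq_to_K]
      norm_cast
    have h2 := congrArg RCLike.re h1
    rw [inner_self_eq_norm_sq (𝕜 := ℂ)] at h2
    exact h2.symm
  simp only [hnorm] at hlim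
  have h2 := hlim.sqrt
  simp only [Real.sqrt_sq (norm_nonneg _), Real.sqrt_zero] at h2
  exact tendsto_iff_norm_sub_tendsto_zero.2 h2

theorem ae_imp_of_L2On_le {E F : Set ℝ} (hE : MeasurableSet E) (hfin : halfLine E ≠ ⊤)
    (h : L2On E ≤ L2On F) : ∀ᵐ x ∂halfLine, x ∈ E → x ∈ F := by
  set y : L2Half := indicatorConstLp 2 hE hfin 1 with hy
  have hyE : y ∈ L2On E := by
    rw [mem_L2On]
    filter_upwards [indicatorConstLp_coeFn (p := 2) (hs := hE) (hμs := hfin) (c := (1 : ℂ))]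
      with x hx hxE
    rw [hx, indicator_of_notMem hxE]
  filter_upwards [mem_L2On.1 (h hyE),
    indicatorConstLp_coeFn (p := 2) (hs := hE) (hμs := hfin) (c := (1 : ℂ))] with x h1 h2 hxE
  by_contra hxF
  have h3 := h1 hxF
  rw [h2, indicator_of_mem hxE] at h3
  exact one_ne_zero h3

theorem not_ae_notMem_Ioo {a b : ℝ} (ha : 0 ≤ a) (hab : a < b) :
    ¬∀ᵐ x ∂halfLine, x ∉ Ioo a b := by
  intro h
  have h1 : halfLine (Ioo a b) = 0 := measure_eq_zero_iff_ae_notMem.2 h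
  have h2 : Ioo a b ⊆ Ioi 0 := fun x hx => ha.trans_lt hx.1
  rw [Measure.restrict_apply measurableSet_Ioo, inter_eq_left.2 h2, Real.volume_Ioo] at h1
  simp only [ENNReal.ofReal_eq_zero] at h1
  linarith

theorem omega_eq (x : ℝ) (t : ℝ≥0) : omega x t = L2On (Metric.ball x t) := by
  refine L2On_congr ?_
  filter_upwards [ae_restrict_mem measurableSet_Ioi] with z hz
  rw [neighborhood, Metric.thickening_singleton]
  exact ⟨fun h => h.1, fun h => ⟨h, (mem_Ioi.1 hz).le⟩⟩

theorem omega_zero (x : ℝ) : omega x 0 = ⊥ := by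
  rw [omega_eq, NNReal.coe_zero, Metric.ball_zero, L2On_empty]

theorem ae_imp_of_L2On_ball_le {x s : ℝ} {F : Set ℝ} (h : L2On (Metric.ball x s) ≤ L2On F) :
    ∀ᵐ z ∂halfLine, z ∈ Metric.ball x s → z ∈ F := by
  refine ae_imp_of_L2On_le measurableSet_ball ?_ h
  exact ((Measure.restrict_apply_le _ _).trans_lt measure_ball_lt_top).ne

/-- At radius `|p - x| / 2` the two balls are disjoint, while the one about `p ≥ 0` has positive
measure in the half-line. -/
theorem eq_of_omega_le {p x : ℝ} (hp : 0 ≤ p) (h : ∀ t : ℝ≥0, t ≠ 0 → omega p t ≤ omega x t) :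
    p = x := by
  by_contra hne
  have hpos : 0 < |p - x| / 2 := half_pos (abs_pos.2 (sub_ne_zero.2 hne))
  obtain ⟨s, hs⟩ : ∃ s : ℝ≥0, (s : ℝ) = |p - x| / 2 := ⟨⟨_, hpos.le⟩, rfl⟩
  have h1 := h s (by
    rintro rfl
    exact hpos.ne hs)
  rw [omega_eq, omega_eq, hs] at h1
  refine not_ae_notMem_Ioo hp (lt_add_of_pos_right p hpos) ?_
  filter_upwards [ae_imp_of_L2On_ball_le h1] with z hz hzI
  have h2 : |z - p| < |p - x| / 2 := by
    rw [abs_of_pos (sub_pos.2 hzI.1)]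
    linarith [hzI.2]
  have h3 := hz (by rwa [Metric.mem_ball, Real.dist_eq])
  rw [Metric.mem_ball, Real.dist_eq] at h3
  have h4 := abs_sub_le p z x
  rw [abs_sub_comm p z] at h4
  linarith

theorem omega_ne_bot {x : ℝ} (hx : 0 ≤ x) : omega x ≠ ⊥ := by
  intro h
  have h1 : omega x 1 = ⊥ := congrFun h 1
  rw [omega_eq, ← L2On_empty] at h1
  refine not_ae_notMem_Ioo hx (lt_add_one x) ?_
  filter_upwards [ae_imp_of_L2On_ball_le h1.le] with z hz hzI
  refine hz ?_
  rw [Metric.mem_ball, Real.dist_eq, abs_of_pos (sub_pos.2 hzI.1), NNReal.coe_one]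
  linarith [hzI.2]

end Convergence

/-! ### The wave spectrum -/

section Spectrum

variable {q : ℝ → ℝ} (hq : ContDiffOn ℝ ∞ q (Ici 0)) (hA : IsPositiveDefinite (sturmLiouville q))

include hq hA

/-- The wave lattice consists of the subspaces `L₂(E)`. -/
theorem exists_eq_L2On_of_mem_waveLattice {G : ClosedSubmodule ℂ L2Half}
    (hG : G ∈ waveLattice (sturmLiouville q)) : ∃ E, MeasurableSet E ∧ G = L2On E := by
  -- By minimality it suffices that all the `L₂(E)` form an invariant lattice containing the
  -- reachable subspaces.
  refine hG {G | ∃ E, MeasurableSet E ∧ G = L2On E} ⟨⟨?_, ?_, ?_, ?_, ?_⟩, ?_, ?_⟩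
  · exact ⟨∅, MeasurableSet.empty, L2On_empty.symm⟩
  · exact ⟨univ, MeasurableSet.univ, L2On_univ.symm⟩
  · rintro _ ⟨E, hE, rfl⟩ _ ⟨F, hF, rfl⟩
    exact ⟨E ∪ F, hE.union hF, L2On_sup hE⟩
  · rintro _ ⟨E, hE, rfl⟩ _ ⟨F, hF, rfl⟩
    exact ⟨E ∩ F, hE.inter hF, L2On_inf⟩
  · rintro _ ⟨E, hE, rfl⟩
    exact ⟨Eᶜ, hE.compl, orthogonal_L2On hE⟩
  · rintro _ ⟨T, hT, rfl⟩
    exact ⟨Ioo 0 T, measurableSet_Ioo, closure_reachableSet hq hA hT⟩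
  · ext K
    constructor
    · rintro ⟨t, _, ⟨E, hE, rfl⟩, rfl⟩
      rcases eq_or_ne t 0 with rfl | ht
      · exact ⟨E, hE, by rw [waveIsotony, if_pos rfl]⟩
      · exact ⟨_, Metric.isOpen_thickening.measurableSet, waveIsotony_L2On hq hA hE ht⟩
    · intro hK
      exact ⟨0, K, hK, by rw [waveIsotony, if_pos rfl]⟩

/-- A half-open interval is obtained from `L₂(0,b)` and the orthogonal complement of `L₂(0,a)`,
without using the isotony. -/
theorem L2On_mem_waveLattice {a b : ℝ} (ha : 0 ≤ a) (hb : 0 ≤ b) :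
    L2On (Ioo 0 b ∩ (Ioo 0 a)ᶜ) ∈ waveLattice (sturmLiouville q) := by
  rintro S ⟨hS, hR, -⟩
  have h : ∀ T, 0 ≤ T → L2On (Ioo 0 T) ∈ S := fun T hT =>
    hR ⟨T, hT, (closure_reachableSet hq hA hT).symm⟩
  have := hS.inf_mem _ (h b hb) _ (hS.orthogonal_mem _ (h a ha))
  rwa [orthogonal_L2On measurableSet_Ioo, L2On_inf] at this

theorem omega_mem_sequentialClosure {x : ℝ} (hx : 0 ≤ x) : omega x ∈ sequentialClosure
    (isotonyFunctions (waveIsotony (sturmLiouville q)) (waveLattice (sturmLiouville q))) := by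
  set ε : ℕ → ℝ := fun n => 1 / ((n : ℝ) + 1) with hε
  have hε0 : ∀ n, 0 < ε n := fun n => Nat.one_div_pos_of_nat
  have hεlim : Tendsto ε atTop (𝓝 0) := tendsto_one_div_add_atTop_nhds_zero_nat
  -- Intervals shrinking to `x`, cut at `0` because reachable subspaces exist only for `T ≥ 0`.
  set E : ℕ → Set ℝ := fun n => Ioo 0 (x + ε n) ∩ (Ioo 0 (max (x - ε n) 0))ᶜ with hE
  have hEm : ∀ n, MeasurableSet (E n) := fun n => measurableSet_Ioo.inter measurableSet_Ioo.compl
  have hEsub : ∀ n, E n ⊆ Metric.closedBall x (ε n) := by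
    rintro n z ⟨h1, h2⟩
    rw [Metric.mem_closedBall, Real.dist_eq, abs_le]
    have h3 : max (x - ε n) 0 ≤ z := by
      by_contra hlt
      exact h2 ⟨h1.1, not_le.1 hlt⟩
    constructor <;> linarith [h1.2, le_max_left (x - ε n) 0]
  have hFsub : ∀ n, essentialClosure (E n) ⊆ Metric.closedBall x (ε n) := fun n =>
    Measure.support_restrict_subset.trans (inter_subset_left.trans
      (closure_minimal (inter_subset_left.trans (hEsub n)) Metric.isClosed_closedBall))
  have hFne : ∀ n, (essentialClosure (E n)).Nonempty := by
    intro n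
    refine Measure.nonempty_support fun h0 => ?_
    refine not_ae_notMem_Ioo hx (lt_add_of_pos_right x (hε0 n)) ?_
    rw [ae_restrict_iff' measurableSet_Ioi]
    have h1 := Measure.restrict_eq_zero.1 h0
    filter_upwards [measure_eq_zero_iff_ae_notMem.1 h1] with z hz hz0 hzI
    refine hz ⟨⟨⟨hz0, hzI.2⟩, fun h2 => ?_⟩, hz0⟩
    exact absurd h2.2 (not_lt.2 (max_le (by linarith [hzI.1, hε0 n]) (mem_Ioi.1 hz0).le))
  refine ⟨fun n t => waveIsotony (sturmLiouville q) t (L2On (E n)), fun n => ⟨L2On (E n),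
    L2On_mem_waveLattice hq hA (le_max_right _ _) (by linarith [hε0 n]), rfl⟩, fun t y => ?_⟩
  rw [omega_eq, starProjection_L2On measurableSet_ball]
  rcases eq_or_ne t 0 with rfl | ht
  -- At `t = 0` the sets themselves shrink to the null set `{x}`, in accordance with the empty ball
  -- of radius `0`.
  · simp only [waveIsotony, if_true, starProjection_L2On (hEm _)]
    refine tendsto_restrictTo hEm measurableSet_ball ?_
    filter_upwards [ae_restrict_of_ae (Measure.ae_ne volume x)] with z hz _
    have hpos : 0 < |z - x| := abs_pos.2 (sub_ne_zero.2 hz)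
    filter_upwards [hεlim.eventually (gt_mem_nhds hpos)] with n hn
    refine iff_of_false (fun h => ?_) (by simp)
    have := hEsub n h
    rw [Metric.mem_closedBall, Real.dist_eq] at this
    linarith
  · have hT : ∀ n, MeasurableSet (Metric.thickening (t : ℝ) (essentialClosure (E n))) := fun n =>
      Metric.isOpen_thickening.measurableSet
    simp only [waveIsotony_L2On hq hA (hEm _) ht, starProjection_L2On (hT _)]
    refine tendsto_restrictTo hT measurableSet_ball ?_
    filter_upwards [ae_restrict_of_ae (Measure.ae_ne volume (x + t)),
      ae_restrict_of_ae (Measure.ae_ne volume (x - t))] with z h1 h2 _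
    have hne : |z - x| ≠ t := by
      intro h
      rcases abs_eq t.coe_nonneg |>.1 h with h3 | h3
      · exact h1 (by linarith)
      · exact h2 (by linarith)
    -- Off the null set `|z - x| = t` membership is settled once `ε n` is below the distance of `|z
    -- - x|` from `t`. The inner case needs the essential closure to be nonempty, the outer one that
    -- it is small.
    rcases hne.lt_or_gt with hlt | hgt
    · filter_upwards [hεlim.eventually (gt_mem_nhds (sub_pos.2 hlt))] with n hn
      refine iff_of_true ?_ (by rwa [Metric.mem_ball, Real.dist_eq])
      obtain ⟨p, hp⟩ := hFne n
      refine Metric.mem_thickening_iff.2 ⟨p, hp, ?_⟩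
      have h3 := hFsub n hp
      rw [Metric.mem_closedBall] at h3
      have h4 := dist_triangle_right z p x
      rw [Real.dist_eq z x] at h4
      linarith
    · filter_upwards [hεlim.eventually (gt_mem_nhds (sub_pos.2 hgt))] with n hn
      refine iff_of_false (fun h => ?_) (by
        rw [Metric.mem_ball, Real.dist_eq]; exact not_lt.2 hgt.le)
      obtain ⟨p, hp, hzp⟩ := Metric.mem_thickening_iff.1 h
      have h3 := hFsub n hp
      rw [Metric.mem_closedBall] at h3
      have h4 := dist_triangle z p x
      rw [Real.dist_eq z x] at h4
      linarith

/-- Every nonzero element of the closure that lies below some `ω_x` lies above some `ω_p`. -/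
theorem exists_omega_le {x : ℝ} {g : ℝ≥0 → ClosedSubmodule ℂ L2Half}
    (hg : g ∈ sequentialClosure (isotonyFunctions (waveIsotony (sturmLiouville q))
      (waveLattice (sturmLiouville q)))) (hg0 : g ≠ ⊥) (hgx : g ≤ omega x) :
    ∃ p, 0 ≤ p ∧ ∀ s : ℝ≥0, s ≠ 0 → omega p s ≤ g s := by
  obtain ⟨φ, hφ, hlim⟩ := hg
  choose G hG hφG using hφ
  choose E hE hGE using fun n => exists_eq_L2On_of_mem_waveLattice hq hA (hG n)
  have hT : ∀ (s : ℝ≥0) n, MeasurableSet (Metric.thickening (s : ℝ) (essentialClosure (E n))) :=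
    fun s n => Metric.isOpen_thickening.measurableSet
  have hproj : ∀ (s : ℝ≥0), s ≠ 0 → ∀ n y, (φ n s).toSubmodule.starProjection y =
      restrictTo _ (hT s n) y := by
    intro s hs n y
    have h : φ n s = L2On (Metric.thickening (s : ℝ) (essentialClosure (E n))) := by
      rw [hφG]
      change waveIsotony (sturmLiouville q) s (G n) = _
      rw [hGE, waveIsotony_L2On hq hA (hE n) hs]
    rw [h, starProjection_L2On (hT s n)]
  obtain ⟨t, ht⟩ : ∃ t, g t ≠ ⊥ := by
    by_contra h
    push Not at h
    exact hg0 (funext h)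
  have ht0 : t ≠ 0 := by
    rintro rfl
    exact ht (bot_unique ((hgx 0).trans (omega_zero x).le))
  obtain ⟨y, hy, hy0⟩ : ∃ y ∈ g t, y ≠ 0 := by
    by_contra h
    push Not at h
    exact ht (bot_unique fun y hy => h y hy)
  -- Otherwise the `t`-neighbourhoods eventually miss the ball about `x` where `y` lives, and the
  -- projections of `y ∈ g t` tend to `0` instead of `y`.
  have hfreq : ∃ᶠ n in atTop, ∃ p ∈ essentialClosure (E n), p ∈ Metric.closedBall x (2 * t) := by
    intro hcon
    have h1 : (fun n => (φ n t).toSubmodule.starProjection y) =ᶠ[atTop] fun _ => 0 := by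
      filter_upwards [hcon] with n hn
      rw [hproj t ht0]
      refine (Lp.eq_zero_iff_ae_eq_zero).2 ?_
      have hyx := hgx t hy
      rw [omega_eq] at hyx
      filter_upwards [coeFn_restrictTo (hT t n) y, mem_L2On.1 hyx] with z h1 h2
      rw [h1]
      by_cases hz : z ∈ Metric.thickening (t : ℝ) (essentialClosure (E n))
      · rw [indicator_of_mem hz]
        refine h2 fun hzx => hn ?_
        obtain ⟨p, hp, hzp⟩ := Metric.mem_thickening_iff.1 hz
        refine ⟨p, hp, ?_⟩
        rw [Metric.mem_closedBall]
        rw [Metric.mem_ball] at hzx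
        linarith [dist_triangle_left p x z]
      · rw [indicator_of_notMem hz]
        rfl
    have h2 := tendsto_nhds_unique ((hlim t y).congr' h1) tendsto_const_nhds
    have : CompleteSpace (g t).toSubmodule := (g t).isClosed.completeSpace_coe
    rw [Submodule.starProjection_eq_self_iff.2 hy] at h2
    exact hy0 h2
  obtain ⟨ψ, hψ, hp⟩ := extraction_of_frequently_atTop hfreq
  choose p hpE hpx using hp
  obtain ⟨a, -, θ, hθ, ha⟩ := (isCompact_closedBall x (2 * (t : ℝ))).tendsto_subseq hpx
  refine ⟨a, isClosed_Ici.mem_of_tendsto ha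
    (Eventually.of_forall fun n => essentialClosure_subset _ (hpE (θ n))), fun s hs z hz => ?_⟩
  rw [omega_eq] at hz
  have h1 : Tendsto (fun n => (φ (ψ (θ n)) s).toSubmodule.starProjection z) atTop
      (𝓝 ((g s).toSubmodule.starProjection z)) :=
    (hlim s z).comp (hψ.comp hθ).tendsto_atTop
  simp only [hproj s hs] at h1
  -- Each point of the `s`-ball about `a` is eventually within `s` of `p (θ n)`, so the projections
  -- of `z` tend to `z` itself. The limit set may be `univ`, as only points of the ball count.
  have h2 := tendsto_restrictTo (y := z) (fun n => hT s (ψ (θ n))) MeasurableSet.univ (by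
    filter_upwards [mem_L2On.1 hz] with w hw hw0
    have hwa : w ∈ Metric.ball a s := by
      by_contra h
      exact hw0 (hw h)
    have h3 : ∀ᶠ n in atTop, dist w (p (θ n)) < s :=
      (tendsto_const_nhds.dist ha).eventually (gt_mem_nhds hwa)
    filter_upwards [h3] with n hn
    exact iff_of_true (Metric.mem_thickening_iff.2 ⟨_, hpE (θ n), hn⟩) (mem_univ w))
  have h3 := tendsto_nhds_unique h1 h2
  rw [restrictTo_of_mem MeasurableSet.univ (by rw [L2On_univ]; trivial)] at h3
  rw [← h3]
  exact Submodule.starProjection_apply_mem _ _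

/-- The functions `ω_x` belong to the wave spectrum. -/
theorem omega_mem_waveSpectrum {x : ℝ} (hx : 0 ≤ x) :
    omega x ∈ waveSpectrum (sturmLiouville q) := by
  refine ⟨omega_mem_sequentialClosure hq hA hx, omega_ne_bot hx, fun g hg hg0 hgx => ?_⟩
  obtain ⟨p, hp, hpg⟩ := exists_omega_le hq hA hg hg0 hgx
  obtain rfl := eq_of_omega_le hp fun t ht => (hpg t ht).trans (hgx t)
  refine le_antisymm hgx fun t => ?_
  rcases eq_or_ne t 0 with rfl | ht
  · rw [omega_zero]
    exact bot_le
  · exact hpg t ht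

end Spectrum

end WaveSpectrum

end

theorem lemma6 (q : ℝ → ℝ) (hq : ContDiffOn ℝ ∞ q (Ici 0)) (hlp : WaveSpectrum.IsLimitPoint q)
    (hpos : WaveSpectrum.IsPositiveDefinite (WaveSpectrum.sturmLiouville q))
    (x : ℝ) (hx : 0 ≤ x) :
    WaveSpectrum.omega x ∈ WaveSpectrum.waveSpectrum (WaveSpectrum.sturmLiouville q) := by
  exact WaveSpectrum.omega_mem_waveSpectrum hq hpos hx
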